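/- For a rational number $q$ let $C_q=\frac{1}{q+1}\binom{2q}{q}$ be the $q$-th Catalan number if $q$ is a nonnegative integer, and let $C_q=0$ otherwise. A $k$-dissection of a convex $n$-gon is a set of $k$ pairwise non-crossing diagonals of it (which divides the $n$-gon into $k+1$ polygons); $G(n,k)$ is the set of $k$-dissections of the regular $n$-gon. The cyclic group $Z_n$ of rotations and the dihedral group $D_{2n}$ of all $2n$ symmetries of the regular $n$-gon act on $G(n,k)$. **Theorem 3.** Let $n\ge 5$. 1. The number $|G(n,n-5)/Z_n|$ of $(n-5)$-dissections of an $n$-gon modulo the cyclic action (equivalently, the number of two-dimensional faces of the $(n-3)$-dimensional associahedron, modulo the cyclic action) is $$\frac{(n-3)^2(n-4)}{4n(2n-5)}\,C_{n-2}+\frac{n-4}{8}\,C_{n/2-1}+\frac45\,C_{n/5-1}.$$ 2. The number $|G(n,n-5)/D_{2n}|$ of $(n-5)$-dissections of an $n$-gon modulo the dihedral action (equivalently, the number of two-dimensional faces of the $(n-3)$-dimensional associahedron, modulo the dihedral action) is $$\frac{(n-3)^2(n-4)}{8n(2n-5)}\,C_{n-2}+\frac25\,C_{n/5-1}+\frac{3(n-4)(n-1)}{16(n-3)}\,C_{n/2-1}$$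 if $n$ is even, and $$\frac{(n-3)^2(n-4)}{8n(2n-5)}\,C_{n-2}+\frac25\,C_{n/5-1}+\frac{n^2-2n-11}{8(n-4)}\,C_{(n-3)/2}$$ if $n$ is odd. Here the faces of the associahedron of an $n$-gon are the dissections of the $n$-gon, a face $\Phi$ being contained in a face $\Psi$ if and only if every diagonal of $\Psi$ is a diagonal of $\Phi$, and the dimension of a face is its height in this poset of nonempty faces. -/

import Mathlib

namespace PolygonDissection

/-- The dihedral group of order `2n` acts on the vertices of the `n`-gon, labelled cyclically by
`ZMod n`: `r i` is the rotation `v ↦ v + i`, and `sr i` is the reflection `v ↦ -i - v`. -/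
instance vertexAction (n : ℕ) : MulAction (DihedralGroup n) (ZMod n) where
  smul g v := match g with
    | DihedralGroup.r i => v + i
    | DihedralGroup.sr i => -i - v
  one_smul v := add_zero v
  mul_smul g h v := by
    rcases g with i | i <;> rcases h with j | j
    · change v + (i + j) = v + j + i
      ring
    · change -(j - i) - v = (-j - v) + i
      ring
    · change -(i + j) - v = -i - (v + j)
      ring
    · change v + (j - i) = -i - (-j - v)
      ring

theorem r_smul {n : ℕ} (i v : ZMod n) : DihedralGroup.r i • v = v + i := rfl

theorem sr_smul {n : ℕ} (i v : ZMod n) : DihedralGroup.sr i • v = -i - v := rfl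

/-- A diagonal of the `n`-gon: an unordered pair of distinct, non-adjacent vertices. -/
def IsDiagonal {n : ℕ} (e : Sym2 (ZMod n)) : Prop :=
  ∃ a b : ZMod n, e = s(a, b) ∧ a ≠ b ∧ b ≠ a + 1 ∧ a ≠ b + 1

/-- Two chords cross (in the interior of the polygon): with the vertices labelled `0, …, n - 1`
in cyclic order, their endpoints interlace, i.e. the chords are `ab` and `cd` with
`a < c < b < d` or `c < a < d < b`. -/
def Crosses {n : ℕ} (e f : Sym2 (ZMod n)) : Prop :=
  ∃ a b c d : ZMod n, e = s(a, b) ∧ f = s(c, d) ∧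
    ((a.val < c.val ∧ c.val < b.val ∧ b.val < d.val) ∨
      (c.val < a.val ∧ a.val < d.val ∧ d.val < b.val))

/-- The action of a symmetry of the polygon on chords. -/
def moveChord {n : ℕ} (g : DihedralGroup n) (e : Sym2 (ZMod n)) : Sym2 (ZMod n) :=
  e.map (g • ·)

theorem moveChord_one {n : ℕ} (e : Sym2 (ZMod n)) : moveChord 1 e = e := by
  induction e with
  | _ a b => simp [moveChord]

theorem moveChord_mul {n : ℕ} (g h : DihedralGroup n) (e : Sym2 (ZMod n)) :
    moveChord (g * h) e = moveChord g (moveChord h e) := by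
  induction e with
  | _ a b => simp [moveChord, mul_smul]

theorem isDiagonal_moveChord {n : ℕ} (g : DihedralGroup n) {e : Sym2 (ZMod n)}
    (he : IsDiagonal e) : IsDiagonal (moveChord g e) := by
  obtain ⟨a, b, rfl, h1, h2, h3⟩ := he
  refine ⟨g • a, g • b, by simp [moveChord], fun h => h1 (MulAction.injective g h), ?_, ?_⟩ <;>
    rcases g with i | i <;> simp only [r_smul, sr_smul] <;> intro h
  · exact h2 (by linear_combination h)
  · exact h3 (by linear_combination h)
  · exact h3 (by linear_combination h)
  · exact h2 (by linear_combination h)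

theorem val_add_cases {n : ℕ} [NeZero n] (u v w : ZMod n) (h : u + v = w) :
    u.val + v.val = w.val ∨ u.val + v.val = w.val + n := by
  subst h
  rcases lt_or_ge (u.val + v.val) n with h | h
  · exact Or.inl (ZMod.val_add_of_lt h).symm
  · exact Or.inr (ZMod.val_add_val_of_le h)

theorem crosses_moveChord {n : ℕ} [NeZero n] (g : DihedralGroup n) {e f : Sym2 (ZMod n)}
    (h : Crosses e f) : Crosses (moveChord g e) (moveChord g f) := by
  obtain ⟨a, b, c, d, rfl, rfl, h⟩ := h
  have key : ∀ a b c d : ZMod n,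
      (a.val < c.val ∧ c.val < b.val ∧ b.val < d.val) ∨
      (c.val < a.val ∧ a.val < d.val ∧ d.val < b.val) ∨
      (b.val < c.val ∧ c.val < a.val ∧ a.val < d.val) ∨
      (c.val < b.val ∧ b.val < d.val ∧ d.val < a.val) ∨
      (a.val < d.val ∧ d.val < b.val ∧ b.val < c.val) ∨
      (d.val < a.val ∧ a.val < c.val ∧ c.val < b.val) ∨
      (b.val < d.val ∧ d.val < a.val ∧ a.val < c.val) ∨
      (d.val < b.val ∧ b.val < c.val ∧ c.val < a.val) → Crosses s(a, b) s(c, d) := by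
    rintro a b c d (h | h | h | h | h | h | h | h)
    · exact ⟨a, b, c, d, rfl, rfl, Or.inl h⟩
    · exact ⟨a, b, c, d, rfl, rfl, Or.inr h⟩
    · exact ⟨b, a, c, d, Sym2.eq_swap, rfl, Or.inl h⟩
    · exact ⟨b, a, c, d, Sym2.eq_swap, rfl, Or.inr h⟩
    · exact ⟨a, b, d, c, rfl, Sym2.eq_swap, Or.inl h⟩
    · exact ⟨a, b, d, c, rfl, Sym2.eq_swap, Or.inr h⟩
    · exact ⟨b, a, d, c, Sym2.eq_swap, Sym2.eq_swap, Or.inl h⟩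
    · exact ⟨b, a, d, c, Sym2.eq_swap, Sym2.eq_swap, Or.inr h⟩
  apply key (g • a) (g • b) (g • c) (g • d)
  have fin : ∀ a b c d a' b' c' d' i : ℕ, a < n → b < n → c < n → d < n →
      a' < n → b' < n → c' < n → d' < n → i < n →
      ((a + i = a' ∨ a + i = a' + n) ∧ (b + i = b' ∨ b + i = b' + n) ∧
          (c + i = c' ∨ c + i = c' + n) ∧ (d + i = d' ∨ d + i = d' + n) ∨
        (a' + a = i ∨ a' + a = i + n) ∧ (b' + b = i ∨ b' + b = i + n) ∧
          (c' + c = i ∨ c' + c = i + n) ∧ (d' + d = i ∨ d' + d = i + n)) →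
      ((a < c ∧ c < b ∧ b < d) ∨ (c < a ∧ a < d ∧ d < b)) →
      (a' < c' ∧ c' < b' ∧ b' < d') ∨ (c' < a' ∧ a' < d' ∧ d' < b') ∨
      (b' < c' ∧ c' < a' ∧ a' < d') ∨ (c' < b' ∧ b' < d' ∧ d' < a') ∨
      (a' < d' ∧ d' < b' ∧ b' < c') ∨ (d' < a' ∧ a' < c' ∧ c' < b') ∨
      (b' < d' ∧ d' < a' ∧ a' < c') ∨ (d' < b' ∧ b' < c' ∧ c' < a') := by
    intro a b c d a' b' c' d' i _ _ _ _ _ _ _ _ _ h1 h2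
    rcases h1 with ⟨ha | ha, hb | hb, hc | hc, hd | hd⟩ | ⟨ha | ha, hb | hb, hc | hc, hd | hd⟩ <;>
      rcases h2 with h | h <;>
      first
      | (exfalso; omega)
      | (refine Or.inl ?_; omega)
      | (refine Or.inr (Or.inl ?_); omega)
      | (refine Or.inr (Or.inr (Or.inl ?_)); omega)
      | (refine Or.inr (Or.inr (Or.inr (Or.inl ?_))); omega)
      | (refine Or.inr (Or.inr (Or.inr (Or.inr (Or.inl ?_)))); omega)
      | (refine Or.inr (Or.inr (Or.inr (Or.inr (Or.inr (Or.inl ?_))))); omega)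
      | (refine Or.inr (Or.inr (Or.inr (Or.inr (Or.inr (Or.inr (Or.inl ?_)))))); omega)
      | (refine Or.inr (Or.inr (Or.inr (Or.inr (Or.inr (Or.inr (Or.inr ?_)))))); omega)
  rcases g with i | i
  · have H := fun v : ZMod n => val_add_cases v i (DihedralGroup.r i • v) rfl
    exact fin _ _ _ _ _ _ _ _ i.val (ZMod.val_lt _) (ZMod.val_lt _) (ZMod.val_lt _)
      (ZMod.val_lt _) (ZMod.val_lt _) (ZMod.val_lt _) (ZMod.val_lt _) (ZMod.val_lt _)
      (ZMod.val_lt _) (Or.inl ⟨H a, H b, H c, H d⟩) h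
  · have H := fun v : ZMod n =>
      val_add_cases (DihedralGroup.sr i • v) v (-i) (sub_add_cancel _ _)
    exact fin _ _ _ _ _ _ _ _ (-i).val (ZMod.val_lt _) (ZMod.val_lt _) (ZMod.val_lt _)
      (ZMod.val_lt _) (ZMod.val_lt _) (ZMod.val_lt _) (ZMod.val_lt _) (ZMod.val_lt _)
      (ZMod.val_lt _) (Or.inr ⟨H a, H b, H c, H d⟩) h

/-- A dissection of the `n`-gon: a set of pairwise non-crossing diagonals. -/
@[ext]
structure Dissection (n : ℕ) where
  /-- The diagonals of the dissection. -/
  diagonals : Finset (Sym2 (ZMod n))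
  isDiagonal : ∀ e ∈ diagonals, IsDiagonal e
  noncrossing : ∀ e ∈ diagonals, ∀ f ∈ diagonals, ¬ Crosses e f

variable {n : ℕ}

/-- The dihedral group acts on the dissections of the `n`-gon. -/
instance dissectionAction [NeZero n] : MulAction (DihedralGroup n) (Dissection n) where
  smul g Φ :=
    { diagonals := Φ.diagonals.image (moveChord g)
      isDiagonal := by
        intro e he
        obtain ⟨e', he', rfl⟩ := Finset.mem_image.1 he
        exact isDiagonal_moveChord g (Φ.isDiagonal e' he')
      noncrossing := by
        intro e he f hf h
        obtain ⟨e', he', rfl⟩ := Finset.mem_image.1 he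
        obtain ⟨f', hf', rfl⟩ := Finset.mem_image.1 hf
        refine Φ.noncrossing e' he' f' hf' ?_
        have h' := crosses_moveChord g⁻¹ h
        simpa only [← moveChord_mul, inv_mul_cancel, moveChord_one] using h' }
  one_smul Φ := by
    ext e
    change e ∈ Φ.diagonals.image (moveChord 1) ↔ _
    simp [moveChord_one]
  mul_smul g h Φ := by
    apply Dissection.ext
    change Φ.diagonals.image (moveChord (g * h)) =
      (Φ.diagonals.image (moveChord h)).image (moveChord g)
    rw [Finset.image_image]
    exact congrArg (fun F => Finset.image F Φ.diagonals) (funext (moveChord_mul g h))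

theorem smul_diagonals [NeZero n] (g : DihedralGroup n) (Φ : Dissection n) :
    (g • Φ).diagonals = Φ.diagonals.image (moveChord g) := rfl

theorem moveChord_injective (g : DihedralGroup n) :
    Function.Injective (moveChord g : Sym2 (ZMod n) → Sym2 (ZMod n)) :=
  Sym2.map.injective (MulAction.injective g)

/-- `G(n, k)`, the set of `k`-dissections of the `n`-gon (those with exactly `k` diagonals),
with its action of the dihedral group. -/
def kDissections (n k : ℕ) [NeZero n] : SubMulAction (DihedralGroup n) (Dissection n) where
  carrier := {Φ | Φ.diagonals.card = k}
  smul_mem' g Φ hΦ := by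
    change (Φ.diagonals.image (moveChord g)).card = k
    rw [Finset.card_image_of_injective _ (moveChord_injective g)]
    exact hΦ

/-- The poset of nonempty faces of the associahedron of the `n`-gon: its faces are the
dissections of the `n`-gon, and a face `Φ` is contained in a face `Ψ` if and only if every
diagonal of `Ψ` is a diagonal of `Φ`. (So the vertices are the triangulations, and the
associahedron itself is the empty dissection.) -/
instance facePoset : PartialOrder (Dissection n) where
  le Φ Ψ := Ψ.diagonals ⊆ Φ.diagonals
  le_refl Φ := Finset.Subset.refl _
  le_trans _ _ _ h h' := Finset.Subset.trans h' h
  le_antisymm _ _ h h' := Dissection.ext (Finset.Subset.antisymm h' h)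

theorem smul_le_smul [NeZero n] (g : DihedralGroup n) {Φ Ψ : Dissection n} (h : Φ ≤ Ψ) :
    g • Φ ≤ g • Ψ :=
  Finset.image_subset_image h

/-- Every symmetry of the polygon is an automorphism of the face poset of the associahedron. -/
def faceIso [NeZero n] (g : DihedralGroup n) : Dissection n ≃o Dissection n where
  toEquiv := MulAction.toPerm g
  map_rel_iff' {Φ Ψ} := by
    refine ⟨fun h => ?_, fun h => smul_le_smul g h⟩
    have h' := smul_le_smul g⁻¹ h
    simpa using h'

/-- The `d`-dimensional faces of the associahedron of the `n`-gon, with the action of the dihedral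
group. The dimension of a face of a polytope is its height in the poset of nonempty faces, i.e.
the greatest length of a strictly increasing chain of nonempty faces that ends in it. -/
def associahedronFaces (n d : ℕ) [NeZero n] :
    SubMulAction (DihedralGroup n) (Dissection n) where
  carrier := {F | Order.height F = d}
  smul_mem' g F hF := by
    change Order.height (faceIso g F) = d
    rw [Order.height_orderIso]
    exact hF

/-- The cyclic group `Z_n`, as the subgroup of rotations of the dihedral group. -/
def rotations (n : ℕ) : Subgroup (DihedralGroup n) :=
  Subgroup.zpowers (DihedralGroup.r 1)

/-- The number `|X / Z_n|` of classes of `X` modulo the cyclic action. -/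
noncomputable def cyclicClasses [NeZero n] (X : SubMulAction (DihedralGroup n) (Dissection n)) :
    ℕ :=
  Nat.card (MulAction.orbitRel.Quotient (rotations n) X)

/-- The number `|X / D_{2n}|` of classes of `X` modulo the dihedral action. -/
noncomputable def dihedralClasses [NeZero n]
    (X : SubMulAction (DihedralGroup n) (Dissection n)) : ℕ :=
  Nat.card (MulAction.orbitRel.Quotient (DihedralGroup n) X)

/-- The Catalan number `C_q` when the rational number `q` is a nonnegative integer, and `0`
otherwise. -/
def C (q : ℚ) : ℚ :=
  if q.den = 1 ∧ 0 ≤ q then (catalan q.num.toNat : ℚ) else 0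

end PolygonDissection

/-! By Burnside's lemma both class numbers are averages of the number of `(n - 5)`-dissections fixed
by a symmetry, so the task is to count these for each rotation and reflection. A triangulation has
`n - 3` diagonals, so the dissections in question lack two; every count below is organised by the
number of missing diagonals.

Identity. Splitting a dissection along the longest diagonal at the vertex `0` (`indepSum_diagonals`)
gives a recursion for the polynomials that count dissections by diagonals. Reversing these
polynomials turns it into a convolution (`defectPoly_succ`). Its constant coefficients are the
Catalan numbers; the generating functions of the next two coefficients solve linear equations over
the Catalan series `C` with leading factor `1 - 2XC`, and the Euler operator `X d/dX` expresses the
solutions.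

Rotations. If a rotation of prime order `p` fixes a dissection, then either it fixes a diagonal,
which forces `p = 2`, or it permutes the diagonals freely, so that `p` divides both `n` and `n - 5`
and `p = 5`. With `s = n / p`, an invariant dissection contains a chord of length `s`: a diameter
for `p = 2`; for `p = 5` and `s ≥ 2`, a side of the central pentagon (`exists_side_five`). Such a
chord limits the rotations that fix the dissection to those killed by `p` (`mul_eq_zero_of_fixed`),
and the invariant dissections containing it correspond to the dissections of one sector `{0, …, s}`
(`card_fixed_sector`): lacking one diagonal for `p = 2`, triangulations for `p = 5`.

Reflections. An invariant dissection folds along the axis to a dissection of a polygon with about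
half as many vertices, in which an extra vertex `0` stands for the axis. Diagonals at `0` come from
diagonals perpendicular to the axis and count once; the others come from mirror pairs and count
twice, except that a diagonal along the axis also counts once (`foldPoly`, `indepSum_axis`). The
folded polynomials obey a similar recursion.

Associahedron. Every dissection with fewer than `n - 3` diagonals can be enlarged
(`isPure_diagonals`), so the height of a face is the number of missing diagonals, and the
two-dimensional faces are exactly the `(n - 5)`-dissections. -/

namespace PolygonDissection

/-! ### Weighted sums over independent sets -/

section IndependentSums

open Finset

variable {ι κ R S : Type*} [CommSemiring R] [CommSemiring S]

/-- A finite set no two elements of which are related. -/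
def IsIndep (r : ι → ι → Prop) (A : Finset ι) : Prop := ∀ a ∈ A, ∀ b ∈ A, ¬ r a b

open Classical in
/-- The weighted sum over the independent subsets of `T`. -/
noncomputable def indepSum (r : ι → ι → Prop) (T : Finset ι) (w : ι → R) : R :=
  ∑ A ∈ T.powerset with IsIndep r A, ∏ a ∈ A, w a

theorem IsIndep.mono {r : ι → ι → Prop} {A B : Finset ι} (h : IsIndep r B) (hAB : A ⊆ B) :
    IsIndep r A := fun a ha b hb => h a (hAB ha) b (hAB hb)

theorem isIndep_insert [DecidableEq ι] {r : ι → ι → Prop} (hs : ∀ a b, r a b → r b a) (hi : ∀ a, ¬ r a a)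
    {e : ι} {A : Finset ι} :
    IsIndep r (insert e A) ↔ IsIndep r A ∧ ∀ a ∈ A, ¬ r e a := by
  constructor
  · intro h
    exact ⟨h.mono (subset_insert e A), fun a ha =>
      h e (mem_insert_self e A) a (mem_insert_of_mem ha)⟩
  · rintro ⟨h, h'⟩ a ha b hb
    rcases mem_insert.1 ha with rfl | ha' <;> rcases mem_insert.1 hb with rfl | hb'
    · exact hi _
    · exact h' b hb'
    · exact fun hr => h' a ha' (hs _ _ hr)
    · exact h a ha' b hb'

theorem indepSum_empty (r : ι → ι → Prop) (w : ι → R) : indepSum r ∅ w = 1 := by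
  classical
  have : ({A ∈ (∅ : Finset ι).powerset | IsIndep r A}) = {∅} := by
    ext A
    simp only [powerset_empty, mem_filter, mem_singleton, and_iff_left_iff_imp]
    rintro rfl
    exact fun a ha => absurd ha (notMem_empty a)
  rw [indepSum, this, sum_singleton, prod_empty]

/-- An independent set either avoids `e`, or is `e` together with an independent set of elements
unrelated to `e`. All the recursions below come from this one. -/
theorem indepSum_insert [DecidableEq ι] {r : ι → ι → Prop} (hs : ∀ a b, r a b → r b a)
    (hi : ∀ a, ¬ r a a) {e : ι} [DecidablePred fun a => ¬ r e a] {T : Finset ι} (he : e ∉ T)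
    (w : ι → R) :
    indepSum r (insert e T) w = indepSum r T w + w e * indepSum r {a ∈ T | ¬ r e a} w := by
  classical
  have h : ({a ∈ T | ¬ r e a}).powerset = {A ∈ T.powerset | ∀ a ∈ A, ¬ r e a} := by
    ext A
    simp only [mem_powerset, mem_filter, subset_iff]
    exact ⟨fun h => ⟨fun a ha => (h ha).1, fun a ha => (h ha).2⟩,
      fun h a ha => ⟨h.1 ha, h.2 a ha⟩⟩
  simp only [indepSum]
  rw [sum_filter, sum_powerset_insert he, ← sum_filter, h, filter_filter, mul_sum,
    sum_filter (fun A => (∀ a ∈ A, ¬ r e a) ∧ IsIndep r A)]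
  congr 1
  refine sum_congr rfl fun A hA => ?_
  have heA : e ∉ A := fun h => he (mem_powerset.1 hA h)
  rw [isIndep_insert hs hi, prod_insert heA]
  simp only [and_comm]
  congr

theorem indepSum_congr {r r' : ι → ι → Prop} {T : Finset ι} {w w' : ι → R}
    (hr : ∀ a ∈ T, ∀ b ∈ T, (r a b ↔ r' a b)) (h : ∀ a ∈ T, w a = w' a) :
    indepSum r T w = indepSum r' T w' := by
  classical
  have : ({A ∈ T.powerset | IsIndep r A}) = {A ∈ T.powerset | IsIndep r' A} := by
    refine filter_congr fun A hA => ?_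
    have hA' := mem_powerset.1 hA
    exact ⟨fun h a ha b hb => (hr a (hA' ha) b (hA' hb)).not.1 (h a ha b hb),
      fun h a ha b hb => (hr a (hA' ha) b (hA' hb)).not.2 (h a ha b hb)⟩
  rw [indepSum, this]
  exact sum_congr rfl fun A hA => prod_congr rfl fun a ha =>
    h a (mem_powerset.1 (mem_filter.1 hA).1 ha)

/-- An independent subset of the union is an arbitrary pair of independent subsets of the parts. The
induction removes an element of `T'`, which has no relation to `T`, by `indepSum_insert`. -/
theorem indepSum_union [DecidableEq ι] {r : ι → ι → Prop} (hs : ∀ a b, r a b → r b a) (hi : ∀ a, ¬ r a a)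
    (T T' : Finset ι) (w : ι → R) (hd : Disjoint T T') (hr : ∀ a ∈ T, ∀ b ∈ T', ¬ r b a) :
    indepSum r (T ∪ T') w = indepSum r T w * indepSum r T' w := by
  classical
  induction T' using Finset.strongInduction with
  | H T' ih =>
    rcases T'.eq_empty_or_nonempty with rfl | ⟨e, he⟩
    · rw [union_empty, indepSum_empty, mul_one]
    · obtain ⟨U, heU, rfl⟩ : ∃ U, e ∉ U ∧ insert e U = T' :=
        ⟨T'.erase e, notMem_erase e T', insert_erase he⟩
      have heT : e ∉ T := fun h => disjoint_left.1 hd h he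
      have h1 : {a ∈ T ∪ U | ¬ r e a} = T ∪ {a ∈ U | ¬ r e a} := by
        rw [filter_union, filter_true_of_mem fun a ha => hr a ha e he]
      have hU : U ⊂ insert e U := ssubset_insert heU
      have hU' : {a ∈ U | ¬ r e a} ⊂ insert e U :=
        lt_of_le_of_lt (filter_subset _ _) hU
      rw [union_insert, indepSum_insert hs hi (by simp [heT, heU]), indepSum_insert hs hi heU, h1,
        ih U hU (hd.mono_right hU.1) fun a ha b hb => hr a ha b (hU.1 hb),
        ih _ hU' (hd.mono_right hU'.1) fun a ha b hb => hr a ha b (hU'.1 hb)]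
      ring

theorem indepSum_map (r : ι → ι → Prop) (f : κ ↪ ι) (T : Finset κ) (w : ι → R) :
    indepSum r (T.map f) w = indepSum (fun a b => r (f a) (f b)) T (fun a => w (f a)) := by
  classical
  simp only [indepSum]
  refine (sum_bij (fun A _ => A.map f) ?_ ?_ ?_ ?_).symm
  · intro A hA
    simp only [mem_filter, mem_powerset] at hA ⊢
    refine ⟨map_subset_map.2 hA.1, ?_⟩
    intro a ha b hb
    obtain ⟨a, ha', rfl⟩ := mem_map.1 ha
    obtain ⟨b, hb', rfl⟩ := mem_map.1 hb
    exact hA.2 a ha' b hb'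
  · intro A _ B _ h
    exact map_injective f h
  · intro B hB
    simp only [mem_filter, mem_powerset] at hB
    obtain ⟨A, hA, rfl⟩ := subset_map_iff.1 hB.1
    refine ⟨A, ?_, rfl⟩
    simp only [mem_filter, mem_powerset]
    exact ⟨hA, fun a ha b hb => hB.2 _ (mem_map_of_mem f ha) _ (mem_map_of_mem f hb)⟩
  · intro A _
    rw [prod_map]

theorem map_indepSum (r : ι → ι → Prop) (T : Finset ι) (w : ι → R) (f : R →+* S) :
    f (indepSum r T w) = indepSum r T (fun a => f (w a)) := by
  simp only [indepSum, map_sum, map_prod]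

-- Translates the polynomial identities back into numbers of sets, with the exponent `w a` as the
-- size contributed by `a`.
open Classical in
theorem coeff_indepSum (r : ι → ι → Prop) (T : Finset ι) (w : ι → ℕ) (k : ℕ) :
    (indepSum r T (fun a => (Polynomial.X : Polynomial ℚ) ^ w a)).coeff k =
      #{A ∈ T.powerset | IsIndep r A ∧ ∑ a ∈ A, w a = k} := by
  simp only [indepSum, Polynomial.finsetSum_coeff, prod_pow_eq_pow_sum, Polynomial.coeff_X_pow,
    sum_boole, filter_filter, eq_comm]

end IndependentSums

/-! ### Non-crossing chords and the recursion at the vertex 0 -/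

section Chords

open Finset

/-- Two chords of a convex polygon with linearly ordered vertices cross. -/
def Interlace (p q : ℕ × ℕ) : Prop :=
  (p.1 < q.1 ∧ q.1 < p.2 ∧ p.2 < q.2) ∨ (q.1 < p.1 ∧ p.1 < q.2 ∧ q.2 < p.2)

theorem interlace_symm (p q : ℕ × ℕ) (h : Interlace p q) : Interlace q p := Or.symm h

theorem interlace_irrefl (p : ℕ × ℕ) : ¬ Interlace p p := by
  unfold Interlace
  omega

/-- The chords between non-consecutive vertices in `{a, …, b}`, including the chord `(a, b)`. -/
def chords (a b : ℕ) : Finset (ℕ × ℕ) :=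
  {p ∈ range (b + 1) ×ˢ range (b + 1) | a ≤ p.1 ∧ p.1 + 2 ≤ p.2}

/-- The diagonals of the polygon with vertices `{a, …, b}`. -/
def diagonals (a b : ℕ) : Finset (ℕ × ℕ) := (chords a b).erase (a, b)

theorem mem_chords {a b : ℕ} {p : ℕ × ℕ} :
    p ∈ chords a b ↔ a ≤ p.1 ∧ p.1 + 2 ≤ p.2 ∧ p.2 ≤ b := by
  simp only [chords, mem_filter, mem_product, mem_range]
  omega

theorem mem_diagonals {a b : ℕ} {p : ℕ × ℕ} :
    p ∈ diagonals a b ↔ a ≤ p.1 ∧ p.1 + 2 ≤ p.2 ∧ p.2 ≤ b ∧ ¬ (p.1 = a ∧ p.2 = b) := by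
  rw [diagonals, mem_erase, mem_chords, ne_eq, Prod.ext_iff]
  tauto

variable {R : Type*} [CommSemiring R]

theorem indepSum_chords_add (a l : ℕ) (w : ℕ × ℕ → R) :
    indepSum Interlace (chords a (a + l)) w =
      indepSum Interlace (chords 0 l) (fun p => w (a + p.1, a + p.2)) := by
  have : chords a (a + l) = (chords 0 l).map
      (((addLeftEmbedding a).prodMap (addLeftEmbedding a) : ℕ × ℕ ↪ ℕ × ℕ)) := by
    ext ⟨x, y⟩
    simp only [mem_map, mem_chords, Function.Embedding.coe_prodMap, Prod.exists, Prod.map,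
      addLeftEmbedding_apply, Prod.mk.injEq]
    constructor
    · intro h
      exact ⟨x - a, y - a, by omega, by omega, by omega⟩
    · rintro ⟨u, v, h, rfl, rfl⟩
      omega
  rw [this, indepSum_map]
  refine indepSum_congr (fun p _ q _ => ?_) (fun p _ => rfl)
  simp only [Interlace, Function.Embedding.coe_prodMap, Prod.map, addLeftEmbedding_apply]
  omega

/-- The chord `(a, b)` crosses no other chord of `{a, …, b}`, so it can be added or left out freely.
-/
theorem indepSum_chords {a b : ℕ} (h : a + 2 ≤ b) (w : ℕ × ℕ → R) :
    indepSum Interlace (chords a b) w =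
      (1 + w (a, b)) * indepSum Interlace (diagonals a b) w := by
  classical
  have hab : (a, b) ∈ chords a b := mem_chords.2 (by simp; omega)
  rw [← insert_erase hab, indepSum_insert interlace_symm interlace_irrefl (notMem_erase _ _),
    filter_true_of_mem, ← diagonals]
  · ring
  · intro p hp
    rw [← diagonals, mem_diagonals] at hp
    unfold Interlace
    simp only
    omega

theorem chords_eq_empty {a b : ℕ} (h : b < a + 2) : chords a b = ∅ := by
  ext p
  simp only [mem_chords, notMem_empty, iff_false]
  omega

/-- The chords `(0, 2), …, (0, J)` are added in this order, so the `j`-th summand collects the sets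
whose longest chord at `0` is `(0, j)`. What is compatible with that chord lies in `{0, …, j}` or in
`{j, …, m}`; on the second side the closing chord `(j, m)` is allowed as well. -/
theorem indepSum_chords_union (m J : ℕ) (hJ : J < m) (w : ℕ × ℕ → R) :
    indepSum Interlace (chords 1 m ∪ {p ∈ chords 0 m | p.1 = 0 ∧ p.2 ≤ J}) w =
      indepSum Interlace (chords 1 m) w +
      ∑ j ∈ Icc 2 J, w (0, j) * (indepSum Interlace (diagonals 0 j) w *
        indepSum Interlace (chords j m) w) := by
  classical
  induction J with
  | zero =>
    rw [show {p ∈ chords 0 m | p.1 = 0 ∧ p.2 ≤ 0} = ∅ from ?_]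
    · simp
    · ext p
      simp only [mem_filter, mem_chords, notMem_empty, iff_false]
      omega
  | succ J ih =>
    rcases lt_or_ge (J + 1) 2 with h | h
    · rw [show {p ∈ chords 0 m | p.1 = 0 ∧ p.2 ≤ J + 1} =
        {p ∈ chords 0 m | p.1 = 0 ∧ p.2 ≤ J} from ?_, ih (by omega)]
      · rw [Icc_eq_empty (by omega), Icc_eq_empty (by omega)]
      · ext p
        simp only [mem_filter, mem_chords]
        omega
    · have h1 : chords 1 m ∪ {p ∈ chords 0 m | p.1 = 0 ∧ p.2 ≤ J + 1} =
          insert (0, J + 1) (chords 1 m ∪ {p ∈ chords 0 m | p.1 = 0 ∧ p.2 ≤ J}) := by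
        ext ⟨x, y⟩
        simp only [mem_union, mem_filter, mem_chords, mem_insert, Prod.mk.injEq]
        omega
      have h2 : filter (fun p => ¬ Interlace (0, J + 1) p)
          (chords 1 m ∪ {p ∈ chords 0 m | p.1 = 0 ∧ p.2 ≤ J}) = diagonals 0 (J + 1) ∪ chords (J + 1) m := by
        ext ⟨x, y⟩
        simp only [mem_union, mem_filter, mem_chords, mem_diagonals]
        unfold Interlace
        omega
      rw [h1, indepSum_insert interlace_symm interlace_irrefl, h2, ih (by omega),
        indepSum_union interlace_symm interlace_irrefl, sum_Icc_succ_top h, add_assoc]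
      · rw [disjoint_left]
        intro p
        rw [mem_diagonals, mem_chords]
        omega
      · intro p hp q hq
        rw [mem_diagonals] at hp
        rw [mem_chords] at hq
        unfold Interlace
        omega
      · simp only [mem_union, mem_filter, mem_chords]
        omega

/-- Splitting the dissections of the polygon `{0, …, m}` along the longest diagonal at `0`. -/
theorem indepSum_diagonals {m : ℕ} (hm : 2 ≤ m) (w : ℕ × ℕ → R) :
    indepSum Interlace (diagonals 0 m) w = indepSum Interlace (chords 1 m) w +
      ∑ j ∈ Ico 2 m, w (0, j) * (indepSum Interlace (diagonals 0 j) w *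
        indepSum Interlace (chords j m) w) := by
  have : diagonals 0 m = chords 1 m ∪ {p ∈ chords 0 m | p.1 = 0 ∧ p.2 ≤ m - 1} := by
    ext p
    simp only [mem_union, mem_filter, mem_chords, mem_diagonals]
    omega
  rw [this, indepSum_chords_union m (m - 1) (by omega)]
  congr 2

end Chords

end PolygonDissection

namespace PolygonDissection

/-! ### Maximal dissections all have the same size -/

section Purity

open Finset

/-- Every independent subset of `T` has at most `m` elements, and can be enlarged if it has
fewer. -/
def IsPure (T : Finset (ℕ × ℕ)) (m : ℕ) : Prop :=
  ∀ A ⊆ T, IsIndep Interlace A →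
    #A ≤ m ∧ (#A < m → ∃ e ∈ T, e ∉ A ∧ IsIndep Interlace (insert e A))

theorem isIndep_insert_interlace {e : ℕ × ℕ} {A : Finset (ℕ × ℕ)} :
    IsIndep Interlace (insert e A) ↔ IsIndep Interlace A ∧ ∀ a ∈ A, ¬ Interlace e a :=
  isIndep_insert interlace_symm interlace_irrefl

/-- The chord `(a, b)` is compatible with everything, so allowing it raises the maximal size by
exactly one. -/
theorem isPure_chords {a b : ℕ} (hab : a < b)
    (h : a + 2 ≤ b → IsPure (diagonals a b) (b - a - 2)) :
    IsPure (chords a b) (b - a - 1) := by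
  intro A hA hi
  rcases lt_or_ge b (a + 2) with hb | hb
  · rw [chords_eq_empty hb, subset_empty] at hA
    subst hA
    simp only [card_empty]
    omega
  by_cases hm : (a, b) ∈ A
  · obtain ⟨h1, h2⟩ := h hb (A.erase (a, b)) (erase_subset_erase _ hA)
      (hi.mono (erase_subset _ _))
    have hc := card_erase_add_one hm
    refine ⟨by omega, fun hlt => ?_⟩
    obtain ⟨e, he, heA, hei⟩ := h2 (by omega)
    have he' : e ∈ chords a b := mem_of_mem_erase he
    have hne : e ≠ (a, b) := ne_of_mem_erase he
    refine ⟨e, he', fun h => heA (mem_erase.2 ⟨hne, h⟩), ?_⟩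
    rw [isIndep_insert_interlace] at hei ⊢
    refine ⟨hi, fun p hp => ?_⟩
    by_cases hpe : p = (a, b)
    · subst hpe
      rw [mem_chords] at he'
      unfold Interlace
      omega
    · exact hei.2 p (mem_erase.2 ⟨hpe, hp⟩)
  · obtain ⟨h1, h2⟩ := h hb A (fun p hp => mem_erase.2 ⟨fun h => hm (h ▸ hp), hA hp⟩) hi
    refine ⟨by omega, fun _ => ⟨(a, b), mem_chords.2 (by simp; omega), hm, ?_⟩⟩
    rw [isIndep_insert_interlace]
    refine ⟨hi, fun p hp => ?_⟩
    have := mem_chords.1 (hA hp)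
    unfold Interlace
    omega

/-- Induction on the length. The longest diagonal `(a, j)` at `a` cuts the set into diagonals of
`{a, …, j}` and chords of `{j, …, b}`, and `(j - a - 2) + (b - j - 1) + 1 = b - a - 2`; if a
diagonal is missing, one of the two sides is not maximal and can be enlarged. Without a diagonal at
`a`, the set consists of chords of `{a + 1, …, b}`. -/
theorem isPure_diagonals (a b : ℕ) (hab : a + 2 ≤ b) : IsPure (diagonals a b) (b - a - 2) := by
  obtain ⟨d, hd⟩ : ∃ d, d = b - a := ⟨_, rfl⟩
  induction d using Nat.strong_induction_on generalizing a b with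
  | _ d ih =>
    have ihc : ∀ a' b', a' < b' → b' - a' < d → IsPure (chords a' b') (b' - a' - 1) :=
      fun a' b' h1 h2 => isPure_chords h1 fun h => ih _ h2 a' b' h rfl
    intro A hA hi
    by_cases hex : ∃ j, (a, j) ∈ A
    · obtain ⟨j, hj, hjmax⟩ : ∃ j, (a, j) ∈ A ∧ ∀ y, (a, y) ∈ A → y ≤ j := by
        obtain ⟨j₀, hj₀⟩ := hex
        obtain ⟨⟨x, j⟩, hj, hmax⟩ := exists_max_image {p ∈ A | p.1 = a} Prod.snd
          ⟨(a, j₀), mem_filter.2 ⟨hj₀, rfl⟩⟩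
        obtain ⟨hjA, rfl⟩ := mem_filter.1 hj
        exact ⟨j, hjA, fun y hy => hmax (x, y) (mem_filter.2 ⟨hy, rfl⟩)⟩
      have hjm := mem_diagonals.1 (hA hj)
      simp only [true_and] at hjm
      obtain ⟨h1, h1'⟩ := ih (j - a) (by omega) a j (by omega) rfl {p ∈ A | p ∈ diagonals a j}
        (fun p hp => (mem_filter.1 hp).2) (hi.mono (filter_subset _ _))
      obtain ⟨h2, h2'⟩ := ihc j b (by omega) (by omega) {p ∈ A | p ∈ chords j b}
        (fun p hp => (mem_filter.1 hp).2) (hi.mono (filter_subset _ _))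
      have hAe : A = insert (a, j) ({p ∈ A | p ∈ diagonals a j} ∪ {p ∈ A | p ∈ chords j b}) := by
        ext ⟨x, y⟩
        rw [mem_insert, mem_union, mem_filter, mem_filter, Prod.mk.injEq]
        constructor
        · intro hp
          have h3 := mem_diagonals.1 (hA hp)
          have h4 := hi _ hj _ hp
          rw [mem_diagonals, mem_chords, and_iff_right hp, and_iff_right hp]
          unfold Interlace at h4
          simp only at h3 h4 ⊢
          have h5 : x = a → y ≤ j := fun h => hjmax y (h ▸ hp)
          omega
        · rintro (⟨rfl, rfl⟩ | h | h)
          exacts [hj, h.1, h.1]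
      have hcard : #A = #{p ∈ A | p ∈ diagonals a j} + #{p ∈ A | p ∈ chords j b} + 1 := by
        conv_lhs => rw [hAe]
        rw [card_insert_of_notMem, card_union_of_disjoint]
        · rw [disjoint_left]
          intro p hp hp'
          have h3 := mem_diagonals.1 (mem_filter.1 hp).2
          have h4 := mem_chords.1 (mem_filter.1 hp').2
          omega
        · intro h
          rcases mem_union.1 h with h | h
          · have := mem_diagonals.1 (mem_filter.1 h).2
            omega
          · have := mem_chords.1 (mem_filter.1 h).2
            omega
      refine ⟨by omega, fun hlt => ?_⟩
      rcases lt_or_ge (#{p ∈ A | p ∈ diagonals a j}) (j - a - 2) with h | h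
      · obtain ⟨e, he, heA, hei⟩ := h1' h
        have he' := mem_diagonals.1 he
        refine ⟨e, mem_diagonals.2 (by omega), fun h => heA (mem_filter.2 ⟨h, he⟩), ?_⟩
        rw [isIndep_insert_interlace] at hei ⊢
        refine ⟨hi, fun p hp => ?_⟩
        rw [hAe, mem_insert, mem_union] at hp
        rcases hp with rfl | hp | hp
        · unfold Interlace
          omega
        · exact hei.2 p hp
        · have h4 := mem_chords.1 (mem_filter.1 hp).2
          unfold Interlace
          omega
      · obtain ⟨e, he, heA, hei⟩ := h2' (by omega)
        have he' := mem_chords.1 he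
        refine ⟨e, mem_diagonals.2 (by omega), fun h => heA (mem_filter.2 ⟨h, he⟩), ?_⟩
        rw [isIndep_insert_interlace] at hei ⊢
        refine ⟨hi, fun p hp => ?_⟩
        rw [hAe, mem_insert, mem_union] at hp
        rcases hp with rfl | hp | hp
        · unfold Interlace
          omega
        · have h4 := mem_diagonals.1 (mem_filter.1 hp).2
          unfold Interlace
          omega
        · exact hei.2 p hp
    · have hA' : A ⊆ chords (a + 1) b := by
        intro p hp
        have h3 := mem_diagonals.1 (hA hp)
        have : p.1 ≠ a := fun h => hex ⟨p.2, by rw [← h]; exact hp⟩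
        exact mem_chords.2 (by omega)
      obtain ⟨h1, h1'⟩ := ihc (a + 1) b (by omega) (by omega) A hA' hi
      refine ⟨by omega, fun hlt => ?_⟩
      obtain ⟨e, he, heA⟩ := h1' (by omega)
      have he' := mem_chords.1 he
      exact ⟨e, mem_diagonals.2 (by omega), heA⟩

end Purity

end PolygonDissection

namespace PolygonDissection

/-! ### Counting dissections by missing diagonals -/

section Deficiency

open Finset

theorem reflect_sum {ι : Type*} (s : Finset ι) (N : ℕ) (f : ι → Polynomial ℚ) :
    (∑ i ∈ s, f i).reflect N = ∑ i ∈ s, (f i).reflect N := by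
  classical
  induction s using Finset.induction_on with
  | empty => simp
  | insert a s ha ih => rw [sum_insert ha, sum_insert ha, Polynomial.reflect_add, ih]

/-- The dissections of the polygon `{0, …, m}`, counted by the number of diagonals. -/
noncomputable def dissectionPoly (m : ℕ) : Polynomial ℚ :=
  indepSum Interlace (diagonals 0 m) fun _ => Polynomial.X

/-- The sets of non-crossing chords in `{0, …, m}`, counted by the number of chords. -/
noncomputable def chordPoly (m : ℕ) : Polynomial ℚ :=
  indepSum Interlace (chords 0 m) fun _ => Polynomial.X

theorem chordPoly_one : chordPoly 1 = 1 := by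
  rw [chordPoly, chords_eq_empty (by omega), indepSum_empty]

theorem chordPoly_eq {l : ℕ} (hl : 2 ≤ l) :
    chordPoly l = (1 + Polynomial.X) * dissectionPoly l :=
  indepSum_chords (by omega) _

theorem indepSum_chords_eq_chordPoly {R : Type*} [CommSemiring R] (f : Polynomial ℚ →+* R)
    {j m : ℕ} (hj : j ≤ m) (w : ℕ × ℕ → R)
    (hw : ∀ p ∈ chords j m, w p = f Polynomial.X) :
    indepSum Interlace (chords j m) w = f (chordPoly (m - j)) := by
  rw [indepSum_congr (w' := fun _ => f Polynomial.X) (fun _ _ _ _ => Iff.rfl) hw,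
    chordPoly, map_indepSum]
  obtain ⟨l, rfl⟩ := Nat.exists_eq_add_of_le hj
  rw [indepSum_chords_add, Nat.add_sub_cancel_left]

theorem indepSum_chords_X {j m : ℕ} (hj : j ≤ m) :
    indepSum Interlace (chords j m) (fun _ => (Polynomial.X : Polynomial ℚ)) =
      chordPoly (m - j) := by
  have := indepSum_chords_eq_chordPoly (RingHom.id _) hj _ fun _ _ => (RingHom.id_apply _).symm
  rwa [RingHom.id_apply] at this

theorem dissectionPoly_eq {m : ℕ} (hm : 2 ≤ m) :
    dissectionPoly m = chordPoly (m - 1) +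
      ∑ j ∈ Ico 2 m, Polynomial.X * (dissectionPoly j * chordPoly (m - j)) := by
  rw [dissectionPoly, indepSum_diagonals hm, indepSum_chords_X (by omega)]
  refine congrArg _ (sum_congr rfl fun j hj => ?_)
  rw [indepSum_chords_X (mem_Ico.1 hj).2.le, dissectionPoly]

theorem natDegree_one_add_X : (1 + Polynomial.X : Polynomial ℚ).natDegree ≤ 1 :=
  Polynomial.natDegree_add_le_of_degree_le (by simp) Polynomial.natDegree_X_le

/-- These bounds license the use of `Polynomial.reflect_mul`, which reverses a product factor by
factor only when the degrees do not exceed the reversal exponents. -/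
theorem natDegree_dissectionPoly (m : ℕ) (hm : 2 ≤ m) :
    (dissectionPoly m).natDegree ≤ m - 2 ∧ (chordPoly m).natDegree ≤ m - 1 := by
  induction m using Nat.strong_induction_on with
  | _ m ih =>
    have hc : ∀ l, 1 ≤ l → l < m → (chordPoly l).natDegree ≤ l - 1 := by
      intro l h1 hl
      rcases Nat.lt_or_ge l 2 with h | h
      · obtain rfl : l = 1 := by omega
        simp [chordPoly_one]
      · exact (ih l hl h).2
    have h1 : (dissectionPoly m).natDegree ≤ m - 2 := by
      rw [dissectionPoly_eq hm]
      refine Polynomial.natDegree_add_le_of_degree_le ?_ ?_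
      · exact (hc (m - 1) (by omega) (by omega)).trans (by omega)
      · refine Polynomial.natDegree_sum_le_of_forall_le _ _ fun j hj => ?_
        have hj' := mem_Ico.1 hj
        refine (Polynomial.natDegree_mul_le.trans (add_le_add Polynomial.natDegree_X_le
          (Polynomial.natDegree_mul_le.trans (add_le_add (ih j hj'.2 hj'.1).1
            (hc (m - j) (by omega) (by omega)))))).trans (by omega)
    refine ⟨h1, ?_⟩
    rw [chordPoly_eq hm]
    exact (Polynomial.natDegree_mul_le.trans (add_le_add natDegree_one_add_X h1)).trans (by omega)

theorem natDegree_chordPoly {l : ℕ} (hl : 1 ≤ l) : (chordPoly l).natDegree ≤ l - 1 := by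
  rcases Nat.lt_or_ge l 2 with h | h
  · obtain rfl : l = 1 := by omega
    simp [chordPoly_one]
  · exact (natDegree_dissectionPoly l h).2

/-- The dissections of a polygon with `h + 2` vertices, counted by the number of diagonals
that are missing in comparison with a triangulation. -/
noncomputable def defectPoly (h : ℕ) : Polynomial ℚ :=
  if h = 0 then 1 else (dissectionPoly (h + 1)).reflect (h - 1)

/-- The analogue of `defectPoly` for the sets of non-crossing chords in `{0, …, h + 1}`. -/
noncomputable def chordDefectPoly (h : ℕ) : Polynomial ℚ :=
  (chordPoly (h + 1)).reflect h

theorem chordDefectPoly_zero : chordDefectPoly 0 = 1 := by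
  simp [chordDefectPoly, chordPoly_one]

theorem chordDefectPoly_succ (h : ℕ) :
    chordDefectPoly (h + 1) = (1 + Polynomial.X) * defectPoly (h + 1) := by
  rw [chordDefectPoly, chordPoly_eq (by omega), defectPoly, if_neg (by omega), add_comm h 1,
    Polynomial.reflect_mul, Polynomial.reflect_add, Polynomial.reflect_one, pow_one, Polynomial.reflect_one_X]
  · simp [add_comm]
  · exact natDegree_one_add_X
  · exact (natDegree_dissectionPoly _ (by omega)).1.trans (by omega)

/-- Reversal of `dissectionPoly_eq`: the factor `X` of the splitting diagonal reverses to `1`, and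
`(0, j)` contributes the term with indices `j - 1` and `h + 1 - j`. The convention `defectPoly 0 =
1` makes the case without a diagonal at `0` the remaining term of the convolution. -/
theorem defectPoly_succ (h : ℕ) :
    defectPoly (h + 1) =
      ∑ p ∈ antidiagonal h, defectPoly p.1 * chordDefectPoly p.2 := by
  rw [defectPoly, if_neg (by omega), dissectionPoly_eq (by omega), Polynomial.reflect_add,
    reflect_sum, Nat.sum_antidiagonal_eq_sum_range_succ (fun i j => defectPoly i *
      chordDefectPoly j), sum_range_succ', add_comm, sum_Ico_eq_sum_range]
  congr 1
  · refine sum_congr (by congr 1) fun j hj => ?_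
    have hj' := mem_range.1 hj
    rw [defectPoly, if_neg (by omega), chordDefectPoly,
      show h + 1 - 1 = 1 + (j + 1 - 1 + (h - (j + 1))) by omega, Polynomial.reflect_mul,
      Polynomial.reflect_one_X, one_mul, Polynomial.reflect_mul]
    · congr 3 <;> omega
    · exact (natDegree_dissectionPoly _ (by omega)).1.trans (by omega)
    · exact (natDegree_chordPoly (by omega)).trans (by omega)
    · exact Polynomial.natDegree_X_le
    · exact (Polynomial.natDegree_mul_le.trans (add_le_add
        (natDegree_dissectionPoly _ (by omega)).1 (natDegree_chordPoly (by omega)))).trans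
          (by omega)
  · simp [defectPoly, chordDefectPoly]

theorem coeff_dissectionPoly {m d : ℕ} (hd : d + 2 ≤ m) :
    (dissectionPoly m).coeff (m - 2 - d) = (defectPoly (m - 1)).coeff d := by
  rw [defectPoly, if_neg (by omega), Polynomial.coeff_reflect, Polynomial.revAt_le (by omega)]
  congr 1
  congr 1
  omega

end Deficiency

end PolygonDissection

namespace PolygonDissection

/-! ### Dissections folded along an axis of reflection -/

section Folding

open Finset

/-- The dissections of the polygon `{0, …, m}`, where a diagonal has weight `1` if it ends in the
vertex `0`, and weight `2` otherwise. -/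
noncomputable def foldPoly (m : ℕ) : Polynomial ℚ :=
  indepSum Interlace (diagonals 0 m) fun p => Polynomial.X ^ (if p.1 = 0 then 1 else 2)

theorem diagonals_translate (a l : ℕ) : diagonals a (a + l) = (diagonals 0 l).map
      (((addLeftEmbedding a).prodMap (addLeftEmbedding a) : ℕ × ℕ ↪ ℕ × ℕ)) := by
  ext ⟨x, y⟩
  simp only [mem_map, mem_diagonals, Function.Embedding.coe_prodMap, Prod.exists, Prod.map,
    addLeftEmbedding_apply, Prod.mk.injEq]
  constructor
  · intro h
    exact ⟨x - a, y - a, by omega, by omega, by omega⟩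
  · rintro ⟨u, v, h, rfl, rfl⟩
    omega

theorem indepSum_diagonals_add {R : Type*} [CommSemiring R] (a l : ℕ) (w : ℕ × ℕ → R) :
    indepSum Interlace (diagonals a (a + l)) w =
      indepSum Interlace (diagonals 0 l) (fun p => w (a + p.1, a + p.2)) := by
  rw [diagonals_translate, indepSum_map]
  refine indepSum_congr (fun p _ q _ => ?_) (fun p _ => rfl)
  simp only [Interlace, Function.Embedding.coe_prodMap, Prod.map, addLeftEmbedding_apply]
  omega

theorem indepSum_chords_X_sq {j m : ℕ} (hj : j ≤ m) {w : ℕ × ℕ → Polynomial ℚ}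
    (hw : ∀ p ∈ chords j m, w p = Polynomial.X ^ 2) :
    indepSum Interlace (chords j m) w = Polynomial.expand ℚ 2 (chordPoly (m - j)) := by
  have := indepSum_chords_eq_chordPoly
    ((Polynomial.expand ℚ 2 : Polynomial ℚ →ₐ[ℚ] Polynomial ℚ) : Polynomial ℚ →+* Polynomial ℚ)
    hj w fun p hp => by rw [hw p hp, RingHom.coe_coe, Polynomial.expand_X]
  rwa [RingHom.coe_coe] at this

theorem foldPoly_eq {m : ℕ} (hm : 2 ≤ m) :
    foldPoly m = Polynomial.expand ℚ 2 (chordPoly (m - 1)) +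
      ∑ j ∈ Ico 2 m, Polynomial.X *
        (foldPoly j * Polynomial.expand ℚ 2 (chordPoly (m - j))) := by
  have h : ∀ j, 1 ≤ j → ∀ p ∈ chords j m,
      (Polynomial.X : Polynomial ℚ) ^ (if p.1 = 0 then 1 else 2) = Polynomial.X ^ 2 := by
    intro j hj p hp
    have := mem_chords.1 hp
    rw [if_neg (by omega)]
  rw [foldPoly, indepSum_diagonals hm, indepSum_chords_X_sq (by omega) (h 1 le_rfl)]
  refine congrArg _ (sum_congr rfl fun j hj => ?_)
  have hj' := mem_Ico.1 hj
  rw [indepSum_chords_X_sq hj'.2.le (h j (by omega)), foldPoly, if_pos rfl, pow_one]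

theorem natDegree_expand_chordPoly {l : ℕ} (hl : 1 ≤ l) :
    (Polynomial.expand ℚ 2 (chordPoly l)).natDegree ≤ 2 * (l - 1) := by
  rw [Polynomial.natDegree_expand]
  have := natDegree_chordPoly hl
  omega

theorem natDegree_foldPoly (m : ℕ) (hm : 2 ≤ m) : (foldPoly m).natDegree ≤ 2 * (m - 2) := by
  induction m using Nat.strong_induction_on with
  | _ m ih =>
    rw [foldPoly_eq hm]
    refine Polynomial.natDegree_add_le_of_degree_le ?_ ?_
    · exact (natDegree_expand_chordPoly (by omega)).trans (by omega)
    · refine Polynomial.natDegree_sum_le_of_forall_le _ _ fun j hj => ?_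
      have hj' := mem_Ico.1 hj
      refine (Polynomial.natDegree_mul_le.trans (add_le_add Polynomial.natDegree_X_le
        (Polynomial.natDegree_mul_le.trans (add_le_add (ih j hj'.2 hj'.1)
          (natDegree_expand_chordPoly (by omega)))))).trans (by omega)

/-- The analogue of `defectPoly` for `foldPoly`, for the polygon with `h + 3` vertices. -/
noncomputable def foldDefectPoly (h : ℕ) : Polynomial ℚ :=
  (foldPoly (h + 2)).reflect (2 * h)

theorem reflect_expand (h : ℕ) :
    (Polynomial.expand ℚ 2 (chordPoly (h + 1))).reflect (2 * h) =
      Polynomial.expand ℚ 2 (chordDefectPoly h) := by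
  ext k
  rw [chordDefectPoly, Polynomial.coeff_reflect, Polynomial.coeff_expand two_pos,
    Polynomial.coeff_expand two_pos, Polynomial.coeff_reflect]
  rcases le_or_gt k (2 * h) with hk | hk
  · rw [Polynomial.revAt_le hk]
    by_cases h2 : 2 ∣ k
    · rw [if_pos h2, if_pos (by omega), Polynomial.revAt_le (by omega)]
      congr 1
      omega
    · rw [if_neg h2, if_neg (by omega)]
  · rw [Polynomial.revAt_eq_self_of_lt hk]
    split_ifs with h2
    · rw [Polynomial.revAt_eq_self_of_lt (by omega)]
    · rfl

theorem foldDefectPoly_zero : foldDefectPoly 0 = 1 := by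
  rw [foldDefectPoly, foldPoly_eq (by omega)]
  simp [chordPoly_one]

/-- The room for a diagonal of weight `2` is taken by the splitting diagonal of weight `1`, so each
diagonal at `0` adds one to the defect: `X` reversed in degree `2` is again `X`. Hence each
coefficient of `foldDefectPoly` is determined by those of lower order. -/
theorem foldDefectPoly_succ (h : ℕ) :
    foldDefectPoly (h + 1) = Polynomial.expand ℚ 2 (chordDefectPoly (h + 1)) +
      Polynomial.X * ∑ p ∈ antidiagonal h,
        foldDefectPoly p.1 * Polynomial.expand ℚ 2 (chordDefectPoly p.2) := by
  rw [foldDefectPoly, foldPoly_eq (by omega), Polynomial.reflect_add, ← reflect_expand,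
    reflect_sum, Nat.sum_antidiagonal_eq_sum_range_succ (fun i j => foldDefectPoly i *
      Polynomial.expand ℚ 2 (chordDefectPoly j)), sum_Ico_eq_sum_range, mul_sum]
  refine congrArg _ (sum_congr (by congr 1) fun j hj => ?_)
  have hj' := mem_range.1 hj
  rw [foldDefectPoly, ← reflect_expand,
    show 2 * (h + 1) = 2 + (2 * j + 2 * (h - j)) by omega, Polynomial.reflect_mul,
    Polynomial.reflect_mul]
  · have hX : (Polynomial.X : Polynomial ℚ).reflect 2 = Polynomial.X := by
      simpa [Polynomial.revAt_le] using Polynomial.reflect_monomial (R := ℚ) 2 1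
    rw [hX, show 2 + j = j + 2 by omega, show h + 1 + 2 - (j + 2) = h - j + 1 by omega]
  · exact (natDegree_foldPoly _ (by omega)).trans (by omega)
  · exact (natDegree_expand_chordPoly (by omega)).trans (by omega)
  · exact Polynomial.natDegree_X_le.trans (by omega)
  · exact (Polynomial.natDegree_mul_le.trans (add_le_add
      (natDegree_foldPoly _ (by omega)) (natDegree_expand_chordPoly (by omega)))).trans (by omega)

theorem coeff_foldPoly {m d : ℕ} (hm : 2 ≤ m) (hd : d ≤ 2 * (m - 2)) :
    (foldPoly m).coeff (2 * (m - 2) - d) = (foldDefectPoly (m - 2)).coeff d := by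
  rw [foldDefectPoly, Polynomial.coeff_reflect, Polynomial.revAt_le hd, Nat.sub_add_cancel hm]

/-- The polynomial that counts the dissections of `{0, …, m}` as in `foldPoly`, except that the
chord `(1, m)` has weight `1`. -/
theorem indepSum_axis {m : ℕ} (hm : 3 ≤ m) :
    indepSum Interlace (diagonals 0 m)
      (fun p => (Polynomial.X : Polynomial ℚ) ^
        (if p.1 = 0 then 1 else if p = (1, m) then 1 else 2)) =
      foldPoly m + (Polynomial.X - Polynomial.X ^ 2) *
        Polynomial.expand ℚ 2 (dissectionPoly (m - 1)) := by
  set w : ℕ × ℕ → Polynomial ℚ := fun p => (Polynomial.X : Polynomial ℚ) ^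
        (if p.1 = 0 then 1 else if p = (1, m) then 1 else 2) with hw
  -- The correction concerns the sets that contain `(1, m)`. They have no diagonal at `0`, so the
  -- rest is a dissection of `{1, …, m}` in which every diagonal has weight `2`; changing the weight
  -- of `(1, m)` multiplies this by `X - X ^ 2`.
  have h1 : indepSum Interlace (diagonals 1 m) w =
      Polynomial.expand ℚ 2 (dissectionPoly (m - 1)) := by
    rw [indepSum_congr (w' := fun _ => Polynomial.X ^ 2) (fun _ _ _ _ => Iff.rfl)]
    · obtain ⟨l, rfl⟩ := Nat.exists_eq_add_of_le (show 1 ≤ m by omega)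
      have := map_indepSum Interlace (diagonals 0 l) (fun _ => (Polynomial.X : Polynomial ℚ))
        ((Polynomial.expand ℚ 2 : Polynomial ℚ →ₐ[ℚ] Polynomial ℚ) :
          Polynomial ℚ →+* Polynomial ℚ)
      simp only [RingHom.coe_coe, Polynomial.expand_X] at this
      rw [indepSum_diagonals_add, Nat.add_sub_cancel_left, dissectionPoly, this]
    · intro p hp
      have := mem_diagonals.1 hp
      rw [hw]
      simp only
      rw [if_neg (by omega), if_neg]
      rintro rfl
      omega
  have h2 : indepSum Interlace (chords 1 m) w =
      Polynomial.expand ℚ 2 (chordPoly (m - 1)) + (Polynomial.X - Polynomial.X ^ 2) *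
        Polynomial.expand ℚ 2 (dissectionPoly (m - 1)) := by
    rw [indepSum_chords (by omega), h1, chordPoly_eq (by omega), map_mul, map_add, map_one,
      Polynomial.expand_X, hw]
    simp
    ring
  rw [indepSum_diagonals (by omega), h2, foldPoly_eq (by omega)]
  have h3 : ∀ j ∈ Ico 2 m, w (0, j) * (indepSum Interlace (diagonals 0 j) w *
      indepSum Interlace (chords j m) w) = Polynomial.X * (foldPoly j *
        Polynomial.expand ℚ 2 (chordPoly (m - j))) := by
    intro j hj
    have hj' := mem_Ico.1 hj
    rw [indepSum_chords_X_sq hj'.2.le, foldPoly]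
    · rw [hw]
      simp only [if_true, pow_one]
      refine congrArg _ (congrArg (· * _) (indepSum_congr (fun _ _ _ _ => Iff.rfl) ?_))
      intro p hp
      have := mem_diagonals.1 hp
      rw [if_neg (c := p = (1, m))]
      rintro rfl
      omega
    · intro p hp
      have := mem_chords.1 hp
      rw [hw]
      simp only
      rw [if_neg (by omega), if_neg]
      rintro rfl
      omega
  rw [sum_congr rfl h3]
  ring

/-- The exponent is `2 (h - 1) - 3`, which accounts for the third coefficient of the folded
polynomial. The correction term is `X - X ^ 2` times a polynomial in `X ^ 2`, so in this odd degree
only its `X` contributes: dissections of one half that lack one diagonal. -/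
theorem coeff_indepSum_axis {h : ℕ} (hh : 3 ≤ h) :
    (indepSum Interlace (diagonals 0 (h + 1))
      (fun p => (Polynomial.X : Polynomial ℚ) ^
        (if p.1 = 0 then 1 else if p = (1, h + 1) then 1 else 2))).coeff (2 * h - 5) =
      (foldDefectPoly (h - 1)).coeff 3 + (defectPoly (h - 1)).coeff 1 := by
  rw [indepSum_axis (by omega), sub_mul, Polynomial.coeff_add, Polynomial.coeff_sub,
    show 2 * h - 5 = 2 * (h + 1 - 2) - 3 by omega, coeff_foldPoly (by omega) (by omega),
    show 2 * (h + 1 - 2) - 3 = (h - 3) * 2 + 1 by omega, Polynomial.coeff_X_mul,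
    Polynomial.coeff_expand_mul two_pos, pow_two, mul_assoc, Polynomial.coeff_X_mul,
    show h + 1 - 1 = h by omega, show h + 1 - 2 = h - 1 by omega,
    show h - 3 = h - 2 - 1 by omega, coeff_dissectionPoly (by omega)]
  rcases Nat.eq_zero_or_pos (h - 3) with h0 | h0
  · rw [show (h - 2 - 1) * 2 = 0 by omega, Polynomial.coeff_X_mul_zero, sub_zero]
  · rw [show (h - 2 - 1) * 2 = 2 * (h - 2 - 1) - 1 + 1 by omega, Polynomial.coeff_X_mul,
      Polynomial.coeff_expand two_pos, if_neg (by omega), sub_zero]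

end Folding

end PolygonDissection

namespace PolygonDissection

/-! ### The Catalan series and the coefficients of low defect -/

section GeneratingFunctions

open Finset PowerSeries

/-- The generating function of the `d`-th coefficients of a sequence of polynomials. -/
noncomputable def coeffSeries (d : ℕ) (p : ℕ → Polynomial ℚ) : ℚ⟦X⟧ :=
  PowerSeries.mk fun h => (p h).coeff d

theorem coeff_coeffSeries (d h : ℕ) (p : ℕ → Polynomial ℚ) :
    coeff h (coeffSeries d p) = (p h).coeff d := coeff_mk _ _

theorem coeffSeries_convolution (d : ℕ) (p q : ℕ → Polynomial ℚ) :
    coeffSeries d (fun h => ∑ x ∈ antidiagonal h, p x.1 * q x.2) =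
      ∑ e ∈ antidiagonal d, coeffSeries e.1 p * coeffSeries e.2 q := by
  ext h
  simp only [coeff_coeffSeries, Polynomial.finsetSum_coeff, Polynomial.coeff_mul, map_sum,
    coeff_mul]
  exact sum_comm

/-- The Catalan generating function. -/
noncomputable def catalanGF : ℚ⟦X⟧ := PowerSeries.mk fun h => (catalan h : ℚ)

theorem coeff_catalanGF (h : ℕ) : coeff h catalanGF = catalan h := coeff_mk _ _

theorem catalanGF_eq : catalanGF = 1 + X * catalanGF ^ 2 := by
  ext n
  rcases n with _ | n
  · simp [catalanGF]
  · rw [map_add, coeff_one, if_neg n.succ_ne_zero, zero_add, coeff_succ_X_mul, sq, coeff_mul]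
    simp only [coeff_catalanGF]
    rw [catalan_succ']
    push_cast
    rfl

/-- The Euler operator `X * d / dX`. -/
noncomputable def euler (f : ℚ⟦X⟧) : ℚ⟦X⟧ := X * d⁄dX ℚ f

theorem coeff_euler (f : ℚ⟦X⟧) (h : ℕ) : coeff h (euler f) = h * coeff h f := by
  rcases h with _ | h
  · simp [euler]
  · rw [euler, coeff_succ_X_mul, coeff_derivative]
    push_cast
    ring

/-- The factor that is cancelled in every linear equation below. -/
theorem one_sub_ne_zero : (1 - 2 * X * catalanGF : ℚ⟦X⟧) ≠ 0 := by
  intro h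
  have := congrArg (coeff 0) h
  simp [mul_assoc] at this

theorem euler_catalanGF : (1 - 2 * X * catalanGF) * euler catalanGF = X * catalanGF ^ 2 := by
  have h := congrArg (d⁄dX ℚ) catalanGF_eq
  simp only [map_add, Derivation.leibniz, Derivation.leibniz_pow, derivative_one, derivative_X,
    smul_eq_mul, nsmul_eq_mul] at h
  rw [euler]
  push_cast at h
  linear_combination X * h

theorem euler_euler_catalanGF :
    (1 - 2 * X * catalanGF) * euler (euler catalanGF) =
      X * catalanGF ^ 2 + 4 * X * catalanGF * euler catalanGF + 2 * X * euler catalanGF ^ 2 := by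
  have h := congrArg (d⁄dX ℚ) euler_catalanGF
  have h2 : d⁄dX ℚ (2 : ℚ⟦X⟧) = 0 := by
    have := derivative_C (R := ℚ) (r := 2)
    rwa [map_ofNat] at this
  simp only [map_sub, Derivation.leibniz, Derivation.leibniz_pow, derivative_one, derivative_X,
    smul_eq_mul, nsmul_eq_mul, h2] at h
  have h3 : X * d⁄dX ℚ catalanGF = euler catalanGF := rfl
  have h4 : X * d⁄dX ℚ (euler catalanGF) = euler (euler catalanGF) := rfl
  push_cast at h
  rw [← h4]
  linear_combination X * h + (2 * X * euler catalanGF + 2 * X * catalanGF) * h3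

theorem coeffSeries_eq_X_mul {d : ℕ} {p q b : ℕ → Polynomial ℚ} (h0 : (p 0).coeff d = 0)
    (hs : ∀ h, (p (h + 1)).coeff d = (∑ x ∈ antidiagonal h, q x.1 * b x.2).coeff d) :
    coeffSeries d p = X * ∑ e ∈ antidiagonal d, coeffSeries e.1 q * coeffSeries e.2 b := by
  rw [← coeffSeries_convolution]
  ext h
  rcases h with _ | h
  · simp [coeff_coeffSeries, h0]
  · rw [coeff_coeffSeries, hs, coeff_succ_X_mul, coeff_coeffSeries]

theorem coeffSeries_zero_chordDefectPoly :
    coeffSeries 0 chordDefectPoly = coeffSeries 0 defectPoly := by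
  ext h
  rw [coeff_coeffSeries, coeff_coeffSeries]
  rcases h with _ | h
  · simp [chordDefectPoly_zero, defectPoly]
  · rw [chordDefectPoly_succ, add_mul, one_mul, Polynomial.coeff_add, Polynomial.coeff_X_mul_zero,
      add_zero]

/-- The factor `1 + X` of `chordDefectPoly_succ` is absent for `h = 0`; the summand `-1` corrects
this. -/
theorem coeffSeries_one_chordDefectPoly :
    coeffSeries 1 chordDefectPoly =
      coeffSeries 1 defectPoly + coeffSeries 0 defectPoly - 1 := by
  ext h
  rw [map_sub, map_add, coeff_coeffSeries, coeff_coeffSeries, coeff_coeffSeries, coeff_one]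
  rcases h with _ | h
  · simp [chordDefectPoly_zero, defectPoly, Polynomial.coeff_one]
  · rw [chordDefectPoly_succ, add_mul, one_mul, Polynomial.coeff_add, Polynomial.coeff_X_mul,
      if_neg h.succ_ne_zero, sub_zero]

theorem coeffSeries_two_chordDefectPoly :
    coeffSeries 2 chordDefectPoly = coeffSeries 2 defectPoly + coeffSeries 1 defectPoly := by
  ext h
  rw [map_add, coeff_coeffSeries, coeff_coeffSeries, coeff_coeffSeries]
  rcases h with _ | h
  · simp [chordDefectPoly_zero, defectPoly, Polynomial.coeff_one]
  · rw [chordDefectPoly_succ, add_mul, one_mul, Polynomial.coeff_add, Polynomial.coeff_X_mul]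

/-- Both series satisfy `F = 1 + X F ^ 2`. The difference of the two equations factors, and the
second factor has constant coefficient `1`. -/
theorem coeffSeries_zero_defectPoly : coeffSeries 0 defectPoly = catalanGF := by
  have h : coeffSeries 0 defectPoly = 1 + X * coeffSeries 0 defectPoly ^ 2 := by
    -- The value `1` at `h = 0` is subtracted because `coeffSeries_eq_X_mul` requires a vanishing
    -- initial coefficient.
    have h1 := coeffSeries_eq_X_mul (d := 0) (p := fun h => defectPoly h - if h = 0 then 1 else 0)
      (q := defectPoly) (b := chordDefectPoly) (by simp [defectPoly])
      (fun h => by simp [defectPoly_succ])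
    have h2 : coeffSeries 0 (fun h => defectPoly h - if h = 0 then 1 else 0) =
        coeffSeries 0 defectPoly - 1 := by
      ext h
      rw [map_sub, coeff_coeffSeries, coeff_coeffSeries, coeff_one, Polynomial.coeff_sub]
      split_ifs <;> simp
    rw [h2] at h1
    simp only [Nat.sum_antidiagonal_eq_sum_range_succ_mk, sum_range_succ, sum_range_zero,
      zero_add, Nat.sub_zero, coeffSeries_zero_chordDefectPoly] at h1
    linear_combination h1
  have h' : (coeffSeries 0 defectPoly - catalanGF) *
      (1 - X * (coeffSeries 0 defectPoly + catalanGF)) = 0 := by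
    linear_combination h - catalanGF_eq
  rcases mul_eq_zero.1 h' with h' | h'
  · exact sub_eq_zero.1 h'
  · have := congrArg (coeff 0) h'
    simp at this

theorem coeffSeries_one_defectPoly :
    2 * coeffSeries 1 defectPoly = euler catalanGF - catalanGF + 1 := by
  have h := coeffSeries_eq_X_mul (d := 1) (p := defectPoly) (q := defectPoly)
    (b := chordDefectPoly) (by simp [defectPoly, Polynomial.coeff_one])
    (fun h => by rw [defectPoly_succ])
  simp only [Nat.sum_antidiagonal_eq_sum_range_succ_mk, sum_range_succ, sum_range_zero,
    zero_add, Nat.sub_zero, Nat.sub_self, Nat.succ_eq_add_one, Nat.reduceAdd, coeffSeries_zero_chordDefectPoly,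
    coeffSeries_one_chordDefectPoly, coeffSeries_zero_defectPoly] at h
  refine mul_left_cancel₀ one_sub_ne_zero ?_
  linear_combination 2 * h - euler_catalanGF + catalanGF_eq

/-- With `D₁`, `D₂` for the first and second coefficient series, the convolution reads `(1 - 2XC) D₂
= X (C D₁ + D₁ (D₁ + C - 1))`. It remains to check that the right-hand side of the claim, written
with `X d/dX`, solves this equation. -/
theorem coeffSeries_two_defectPoly :
    16 * coeffSeries 2 defectPoly = 2 * euler (euler catalanGF) - 7 * euler catalanGF +
      7 * catalanGF - 2 * X * catalanGF - 7 := by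
  have h := coeffSeries_eq_X_mul (d := 2) (p := defectPoly) (q := defectPoly)
    (b := chordDefectPoly) (by simp [defectPoly, Polynomial.coeff_one])
    (fun h => by rw [defectPoly_succ])
  simp only [Nat.sum_antidiagonal_eq_sum_range_succ_mk, sum_range_succ, sum_range_zero,
    zero_add, Nat.sub_zero, Nat.sub_self, Nat.succ_eq_add_one, Nat.reduceAdd, Nat.reduceSub, coeffSeries_zero_chordDefectPoly,
    coeffSeries_one_chordDefectPoly, coeffSeries_two_chordDefectPoly,
    coeffSeries_zero_defectPoly] at h
  have h1 := coeffSeries_one_defectPoly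
  have h2 := euler_catalanGF
  have h3 := euler_euler_catalanGF
  have h4 := catalanGF_eq
  generalize coeffSeries 2 defectPoly = k2 at *
  generalize coeffSeries 1 defectPoly = k1 at *
  generalize euler (euler catalanGF) = tt at *
  generalize euler catalanGF = t at *
  refine mul_left_cancel₀ one_sub_ne_zero ?_
  -- The coefficient of `h1` contains the sum of its two sides because `D₁ ^ 2` has to be replaced
  -- as a difference of squares.
  linear_combination 16 * h + (4 * X * (2 * k1 + (t - catalanGF + 1)) + 16 * X * catalanGF -
    8 * X) * h1 - 2 * h3 + 7 * h2 + (4 * X - 7) * h4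

theorem coeffSeries_expand {d : ℕ} :
    coeffSeries d (fun h => Polynomial.expand ℚ 2 (chordDefectPoly h)) =
      if 2 ∣ d then coeffSeries (d / 2) chordDefectPoly else 0 := by
  ext h
  rw [coeff_coeffSeries, Polynomial.coeff_expand two_pos]
  split_ifs
  · rw [coeff_coeffSeries]
  · rw [map_zero]

theorem coeffSeries_zero_foldDefectPoly : coeffSeries 0 foldDefectPoly = catalanGF := by
  rw [← coeffSeries_zero_defectPoly, ← coeffSeries_zero_chordDefectPoly]
  ext h
  rw [coeff_coeffSeries, coeff_coeffSeries]
  rcases h with _ | h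
  · rw [foldDefectPoly_zero, chordDefectPoly_zero]
  · rw [foldDefectPoly_succ, Polynomial.coeff_add, Polynomial.coeff_X_mul_zero, add_zero,
      Polynomial.coeff_expand two_pos]
    simp

theorem coeffSeries_succ_foldDefectPoly (d : ℕ) :
    coeffSeries (d + 1) foldDefectPoly =
      coeffSeries (d + 1) (fun h => Polynomial.expand ℚ 2 (chordDefectPoly h)) +
      X * ∑ e ∈ antidiagonal d, coeffSeries e.1 foldDefectPoly *
        coeffSeries e.2 (fun h => Polynomial.expand ℚ 2 (chordDefectPoly h)) := by
  rw [← coeffSeries_convolution]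
  ext h
  rw [map_add, coeff_coeffSeries, coeff_coeffSeries]
  rcases h with _ | h
  · simp [foldDefectPoly_zero, chordDefectPoly_zero]
  · rw [coeff_succ_X_mul, foldDefectPoly_succ, Polynomial.coeff_add, Polynomial.coeff_X_mul,
      coeff_coeffSeries]

theorem coeffSeries_one_foldDefectPoly : coeffSeries 1 foldDefectPoly = catalanGF - 1 := by
  rw [coeffSeries_succ_foldDefectPoly 0, coeffSeries_expand,
    Nat.sum_antidiagonal_eq_sum_range_succ_mk, sum_range_one, coeffSeries_expand]
  simp only [coeffSeries_zero_foldDefectPoly, coeffSeries_zero_chordDefectPoly, Nat.sub_zero,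
    coeffSeries_zero_defectPoly, dvd_zero, if_true, Nat.zero_div]
  rw [if_neg (by decide)]
  linear_combination - catalanGF_eq

theorem coeffSeries_two_foldDefectPoly :
    2 * coeffSeries 2 foldDefectPoly =
      euler catalanGF + 3 * catalanGF - 3 - 2 * X * catalanGF := by
  rw [coeffSeries_succ_foldDefectPoly 1]
  simp only [Nat.sum_antidiagonal_eq_sum_range_succ_mk, sum_range_succ, sum_range_zero,
    zero_add, Nat.sub_zero, Nat.sub_self, Nat.succ_eq_add_one, Nat.reduceAdd, coeffSeries_expand]
  norm_num [coeffSeries_zero_chordDefectPoly, coeffSeries_one_chordDefectPoly,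
    coeffSeries_zero_defectPoly, coeffSeries_one_foldDefectPoly]
  linear_combination coeffSeries_one_defectPoly - 2 * catalanGF_eq

theorem coeffSeries_three_foldDefectPoly :
    2 * coeffSeries 3 foldDefectPoly =
      euler catalanGF + 3 * catalanGF - 3 - 6 * X * catalanGF + 2 * X := by
  have h2 := coeffSeries_two_foldDefectPoly
  rw [coeffSeries_succ_foldDefectPoly 2]
  simp only [Nat.sum_antidiagonal_eq_sum_range_succ_mk, sum_range_succ, sum_range_zero,
    zero_add, Nat.sub_zero, Nat.sub_self, Nat.succ_eq_add_one, Nat.reduceAdd, Nat.reduceSub, coeffSeries_expand]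
  norm_num [coeffSeries_zero_chordDefectPoly, coeffSeries_one_chordDefectPoly,
    coeffSeries_zero_defectPoly, coeffSeries_one_foldDefectPoly, coeffSeries_zero_foldDefectPoly]
  linear_combination X * catalanGF * h2 + X * catalanGF * coeffSeries_one_defectPoly -
    euler_catalanGF + (2 * X - 3) * catalanGF_eq

theorem defectPoly_coeff_zero (h : ℕ) : (defectPoly h).coeff 0 = catalan h := by
  rw [← coeff_coeffSeries, coeffSeries_zero_defectPoly, coeff_catalanGF]

theorem coeff_ofNat_mul (a : ℕ) [a.AtLeastTwo] (f : ℚ⟦X⟧) (h : ℕ) :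
    coeff h ((ofNat(a) : ℚ⟦X⟧) * f) = (ofNat(a) : ℚ) * coeff h f := by
  rw [← map_ofNat (PowerSeries.C (R := ℚ)) a, coeff_C_mul]

theorem defectPoly_coeff_one {h : ℕ} (hh : 1 ≤ h) :
    (defectPoly h).coeff 1 = ((h : ℚ) - 1) / 2 * catalan h := by
  have := congrArg (coeff h) coeffSeries_one_defectPoly
  rw [coeff_ofNat_mul, map_add, map_sub, coeff_euler, coeff_coeffSeries, coeff_catalanGF,
    coeff_one, if_neg (by omega)] at this
  linear_combination this / 2

theorem defectPoly_coeff_two (h : ℕ) :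
    16 * (defectPoly (h + 1)).coeff 2 =
      (2 * ((h : ℚ) + 1) ^ 2 - 7 * (h + 1) + 7) * catalan (h + 1) - 2 * catalan h := by
  have := congrArg (coeff (h + 1)) coeffSeries_two_defectPoly
  rw [← map_ofNat (PowerSeries.C (R := ℚ)) 7, mul_assoc 2 X] at this
  simp only [coeff_ofNat_mul, coeff_C_mul, map_add, map_sub, coeff_euler, coeff_coeffSeries,
    coeff_catalanGF, coeff_C, coeff_succ_X_mul] at this
  rw [if_neg (by omega)] at this
  push_cast at this
  linear_combination this

theorem foldDefectPoly_coeff_one {h : ℕ} (hh : 1 ≤ h) :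
    (foldDefectPoly h).coeff 1 = catalan h := by
  rw [← coeff_coeffSeries, coeffSeries_one_foldDefectPoly, map_sub, coeff_catalanGF, coeff_one,
    if_neg (by omega), sub_zero]

theorem foldDefectPoly_coeff_two (h : ℕ) :
    (foldDefectPoly (h + 1)).coeff 2 =
      ((h : ℚ) + 4) / 2 * catalan (h + 1) - catalan h := by
  have := congrArg (coeff (h + 1)) coeffSeries_two_foldDefectPoly
  rw [← map_ofNat (PowerSeries.C (R := ℚ)) 3, mul_assoc 2 X] at this
  simp only [coeff_ofNat_mul, coeff_C_mul, map_add, map_sub, coeff_euler, coeff_coeffSeries,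
    coeff_catalanGF, coeff_C, coeff_succ_X_mul] at this
  rw [if_neg (by omega)] at this
  push_cast at this
  linear_combination this / 2

theorem foldDefectPoly_coeff_three {h : ℕ} (hh : 1 ≤ h) :
    (foldDefectPoly (h + 1)).coeff 3 =
      ((h : ℚ) + 4) / 2 * catalan (h + 1) - 3 * catalan h := by
  have := congrArg (coeff (h + 1)) coeffSeries_three_foldDefectPoly
  rw [← map_ofNat (PowerSeries.C (R := ℚ)) 3, mul_assoc 6 X] at this
  simp only [coeff_ofNat_mul, coeff_C_mul, map_add, map_sub, coeff_euler, coeff_coeffSeries,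
    coeff_catalanGF, coeff_C, coeff_succ_X_mul, coeff_X] at this
  rw [if_neg (by omega), if_neg (by omega)] at this
  push_cast at this
  linear_combination this / 2

end GeneratingFunctions

end PolygonDissection

namespace PolygonDissection

/-! ### Dissections as sets of pairs; invariant sets as unions of orbits -/

section Coding

open Finset

/-- The chord of the `n`-gon with given end points. -/
def toChord (n : ℕ) (p : ℕ × ℕ) : Sym2 (ZMod n) := s((p.1 : ZMod n), (p.2 : ZMod n))

variable {n : ℕ}

theorem toChord_injOn {p q : ℕ × ℕ} (hp : p.1 < p.2) (hp' : p.2 < n) (hq : q.1 < q.2)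
    (hq' : q.2 < n) (h : toChord n p = toChord n q) : p = q := by
  have v : ∀ a b : ℕ, a < n → b < n → (a : ZMod n) = b → a = b := fun a b ha hb hab => by
    rw [← ZMod.val_natCast_of_lt ha, ← ZMod.val_natCast_of_lt hb, hab]
  rcases Sym2.eq_iff.1 h with ⟨h1, h2⟩ | ⟨h1, h2⟩
  · exact Prod.ext (v _ _ (by omega) (by omega) h1) (v _ _ hp' hq' h2)
  · have := v _ _ (by omega) hq' h1
    have := v _ _ hp' (by omega) h2
    omega

theorem crosses_toChord {p q : ℕ × ℕ} (hp : p.1 < p.2) (hp' : p.2 < n) (hq : q.1 < q.2)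
    (hq' : q.2 < n) : Crosses (toChord n p) (toChord n q) ↔ Interlace p q := by
  have v : ∀ a : ℕ, a < n → (a : ZMod n).val = a := fun a ha => ZMod.val_natCast_of_lt ha
  have h1 := v p.1 (by omega)
  have h2 := v p.2 hp'
  have h3 := v q.1 (by omega)
  have h4 := v q.2 hq'
  unfold Interlace
  constructor
  · rintro ⟨a, b, c, d, he, hf, h⟩
    rcases Sym2.eq_iff.1 he with ⟨rfl, rfl⟩ | ⟨rfl, rfl⟩ <;>
      rcases Sym2.eq_iff.1 hf with ⟨rfl, rfl⟩ | ⟨rfl, rfl⟩ <;>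
      rw [h1, h2, h3, h4] at h <;> omega
  · intro h
    exact ⟨_, _, _, _, rfl, rfl, by rw [h1, h2, h3, h4]; exact h⟩

theorem exists_toChord [NeZero n] {e : Sym2 (ZMod n)} (he : IsDiagonal e) :
    ∃ p ∈ diagonals 0 (n - 1), toChord n p = e := by
  obtain ⟨a, b, rfl, h1, h2, h3⟩ := he
  wlog hab : a.val < b.val generalizing a b
  · have hne : a.val ≠ b.val := fun h => h1 (ZMod.val_injective n h)
    rw [Sym2.eq_swap]
    exact this b a h1.symm h3 h2 (by omega)
  have ha : ((a.val : ℕ) : ZMod n) = a := ZMod.natCast_zmod_val a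
  have hb : ((b.val : ℕ) : ZMod n) = b := ZMod.natCast_zmod_val b
  have hbn := ZMod.val_lt b
  refine ⟨(a.val, b.val), mem_diagonals.2 ⟨Nat.zero_le _, ?_, by simp only; omega, ?_⟩, ?_⟩
  · simp only
    by_contra hlt
    apply h2
    rw [← hb, show b.val = a.val + 1 by omega]
    push_cast
    rw [ha]
  · rintro ⟨h4, h5⟩
    apply h3
    simp only at h4 h5
    rw [← ha, ← hb, h4, h5, ← Nat.cast_succ, Nat.succ_eq_add_one, Nat.sub_add_cancel (by omega)]
    simp
  · rw [toChord, ha, hb]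

theorem isDiagonal_toChord {p : ℕ × ℕ} (hp : p ∈ diagonals 0 (n - 1)) :
    IsDiagonal (toChord n p) := by
  have h := mem_diagonals.1 hp
  have v : ∀ a : ℕ, a < n → (a : ZMod n).val = a := fun a ha => ZMod.val_natCast_of_lt ha
  have h1 := v p.1 (by omega)
  have h2 := v p.2 (by omega)
  refine ⟨_, _, rfl, ?_, ?_, ?_⟩ <;> intro h3
  · rw [h3] at h1
    omega
  · have h4 := v (p.1 + 1) (by omega)
    rw [h3, ← Nat.cast_succ, Nat.succ_eq_add_one] at h2
    omega
  · rcases Nat.lt_or_ge (p.2 + 1) n with h4 | h4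
    · have h5 := v (p.2 + 1) h4
      rw [h3, ← Nat.cast_succ, Nat.succ_eq_add_one] at h1
      omega
    · rw [h3, ← Nat.cast_succ, Nat.succ_eq_add_one, show p.2 + 1 = n by omega,
        ZMod.natCast_self, ZMod.val_zero] at h1
      omega

theorem lt_of_mem_diagonals {p : ℕ × ℕ} (hp : p ∈ diagonals 0 (n - 1)) : p.1 < p.2 ∧ p.2 < n := by
  have h := mem_diagonals.1 hp
  omega

theorem toChord_inj {p q : ℕ × ℕ} (hp : p ∈ diagonals 0 (n - 1)) (hq : q ∈ diagonals 0 (n - 1))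
    (h : toChord n p = toChord n q) : p = q :=
  toChord_injOn (lt_of_mem_diagonals hp).1 (lt_of_mem_diagonals hp).2 (lt_of_mem_diagonals hq).1
    (lt_of_mem_diagonals hq).2 h

theorem crosses_toChord_iff {p q : ℕ × ℕ} (hp : p ∈ diagonals 0 (n - 1))
    (hq : q ∈ diagonals 0 (n - 1)) : Crosses (toChord n p) (toChord n q) ↔ Interlace p q :=
  crosses_toChord (lt_of_mem_diagonals hp).1 (lt_of_mem_diagonals hp).2 (lt_of_mem_diagonals hq).1
    (lt_of_mem_diagonals hq).2

open Classical in
/-- A dissection as a set of pairs of natural numbers. -/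
noncomputable def code (Φ : Dissection n) : Finset (ℕ × ℕ) :=
  {p ∈ diagonals 0 (n - 1) | toChord n p ∈ Φ.diagonals}

theorem mem_code {Φ : Dissection n} {p : ℕ × ℕ} :
    p ∈ code Φ ↔ p ∈ diagonals 0 (n - 1) ∧ toChord n p ∈ Φ.diagonals := by
  classical
  rw [code, mem_filter]

theorem code_subset (Φ : Dissection n) : code Φ ⊆ diagonals 0 (n - 1) :=
  fun _ hp => (mem_code.1 hp).1

theorem isIndep_code (Φ : Dissection n) : IsIndep Interlace (code Φ) := by
  intro p hp q hq h
  rw [mem_code] at hp hq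
  exact Φ.noncrossing _ hp.2 _ hq.2 ((crosses_toChord_iff hp.1 hq.1).2 h)

theorem image_code [NeZero n] (Φ : Dissection n) : (code Φ).image (toChord n) = Φ.diagonals := by
  ext e
  rw [mem_image]
  constructor
  · rintro ⟨p, hp, rfl⟩
    exact (mem_code.1 hp).2
  · intro he
    obtain ⟨p, hp, rfl⟩ := exists_toChord (Φ.isDiagonal e he)
    exact ⟨p, mem_code.2 ⟨hp, he⟩, rfl⟩

theorem card_code [NeZero n] (Φ : Dissection n) : #(code Φ) = #Φ.diagonals := by
  rw [← image_code, card_image_of_injOn]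
  intro p hp q hq h
  exact toChord_inj (code_subset Φ hp) (code_subset Φ hq) h

theorem code_injective [NeZero n] : Function.Injective (code (n := n)) := by
  intro Φ Ψ h
  apply Dissection.ext
  rw [← image_code, ← image_code, h]

/-- The dissection with a given set of pairs. -/
def ofCode (A : Finset (ℕ × ℕ)) (hA : A ⊆ diagonals 0 (n - 1)) (hi : IsIndep Interlace A) :
    Dissection n where
  diagonals := A.image (toChord n)
  isDiagonal e he := by
    obtain ⟨p, hp, rfl⟩ := mem_image.1 he
    exact isDiagonal_toChord (hA hp)
  noncrossing e he f hf h := by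
    obtain ⟨p, hp, rfl⟩ := mem_image.1 he
    obtain ⟨q, hq, rfl⟩ := mem_image.1 hf
    exact hi p hp q hq ((crosses_toChord_iff (hA hp) (hA hq)).1 h)

theorem code_ofCode (A : Finset (ℕ × ℕ)) (hA : A ⊆ diagonals 0 (n - 1))
    (hi : IsIndep Interlace A) : code (ofCode A hA hi) = A := by
  ext p
  rw [mem_code]
  constructor
  · rintro ⟨hp, h⟩
    obtain ⟨q, hq, hpq⟩ := mem_image.1 h
    rwa [← toChord_inj (hA hq) hp hpq]
  · exact fun hp => ⟨hA hp, mem_image_of_mem _ hp⟩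

instance [NeZero n] : Finite (Dissection n) :=
  Finite.of_injective (fun Φ => Φ.diagonals) fun _ _ h => Dissection.ext h

/-- One inclusion suffices, since a symmetry preserves the number of diagonals. -/
theorem smul_eq_self_iff [NeZero n] {g : DihedralGroup n} {Φ : Dissection n} :
    g • Φ = Φ ↔ ∀ e ∈ Φ.diagonals, moveChord g e ∈ Φ.diagonals := by
  constructor
  · intro h e he
    have := congrArg Dissection.diagonals h
    rw [smul_diagonals] at this
    rw [← this]
    exact mem_image_of_mem _ he
  · intro h
    apply Dissection.ext
    rw [smul_diagonals]
    refine eq_of_subset_of_card_le (image_subset_iff.2 h) ?_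
    rw [card_image_of_injective _ (moveChord_injective g)]

theorem smul_eq_self_iff_code [NeZero n] {g : DihedralGroup n} {μ : ℕ × ℕ → ℕ × ℕ}
    (hμ : ∀ p ∈ diagonals 0 (n - 1),
      μ p ∈ diagonals 0 (n - 1) ∧ toChord n (μ p) = moveChord g (toChord n p))
    {Φ : Dissection n} : g • Φ = Φ ↔ ∀ p ∈ code Φ, μ p ∈ code Φ := by
  rw [smul_eq_self_iff]
  constructor
  · intro h p hp
    obtain ⟨hp1, hp2⟩ := mem_code.1 hp
    rw [mem_code, (hμ p hp1).2]
    exact ⟨(hμ p hp1).1, h _ hp2⟩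
  · intro h e he
    obtain ⟨p, hp, rfl⟩ := exists_toChord (Φ.isDiagonal e he)
    rw [← (hμ p hp).2]
    exact (mem_code.1 (h p (mem_code.2 ⟨hp, he⟩))).2

open Classical in
/-- Dissections that are fixed by a symmetry and contain given diagonals, in terms of their
codes. -/
theorem card_fixed_eq [NeZero n] {g : DihedralGroup n} {μ : ℕ × ℕ → ℕ × ℕ}
    (hμ : ∀ p ∈ diagonals 0 (n - 1),
      μ p ∈ diagonals 0 (n - 1) ∧ toChord n (μ p) = moveChord g (toChord n p))
    (L : Finset (ℕ × ℕ)) (k : ℕ) :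
    Nat.card {Φ : Dissection n // g • Φ = Φ ∧ L ⊆ code Φ ∧ #Φ.diagonals = k} =
      #{A ∈ (diagonals 0 (n - 1)).powerset |
        IsIndep Interlace A ∧ (∀ p ∈ A, μ p ∈ A) ∧ L ⊆ A ∧ #A = k} := by
  rw [← Nat.card_eq_finsetCard]
  have hmem : ∀ Φ : {Φ : Dissection n // g • Φ = Φ ∧ L ⊆ code Φ ∧ #Φ.diagonals = k},
      code Φ.1 ∈ ({A ∈ (diagonals 0 (n - 1)).powerset |
        IsIndep Interlace A ∧ (∀ p ∈ A, μ p ∈ A) ∧ L ⊆ A ∧ #A = k} : Finset _) := by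
    rintro ⟨Φ, h1, h2, h3⟩
    rw [mem_filter, mem_powerset]
    exact ⟨code_subset Φ, isIndep_code Φ, (smul_eq_self_iff_code hμ).1 h1, h2,
      by rw [card_code, h3]⟩
  refine Nat.card_congr (Equiv.ofBijective (fun Φ => ⟨code Φ.1, hmem Φ⟩) ⟨?_, ?_⟩)
  · intro Φ Ψ h
    exact Subtype.ext (code_injective (Subtype.ext_iff.1 h))
  · rintro ⟨A, hA⟩
    rw [mem_filter, mem_powerset] at hA
    obtain ⟨h1, h2, h3, h4, h5⟩ := hA
    have hc := code_ofCode A h1 h2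
    refine ⟨⟨ofCode A h1 h2, ?_, by rwa [hc], by rw [← card_code, hc, h5]⟩, Subtype.ext hc⟩
    rw [smul_eq_self_iff_code hμ, hc]
    exact h3

open Classical in
/-- A set that is invariant under `μ` and contains `L` is the union of `L` and of some of the
orbits `orb t`; the orbits that occur form an independent set. -/
theorem card_invariant {r : ℕ × ℕ → ℕ × ℕ → Prop} (hs : ∀ a b, r a b → r b a)
    {D T L : Finset (ℕ × ℕ)} {μ : ℕ × ℕ → ℕ × ℕ} {orb : ℕ × ℕ → Finset (ℕ × ℕ)}
    (orb_subset : ∀ t ∈ T, orb t ⊆ D) (orb_nonempty : ∀ t ∈ T, (orb t).Nonempty)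
    (orb_eq : ∀ t ∈ T, ∀ t' ∈ T, ∀ e ∈ orb t, e ∈ orb t' → t = t')
    (orb_inv : ∀ t ∈ T, ∀ e ∈ orb t, μ e ∈ orb t)
    (orb_trans : ∀ t ∈ T, ∀ e ∈ orb t, ∀ f ∈ orb t, ∃ k, μ^[k] e = f)
    (orb_rel : ∀ t ∈ T, ∀ t' ∈ T, (r t t' ↔ ∃ e ∈ orb t, ∃ f ∈ orb t', r e f))
    (hLD : L ⊆ D) (hLμ : ∀ e ∈ L, μ e ∈ L) (hLi : IsIndep r L)
    (hLT : ∀ t ∈ T, ∀ e ∈ orb t, e ∉ L ∧ ∀ f ∈ L, ¬ r e f)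
    (cover : ∀ A ⊆ D, IsIndep r A → (∀ p ∈ A, μ p ∈ A) → L ⊆ A →
      ∀ e ∈ A, e ∈ L ∨ ∃ t ∈ T, e ∈ orb t) (k : ℕ) :
    #{A ∈ D.powerset | IsIndep r A ∧ (∀ p ∈ A, μ p ∈ A) ∧ L ⊆ A ∧ #A = #L + k} =
      #{S ∈ T.powerset | IsIndep r S ∧ ∑ t ∈ S, #(orb t) = k} := by
  have hcard : ∀ S ⊆ T, #(L ∪ S.biUnion orb) = #L + ∑ t ∈ S, #(orb t) := by
    intro S hS
    rw [card_union_of_disjoint, card_biUnion]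
    · intro t ht t' ht' hne
      refine disjoint_left.2 ?_
      exact fun e he he' => hne (orb_eq t (hS ht) t' (hS ht') e he he')
    · rw [disjoint_right]
      intro e he
      obtain ⟨t, ht, he⟩ := mem_biUnion.1 he
      exact (hLT t (hS ht) e he).1
  have hiter : ∀ A : Finset (ℕ × ℕ), (∀ p ∈ A, μ p ∈ A) → ∀ k, ∀ e ∈ A, μ^[k] e ∈ A := by
    intro A hA k
    induction k with
    | zero => exact fun e he => he
    | succ k ih => exact fun e he => ih _ (hA e he)
  have horb : ∀ A : Finset (ℕ × ℕ), (∀ p ∈ A, μ p ∈ A) → ∀ t ∈ T, ∀ e ∈ orb t, e ∈ A →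
      orb t ⊆ A := by
    intro A hA t ht e he heA f hf
    obtain ⟨k, rfl⟩ := orb_trans t ht e he f hf
    exact hiter A hA k e heA
  symm
  refine card_bij (fun S _ => L ∪ S.biUnion orb) ?_ ?_ ?_
  · intro S hS
    rw [mem_filter, mem_powerset] at hS ⊢
    obtain ⟨hST, hSi, hSk⟩ := hS
    refine ⟨union_subset hLD (biUnion_subset.2 fun t ht => orb_subset t (hST ht)), ?_, ?_,
      subset_union_left, by rw [hcard S hST, hSk]⟩
    · intro a ha b hb hab
      rcases mem_union.1 ha with ha | ha <;> rcases mem_union.1 hb with hb | hb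
      · exact hLi a ha b hb hab
      · obtain ⟨t, ht, hb⟩ := mem_biUnion.1 hb
        exact (hLT t (hST ht) b hb).2 a ha (hs _ _ hab)
      · obtain ⟨t, ht, ha⟩ := mem_biUnion.1 ha
        exact (hLT t (hST ht) a ha).2 b hb hab
      · obtain ⟨t, ht, ha⟩ := mem_biUnion.1 ha
        obtain ⟨t', ht', hb⟩ := mem_biUnion.1 hb
        exact hSi t ht t' ht' ((orb_rel t (hST ht) t' (hST ht')).2 ⟨a, ha, b, hb, hab⟩)
    · intro p hp
      rcases mem_union.1 hp with hp | hp
      · exact mem_union_left _ (hLμ p hp)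
      · obtain ⟨t, ht, hp⟩ := mem_biUnion.1 hp
        exact mem_union_right _ (mem_biUnion.2 ⟨t, ht, orb_inv t (hST ht) p hp⟩)
  · have key : ∀ S ⊆ T, ∀ S' ⊆ T, L ∪ S.biUnion orb = L ∪ S'.biUnion orb → S ⊆ S' := by
      intro S hS S' hS' h t ht
      obtain ⟨e, he⟩ := orb_nonempty t (hS ht)
      have h1 : e ∈ L ∪ S'.biUnion orb := by
        rw [← h]
        exact mem_union_right _ (mem_biUnion.2 ⟨t, ht, he⟩)
      rcases mem_union.1 h1 with h1 | h1
      · exact absurd h1 (hLT t (hS ht) e he).1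
      · obtain ⟨t', ht', he'⟩ := mem_biUnion.1 h1
        rwa [orb_eq t (hS ht) t' (hS' ht') e he he']
    intro S hS S' hS' h
    rw [mem_filter, mem_powerset] at hS hS'
    exact (key S hS.1 S' hS'.1 h).antisymm (key S' hS'.1 S hS.1 h.symm)
  · intro A hA
    rw [mem_filter, mem_powerset] at hA
    obtain ⟨hAD, hAi, hAμ, hLA, hAk⟩ := hA
    have hA' : L ∪ ({t ∈ T | orb t ⊆ A}).biUnion orb = A := by
      apply subset_antisymm
      · exact union_subset hLA (biUnion_subset.2 fun t ht => (mem_filter.1 ht).2)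
      · intro e he
        rcases cover A hAD hAi hAμ hLA e he with h | ⟨t, ht, h⟩
        · exact mem_union_left _ h
        · exact mem_union_right _ (mem_biUnion.2
            ⟨t, mem_filter.2 ⟨ht, horb A hAμ t ht e h he⟩, h⟩)
    refine ⟨{t ∈ T | orb t ⊆ A}, mem_filter.2 ⟨mem_powerset.2 (filter_subset _ _), ?_, ?_⟩, hA'⟩
    · intro t ht t' ht' h
      rw [mem_filter] at ht ht'
      obtain ⟨e, he, f, hf, hef⟩ := (orb_rel t ht.1 t' ht'.1).1 h
      exact hAi e (ht.2 he) f (ht'.2 hf) hef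
    · have := hcard {t ∈ T | orb t ⊆ A} (filter_subset _ _)
      rw [hA'] at this
      omega

end Coding

end PolygonDissection

namespace PolygonDissection

/-! ### Dissections fixed by a reflection -/

section Reflections

open Finset

variable {n : ℕ}

/-- The invariant dissections of a polygon, counted by their orbits. -/
theorem card_fixed_eq_coeff [NeZero n] {g : DihedralGroup n} {μ : ℕ × ℕ → ℕ × ℕ}
    (hμ : ∀ p ∈ diagonals 0 (n - 1),
      μ p ∈ diagonals 0 (n - 1) ∧ toChord n (μ p) = moveChord g (toChord n p))
    {T : Finset (ℕ × ℕ)} {orb : ℕ × ℕ → Finset (ℕ × ℕ)}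
    (orb_subset : ∀ t ∈ T, orb t ⊆ diagonals 0 (n - 1))
    (orb_nonempty : ∀ t ∈ T, (orb t).Nonempty)
    (orb_eq : ∀ t ∈ T, ∀ t' ∈ T, ∀ e ∈ orb t, e ∈ orb t' → t = t')
    (orb_inv : ∀ t ∈ T, ∀ e ∈ orb t, μ e ∈ orb t)
    (orb_trans : ∀ t ∈ T, ∀ e ∈ orb t, ∀ f ∈ orb t, ∃ k, μ^[k] e = f)
    (orb_rel : ∀ t ∈ T, ∀ t' ∈ T,
      (Interlace t t' ↔ ∃ e ∈ orb t, ∃ f ∈ orb t', Interlace e f))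
    (cover : ∀ e ∈ diagonals 0 (n - 1), ¬ Interlace e (μ e) → ∃ t ∈ T, e ∈ orb t) (k : ℕ)
    (w : ℕ × ℕ → ℕ) (hw : ∀ t ∈ T, #(orb t) = w t) :
    (Nat.card {Φ : Dissection n // g • Φ = Φ ∧ #Φ.diagonals = k} : ℚ) =
      (indepSum Interlace T fun t => (Polynomial.X : Polynomial ℚ) ^ w t).coeff k := by
  classical
  have h1 := card_fixed_eq hμ ∅ k
  have h2 := card_invariant (L := ∅) interlace_symm orb_subset orb_nonempty orb_eq orb_inv
    orb_trans orb_rel (empty_subset _) (fun e he => absurd he (notMem_empty e))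
    (fun e he => absurd he (notMem_empty e))
    (fun t _ e _ => ⟨notMem_empty e, fun f hf => absurd hf (notMem_empty f)⟩)
    (fun A hA hi hAμ _ e he => Or.inr (cover e (hA he) (hi e he _ (hAμ e he)))) k
  simp only [empty_subset, true_and, card_empty, zero_add] at h1 h2
  rw [h1, h2, indepSum_congr (w' := fun t => Polynomial.X ^ #(orb t)) (fun _ _ _ _ => Iff.rfl)
    (fun t ht => by rw [hw t ht]), coeff_indepSum]

/-- The identity is treated as a symmetry whose orbits are singletons, so that the same counting
principle applies. -/
theorem card_dissections [NeZero n] (k : ℕ) :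
    (Nat.card {Φ : Dissection n // (1 : DihedralGroup n) • Φ = Φ ∧ #Φ.diagonals = k} : ℚ) =
      (dissectionPoly (n - 1)).coeff k := by
  rw [card_fixed_eq_coeff (μ := id) (T := diagonals 0 (n - 1)) (orb := fun t => {t})
    (w := fun _ => 1) (fun p hp => ⟨hp, (moveChord_one _).symm⟩)]
  · simp only [pow_one]
    rfl
  · exact fun t ht => singleton_subset_iff.2 ht
  · exact fun t _ => singleton_nonempty t
  · exact fun t _ t' _ e he he' => (mem_singleton.1 he).symm.trans (mem_singleton.1 he')
  · exact fun t _ e he => he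
  · exact fun t _ e he f hf => ⟨0, (mem_singleton.1 he).trans (mem_singleton.1 hf).symm⟩
  · intro t _ t' _
    simp only [mem_singleton, exists_eq_left]
  · exact fun e he _ => ⟨e, he, mem_singleton_self e⟩
  · exact fun t _ => card_singleton t

/-- A reflection without fixed vertices, or with one fixed vertex. -/
theorem card_fixed_sr_one [NeZero n] {h : ℕ} (h1 : 2 * h + 1 ≤ n) (h2 : n ≤ 2 * h + 2) (k : ℕ) :
    (Nat.card {Φ : Dissection n // DihedralGroup.sr (1 : ZMod n) • Φ = Φ ∧ #Φ.diagonals = k} : ℚ) =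
      (foldPoly (h + 1)).coeff k := by
  -- In the folded polygon `{0, …, h + 1}` the vertex `a ≥ 1` stands for the mirror images `a - 1`
  -- and `n - a`, and `0` stands for the axis. So `(0, b)` encodes the perpendicular diagonal from
  -- `b - 1` to `n - b`, and any other pair encodes two mirror diagonals. For `b = h + 1` the
  -- perpendicular chord is a side or degenerates to the fixed vertex, which is why `(0, h + 1)` is
  -- not among the diagonals.
  have hO : ∀ a b : ℕ, ∀ e : ℕ × ℕ,
      e ∈ (if a = 0 then {(b - 1, n - b)} else {(a - 1, b - 1), (n - b, n - a)} :
        Finset (ℕ × ℕ)) ↔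
      (a = 0 ∧ e.1 = b - 1 ∧ e.2 = n - b) ∨ (a ≠ 0 ∧ ((e.1 = a - 1 ∧ e.2 = b - 1) ∨
        (e.1 = n - b ∧ e.2 = n - a))) := by
    intro a b e
    split_ifs with ha <;> simp [ha, Prod.ext_iff]
  refine card_fixed_eq_coeff (μ := fun p => (n - 1 - p.2, n - 1 - p.1))
    (orb := fun t => if t.1 = 0 then {(t.2 - 1, n - t.2)} else
      {(t.1 - 1, t.2 - 1), (n - t.2, n - t.1)}) ?_ ?_ ?_ ?_ ?_ ?_ ?_ ?_ k _ ?_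
  · intro p hp
    have hp' := mem_diagonals.1 hp
    refine ⟨mem_diagonals.2 (by dsimp only; omega), ?_⟩
    rw [toChord, toChord, moveChord, Sym2.map_mk, Sym2.eq_swap]
    simp only [sr_smul]
    have hn1 : ((n - 1 : ℕ) : ZMod n) = -1 := by
      rw [Nat.cast_sub (by omega)]
      simp
    rw [Nat.cast_sub (m := p.1) (by omega), Nat.cast_sub (m := p.2) (by omega), hn1]
  · intro t ht e he
    rw [hO] at he
    rw [mem_diagonals] at ht ⊢
    rcases he with ⟨_, _, _⟩ | ⟨_, ⟨_, _⟩ | ⟨_, _⟩⟩ <;> omega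
  · intro t ht
    split_ifs <;> simp
  · intro t ht t' ht' e he he'
    rw [hO] at he he'
    rw [mem_diagonals] at ht ht'
    rcases he with ⟨_, _, _⟩ | ⟨_, ⟨_, _⟩ | ⟨_, _⟩⟩ <;>
      rcases he' with ⟨_, _, _⟩ | ⟨_, ⟨_, _⟩ | ⟨_, _⟩⟩ <;>
      exact Prod.ext (by omega) (by omega)
  · intro t ht e he
    rw [hO] at he ⊢
    rw [mem_diagonals] at ht
    simp only
    omega
  · intro t ht e he f hf
    rw [hO] at he hf
    rw [mem_diagonals] at ht
    by_cases hef : e = f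
    · exact ⟨0, hef⟩
    · refine ⟨1, ?_⟩
      rw [Prod.ext_iff] at hef
      rw [Function.iterate_one, Prod.ext_iff]
      dsimp only
      rcases he with ⟨_, _, _⟩ | ⟨_, ⟨_, _⟩ | ⟨_, _⟩⟩ <;>
        rcases hf with ⟨_, _, _⟩ | ⟨_, ⟨_, _⟩ | ⟨_, _⟩⟩ <;> omega
  · intro t ht t' ht'
    rw [mem_diagonals] at ht ht'
    simp only [hO]
    unfold Interlace
    constructor
    · intro hI
      by_cases ha : t.1 = 0
      · refine ⟨(t.2 - 1, n - t.2), Or.inl ⟨ha, rfl, rfl⟩, (t'.1 - 1, t'.2 - 1),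
          Or.inr ⟨by omega, Or.inl ⟨rfl, rfl⟩⟩, ?_⟩
        dsimp only
        omega
      · by_cases ha' : t'.1 = 0
        · refine ⟨(t.1 - 1, t.2 - 1), Or.inr ⟨by omega, Or.inl ⟨rfl, rfl⟩⟩, (t'.2 - 1, n - t'.2),
            Or.inl ⟨ha', rfl, rfl⟩, ?_⟩
          dsimp only
          omega
        · refine ⟨(t.1 - 1, t.2 - 1), Or.inr ⟨by omega, Or.inl ⟨rfl, rfl⟩⟩, (t'.1 - 1, t'.2 - 1),
            Or.inr ⟨by omega, Or.inl ⟨rfl, rfl⟩⟩, ?_⟩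
          dsimp only
          omega
    · rintro ⟨e, he, f, hf, hI⟩
      rcases he with ⟨_, _, _⟩ | ⟨_, ⟨_, _⟩ | ⟨_, _⟩⟩ <;>
        rcases hf with ⟨_, _, _⟩ | ⟨_, ⟨_, _⟩ | ⟨_, _⟩⟩ <;> omega
  -- A diagonal that passes from one side of the axis to the other crosses its mirror image unless
  -- it is perpendicular to the axis, i.e. unless its end points add up to `n - 1`.
  · intro e he hI
    rw [mem_diagonals] at he
    unfold Interlace at hI
    simp only at hI
    by_cases hs : e.1 + e.2 = n - 1
    · refine ⟨(0, e.1 + 1), mem_diagonals.2 (by dsimp only; omega), (hO _ _ _).2 ?_⟩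
      dsimp only
      omega
    · by_cases hlt : e.1 + e.2 < n - 1
      · refine ⟨(e.1 + 1, e.2 + 1), mem_diagonals.2 (by dsimp only; omega), (hO _ _ _).2 ?_⟩
        dsimp only
        omega
      · refine ⟨(n - e.2, n - e.1), mem_diagonals.2 (by dsimp only; omega), (hO _ _ _).2 ?_⟩
        dsimp only
        omega
  · intro t ht
    rw [mem_diagonals] at ht
    split_ifs with ha
    · rfl
    · rw [card_pair]
      rw [ne_eq, Prod.ext_iff]
      dsimp only
      omega

set_option maxHeartbeats 1000000 in
/-- A reflection with two fixed vertices. -/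
theorem card_fixed_sr_zero [NeZero n] {h : ℕ} (hn : n = 2 * h) (k : ℕ) :
    (Nat.card {Φ : Dissection n // DihedralGroup.sr (0 : ZMod n) • Φ = Φ ∧ #Φ.diagonals = k} : ℚ) =
      (indepSum Interlace (diagonals 0 (h + 1)) (fun p => (Polynomial.X : Polynomial ℚ) ^
        (if p.1 = 0 then 1 else if p = (1, h + 1) then 1 else 2))).coeff k := by
  -- Now `1` and `h + 1` stand for the fixed vertices `0` and `h`, and `(1, h + 1)` for the diagonal
  -- along the axis, whose orbit is a single chord. Pairs `(1, b)` form a case of their own because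
  -- the mirror image of `0` is `0`, not the label `n`.
  have hO : ∀ a b : ℕ, ∀ e : ℕ × ℕ,
      e ∈ (if a = 0 then {(b - 1, n + 1 - b)} else if a = 1 then {(0, b - 1), (0, n + 1 - b)} else
        {(a - 1, b - 1), (n + 1 - b, n + 1 - a)} : Finset (ℕ × ℕ)) ↔
      (a = 0 ∧ e.1 = b - 1 ∧ e.2 = n + 1 - b) ∨
      (a = 1 ∧ e.1 = 0 ∧ (e.2 = b - 1 ∨ e.2 = n + 1 - b)) ∨
      (2 ≤ a ∧ ((e.1 = a - 1 ∧ e.2 = b - 1) ∨ (e.1 = n + 1 - b ∧ e.2 = n + 1 - a))) := by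
    intro a b e
    split_ifs with ha ha'
    · simp [ha, Prod.ext_iff]
    · simp [ha', Prod.ext_iff]
      tauto
    · simp [ha, ha', Prod.ext_iff]
      omega
  refine card_fixed_eq_coeff
    (μ := fun p => if p.1 = 0 then (0, n - p.2) else (n - p.2, n - p.1))
    (orb := fun t => if t.1 = 0 then {(t.2 - 1, n + 1 - t.2)} else
      if t.1 = 1 then {(0, t.2 - 1), (0, n + 1 - t.2)} else
      {(t.1 - 1, t.2 - 1), (n + 1 - t.2, n + 1 - t.1)}) ?_ ?_ ?_ ?_ ?_ ?_ ?_ ?_ k _ ?_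
  · intro p hp
    have hp' := mem_diagonals.1 hp
    refine ⟨mem_diagonals.2 (by split_ifs <;> dsimp only <;> omega), ?_⟩
    rw [toChord, toChord, moveChord, Sym2.map_mk]
    simp only [sr_smul]
    split_ifs with h0
    · rw [Nat.cast_sub (by omega), h0]
      simp
    · rw [Nat.cast_sub (by omega), Nat.cast_sub (by omega), Sym2.eq_swap]
      simp
  · intro t ht e he
    rw [hO] at he
    rw [mem_diagonals] at ht ⊢
    rcases he with ⟨_, _, _⟩ | ⟨_, _, _ | _⟩ | ⟨_, ⟨_, _⟩ | ⟨_, _⟩⟩ <;> omega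
  · intro t ht
    split_ifs <;> simp
  · intro t ht t' ht' e he he'
    rw [hO] at he he'
    rw [mem_diagonals] at ht ht'
    rcases he with ⟨_, _, _⟩ | ⟨_, _, _ | _⟩ | ⟨_, ⟨_, _⟩ | ⟨_, _⟩⟩ <;>
      rcases he' with ⟨_, _, _⟩ | ⟨_, _, _ | _⟩ | ⟨_, ⟨_, _⟩ | ⟨_, _⟩⟩ <;>
      exact Prod.ext (by omega) (by omega)
  · intro t ht e he
    rw [hO] at he ⊢
    rw [mem_diagonals] at ht
    rcases he with ⟨_, _, _⟩ | ⟨_, _, _ | _⟩ | ⟨_, ⟨_, _⟩ | ⟨_, _⟩⟩ <;> split_ifs <;>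
      dsimp only <;> omega
  · intro t ht e he f hf
    rw [hO] at he hf
    rw [mem_diagonals] at ht
    by_cases hef : e = f
    · exact ⟨0, hef⟩
    · refine ⟨1, ?_⟩
      rw [Prod.ext_iff] at hef
      rw [Function.iterate_one, Prod.ext_iff]
      rcases he with ⟨_, _, _⟩ | ⟨_, _, _ | _⟩ | ⟨_, ⟨_, _⟩ | ⟨_, _⟩⟩ <;>
        rcases hf with ⟨_, _, _⟩ | ⟨_, _, _ | _⟩ | ⟨_, ⟨_, _⟩ | ⟨_, _⟩⟩ <;>
        split_ifs <;> dsimp only <;> omega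
  · intro t ht t' ht'
    rw [mem_diagonals] at ht ht'
    simp only [hO]
    unfold Interlace
    have hpair : ∀ t : ℕ × ℕ, t.1 ≠ 0 → (t.1 = 0 ∧ t.1 - 1 = t.2 - 1 ∧ t.2 - 1 = n + 1 - t.2) ∨
        (t.1 = 1 ∧ t.1 - 1 = 0 ∧ (t.2 - 1 = t.2 - 1 ∨ t.2 - 1 = n + 1 - t.2)) ∨
        (2 ≤ t.1 ∧ ((t.1 - 1 = t.1 - 1 ∧ t.2 - 1 = t.2 - 1) ∨
          (t.1 - 1 = n + 1 - t.2 ∧ t.2 - 1 = n + 1 - t.1))) := by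
      intro t ht
      omega
    constructor
    · intro hI
      by_cases ha : t.1 = 0
      · refine ⟨(t.2 - 1, n + 1 - t.2), Or.inl ⟨ha, rfl, rfl⟩, (t'.1 - 1, t'.2 - 1),
          hpair t' (by omega), ?_⟩
        dsimp only
        omega
      · by_cases ha' : t'.1 = 0
        · refine ⟨(t.1 - 1, t.2 - 1), hpair t ha, (t'.2 - 1, n + 1 - t'.2),
            Or.inl ⟨ha', rfl, rfl⟩, ?_⟩
          dsimp only
          omega
        · refine ⟨(t.1 - 1, t.2 - 1), hpair t ha, (t'.1 - 1, t'.2 - 1), hpair t' ha', ?_⟩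
          dsimp only
          omega
    · rintro ⟨e, he, f, hf, hI⟩
      rcases he with ⟨_, _, _⟩ | ⟨_, _, _ | _⟩ | ⟨_, ⟨_, _⟩ | ⟨_, _⟩⟩ <;>
        rcases hf with ⟨_, _, _⟩ | ⟨_, _, _ | _⟩ | ⟨_, ⟨_, _⟩ | ⟨_, _⟩⟩ <;> omega
  · intro e he hI
    rw [mem_diagonals] at he
    unfold Interlace at hI
    by_cases h0 : e.1 = 0
    · by_cases hlt : e.2 ≤ h
      · refine ⟨(1, e.2 + 1), mem_diagonals.2 (by dsimp only; omega), (hO _ _ _).2 ?_⟩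
        dsimp only
        omega
      · refine ⟨(1, n - e.2 + 1), mem_diagonals.2 (by dsimp only; omega), (hO _ _ _).2 ?_⟩
        dsimp only
        omega
    · rw [if_neg h0] at hI
      simp only at hI
      by_cases hs : e.1 + e.2 = n
      · refine ⟨(0, e.1 + 1), mem_diagonals.2 (by dsimp only; omega), (hO _ _ _).2 ?_⟩
        dsimp only
        omega
      · by_cases hlt : e.1 + e.2 < n
        · refine ⟨(e.1 + 1, e.2 + 1), mem_diagonals.2 (by dsimp only; omega), (hO _ _ _).2 ?_⟩
          dsimp only
          omega
        · refine ⟨(n + 1 - e.2, n + 1 - e.1), mem_diagonals.2 (by dsimp only; omega),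
            (hO _ _ _).2 ?_⟩
          dsimp only
          omega
  · intro t ht
    rw [mem_diagonals] at ht
    by_cases ha : t.1 = 0
    · rw [if_pos ha, if_pos ha, card_singleton]
    rw [if_neg ha, if_neg ha]
    by_cases ha' : t = (1, h + 1)
    · rw [if_pos ha', ha', if_pos rfl, show n + 1 - (h + 1) = h by omega, Nat.add_sub_cancel,
        pair_eq_singleton, card_singleton]
    · rw [if_neg ha']
      rw [Prod.ext_iff] at ha'
      dsimp only at ha'
      split_ifs <;> rw [card_pair] <;> rw [ne_eq, Prod.ext_iff] <;> dsimp only <;> omega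

end Reflections

end PolygonDissection

namespace PolygonDissection

/-! ### Dissections fixed by a rotation, reduced to one sector -/

section Sectors

open Finset

/-- The chord `t` of `{0, …, s}`, moved by `u` in a polygon with `n` vertices. -/
def shiftChord (n : ℕ) (t : ℕ × ℕ) (u : ℕ) : ℕ × ℕ :=
  -- When `t` lies in `{0, …, s}` and `u` is one of the offsets `i * s` with `i < m`, the end point
  -- can only overflow by being equal to `n`, the label of the vertex `0`, which then becomes the
  -- smaller end point.
  if t.2 + u < n then (t.1 + u, t.2 + u) else (0, t.1 + u)

/-- The rotation by `s` of a polygon with `n` vertices. -/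
def rotateChord (n s : ℕ) (p : ℕ × ℕ) : ℕ × ℕ :=
  if p.2 + s < n then (p.1 + s, p.2 + s) else
    if p.1 + s < n then (p.2 + s - n, p.1 + s) else (p.1 + s - n, p.2 + s - n)

/-- The orbit of a chord of `{0, …, s}` under the rotation by `s`. -/
def sectorOrbit (n m s : ℕ) (t : ℕ × ℕ) : Finset (ℕ × ℕ) :=
  (range m).image fun i => shiftChord n t (i * s)

variable {n m s : ℕ}

theorem offset_cases {i j : ℕ} : i * s = j * s ∨ i * s + s ≤ j * s ∨ j * s + s ≤ i * s := by
  rcases lt_trichotomy i j with h | h | h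
  · have := Nat.mul_le_mul_right s (Nat.succ_le_of_lt h)
    rw [Nat.succ_mul] at this
    omega
  · exact Or.inl (by rw [h])
  · have := Nat.mul_le_mul_right s (Nat.succ_le_of_lt h)
    rw [Nat.succ_mul] at this
    omega

theorem offset_le (hn : n = m * s) {i : ℕ} (hi : i < m) : i * s + s ≤ n := by
  have := Nat.mul_le_mul_right s (Nat.succ_le_of_lt hi)
  rw [Nat.succ_mul] at this
  omega

theorem mem_sectorOrbit {t e : ℕ × ℕ} :
    e ∈ sectorOrbit n m s t ↔ ∃ i < m, (t.2 + i * s < n ∧ e.1 = t.1 + i * s ∧ e.2 = t.2 + i * s) ∨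
      (n ≤ t.2 + i * s ∧ e.1 = 0 ∧ e.2 = t.1 + i * s) := by
  simp only [sectorOrbit, mem_image, mem_range, shiftChord]
  refine exists_congr fun i => and_congr_right fun _ => ?_
  split_ifs with h
  · rw [Prod.ext_iff]
    dsimp only
    omega
  · rw [Prod.ext_iff]
    dsimp only
    omega

theorem sectorOrbit_subset (hn : n = m * s) (hm : 2 ≤ m) (hs : 2 ≤ s) {t : ℕ × ℕ}
    (ht : t ∈ chords 0 s) : sectorOrbit n m s t ⊆ diagonals 0 (n - 1) := by
  intro e he
  obtain ⟨i, hi, h⟩ := mem_sectorOrbit.1 he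
  have h1 := offset_le hn hi
  have h2 := offset_le hn (show 1 < m by omega)
  rw [mem_chords] at ht
  rw [mem_diagonals]
  omega

theorem sectorOrbit_eq (hn : n = m * s) (hm : 2 ≤ m) {t t' e : ℕ × ℕ}
    (ht : t ∈ chords 0 s) (ht' : t' ∈ chords 0 s) (he : e ∈ sectorOrbit n m s t)
    (he' : e ∈ sectorOrbit n m s t') : t = t' := by
  obtain ⟨i, hi, h⟩ := mem_sectorOrbit.1 he
  obtain ⟨j, hj, h'⟩ := mem_sectorOrbit.1 he'
  have h1 := offset_le hn hi
  have h2 := offset_le hn hj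
  have h3 := offset_le hn (show 1 < m by omega)
  have h4 := offset_cases (s := s) (i := i) (j := j)
  rw [mem_chords] at ht ht'
  rcases h with h | h <;> rcases h' with h' | h' <;> exact Prod.ext (by omega) (by omega)

theorem rotateChord_shiftChord (hn : n = m * s) {t : ℕ × ℕ} (ht : t ∈ chords 0 s)
    {i : ℕ} (hi : i + 1 < m) :
    rotateChord n s (shiftChord n t (i * s)) = shiftChord n t ((i + 1) * s) := by
  have h1 := offset_le hn hi
  rw [Nat.succ_mul] at *
  rw [mem_chords] at ht
  unfold shiftChord rotateChord
  rw [if_pos (show t.2 + i * s < n by omega)]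
  dsimp only
  split_ifs <;> first | omega | (refine Prod.ext ?_ ?_ <;> dsimp only <;> omega)

theorem rotateChord_shiftChord_last (hn : n = m * s) (hm : 2 ≤ m) {t : ℕ × ℕ}
    (ht : t ∈ chords 0 s) :
    rotateChord n s (shiftChord n t ((m - 1) * s)) = shiftChord n t (0 * s) := by
  have h1 : (m - 1) * s + s = n := by
    rw [hn, ← Nat.succ_mul, Nat.succ_eq_add_one, Nat.sub_add_cancel (by omega)]
  have h3 := offset_le hn (show 1 < m by omega)
  rw [mem_chords] at ht
  unfold shiftChord rotateChord
  rw [zero_mul, if_pos (show t.2 + 0 < n by omega)]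
  split_ifs <;> dsimp only at * <;>
    first | omega | (refine Prod.ext ?_ ?_ <;> dsimp only <;> omega)

theorem iterate_rotateChord (hn : n = m * s) {t : ℕ × ℕ} (ht : t ∈ chords 0 s)
    {i : ℕ} (hi : i < m) :
    (rotateChord n s)^[i] (shiftChord n t (0 * s)) = shiftChord n t (i * s) := by
  induction i with
  | zero => rfl
  | succ i ih =>
    rw [Function.iterate_succ_apply', ih (by omega), rotateChord_shiftChord hn ht hi]

theorem iterate_rotateChord_self (hn : n = m * s) (hm : 2 ≤ m) {t : ℕ × ℕ}
    (ht : t ∈ chords 0 s) :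
    (rotateChord n s)^[m] (shiftChord n t (0 * s)) = shiftChord n t (0 * s) := by
  obtain ⟨k, rfl⟩ := Nat.exists_eq_add_of_le hm
  rw [show 2 + k = (2 + k - 1) + 1 by omega, Function.iterate_succ_apply',
    iterate_rotateChord hn ht (by omega), rotateChord_shiftChord_last hn hm ht]

theorem sectorOrbit_inv (hn : n = m * s) (hm : 2 ≤ m) {t e : ℕ × ℕ}
    (ht : t ∈ chords 0 s) (he : e ∈ sectorOrbit n m s t) :
    rotateChord n s e ∈ sectorOrbit n m s t := by
  obtain ⟨i, hi, rfl⟩ := mem_image.1 he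
  rw [mem_range] at hi
  rcases Nat.lt_or_ge (i + 1) m with h | h
  · exact mem_image.2 ⟨i + 1, mem_range.2 h, (rotateChord_shiftChord hn ht h).symm⟩
  · obtain rfl : i = m - 1 := by omega
    exact mem_image.2 ⟨0, mem_range.2 (by omega), (rotateChord_shiftChord_last hn hm ht).symm⟩

theorem sectorOrbit_trans (hn : n = m * s) (hm : 2 ≤ m) {t e f : ℕ × ℕ}
    (ht : t ∈ chords 0 s) (he : e ∈ sectorOrbit n m s t) (hf : f ∈ sectorOrbit n m s t) :
    ∃ k, (rotateChord n s)^[k] e = f := by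
  obtain ⟨i, hi, rfl⟩ := mem_image.1 he
  obtain ⟨j, hj, rfl⟩ := mem_image.1 hf
  rw [mem_range] at hi hj
  refine ⟨j + (m - i), ?_⟩
  rw [← iterate_rotateChord hn ht hi, ← Function.iterate_add_apply, add_assoc,
    Nat.sub_add_cancel hi.le, Function.iterate_add_apply, iterate_rotateChord_self hn hm ht, iterate_rotateChord hn ht hj]

theorem sectorOrbit_interlace (hn : n = m * s) (hm : 2 ≤ m) {t t' : ℕ × ℕ}
    (ht : t ∈ chords 0 s) (ht' : t' ∈ chords 0 s) :
    Interlace t t' ↔ ∃ e ∈ sectorOrbit n m s t, ∃ f ∈ sectorOrbit n m s t', Interlace e f := by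
  have h3 := offset_le hn (show 1 < m by omega)
  rw [mem_chords] at ht ht'
  constructor
  · intro h
    refine ⟨t, mem_sectorOrbit.2 ⟨0, by omega, ?_⟩, t', mem_sectorOrbit.2 ⟨0, by omega, ?_⟩, h⟩ <;>
      omega
  · rintro ⟨e, he, f, hf, h⟩
    obtain ⟨i, hi, he⟩ := mem_sectorOrbit.1 he
    obtain ⟨j, hj, hf⟩ := mem_sectorOrbit.1 hf
    have h1 := offset_le hn hi
    have h2 := offset_le hn hj
    have h4 := offset_cases (s := s) (i := i) (j := j)
    unfold Interlace at *
    rcases he with he | he <;> rcases hf with hf | hf <;> rcases h4 with h4 | h4 | h4 <;> omega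

/-- The excluded case is the diameter `(0, s)` for `m = 2`, which the half-turn maps to itself. -/
theorem card_sectorOrbit (hn : n = m * s) (hs : 2 ≤ s) {t : ℕ × ℕ} (ht : t ∈ chords 0 s)
    (h : t ≠ (0, s) ∨ 3 ≤ m) : #(sectorOrbit n m s t) = m := by
  rw [sectorOrbit, card_image_of_injOn, card_range]
  intro i hi j hj hij
  rw [coe_range, Set.mem_Iio] at hi hj
  have h1 := offset_le hn hi
  have h2 := offset_le hn hj
  rw [mem_chords] at ht
  have h4 : t.1 ≠ 0 ∨ t.2 ≠ s ∨ s + s + s ≤ n := by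
    rcases h with h | h
    · by_contra hc
      exact h (Prod.ext (by omega) (by dsimp only; omega))
    · have := offset_le hn (show 2 < m by omega)
      omega
  unfold shiftChord at hij
  apply Nat.eq_of_mul_eq_mul_right (show 0 < s by omega)
  dsimp only at hij
  split_ifs at hij <;> rw [Prod.ext_iff] at hij <;> dsimp only at hij <;> omega

/-- The orbit of `(0, s)` bounds a central `m`-gon with corners at the multiples of `s`. A chord
that crosses none of its sides lies in one sector or is a diagonal of this `m`-gon; in the second
case it would cross its own rotation by `s`. -/
theorem sector_cover (hn : n = m * s) (hm : 2 ≤ m) (hs : 2 ≤ s) {A : Finset (ℕ × ℕ)}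
    (hA : A ⊆ diagonals 0 (n - 1)) (hi : IsIndep Interlace A)
    (hμ : ∀ p ∈ A, rotateChord n s p ∈ A) (hL : sectorOrbit n m s (0, s) ⊆ A)
    {e : ℕ × ℕ} (he : e ∈ A) : ∃ t ∈ chords 0 s, e ∈ sectorOrbit n m s t := by
  have h1 := mem_diagonals.1 (hA he)
  have hlast : (m - 1) * s + s = n := by
    rw [hn, ← Nat.succ_mul, Nat.succ_eq_add_one, Nat.sub_add_cancel (by omega)]
  -- The last side is excluded here since it is stored as `(0, n - s)`; it is the subject of
  -- `hside'`.
  have hside : ∀ k < m, ¬ Interlace e (k * s, k * s + s) ∨ k * s + s = n := by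
    intro k hk
    by_cases hkn : k * s + s = n
    · exact Or.inr hkn
    · refine Or.inl (hi e he _ (hL (mem_sectorOrbit.2 ⟨k, hk, Or.inl ?_⟩)))
      have := offset_le hn hk
      dsimp only
      omega
  have hside' : ¬ Interlace e (0, n - s) := by
    refine hi e he _ (hL (mem_sectorOrbit.2 ⟨m - 1, by omega, Or.inr ?_⟩))
    dsimp only
    omega
  have hrot : ¬ Interlace e (rotateChord n s e) := hi e he _ (hμ e he)
  set i := e.1 / s with hidef
  set j := e.2 / s with hjdef
  have hi1 : i * s ≤ e.1 := Nat.div_mul_le_self _ _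
  have hi2 : e.1 < i * s + s := Nat.lt_div_mul_add (by omega)
  have hj1 : j * s ≤ e.2 := Nat.div_mul_le_self _ _
  have hj2 : e.2 < j * s + s := Nat.lt_div_mul_add (by omega)
  have him : i < m := by
    rw [hidef, Nat.div_lt_iff_lt_mul (by omega), ← hn]
    omega
  have hjm : j < m := by
    rw [hjdef, Nat.div_lt_iff_lt_mul (by omega), ← hn]
    omega
  have hij := offset_cases (s := s) (i := i) (j := j)
  have hsi := hside i him
  have hsj := hside j hjm
  have h0 : i * s = 0 ∨ s ≤ i * s := by
    rcases Nat.eq_zero_or_pos i with h | h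
    · exact Or.inl (by rw [h, zero_mul])
    · exact Or.inr (Nat.le_mul_of_pos_left s h)
  have hjl := offset_le hn hjm
  unfold Interlace at hsi hsj hside' hrot
  dsimp only at hsi hsj hside'
  by_cases hc : e.2 ≤ i * s + s
  · refine ⟨(e.1 - i * s, e.2 - i * s), mem_chords.2 (by dsimp only; omega),
      mem_sectorOrbit.2 ⟨i, him, Or.inl ?_⟩⟩
    dsimp only
    omega
  · by_cases hw : e.1 = 0 ∧ n - s ≤ e.2
    · refine ⟨(e.2 - (n - s), s), mem_chords.2 (by dsimp only; omega),
        mem_sectorOrbit.2 ⟨m - 1, by omega, Or.inr ?_⟩⟩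
      dsimp only
      omega
    · exfalso
      unfold rotateChord at hrot
      split_ifs at hrot <;> dsimp only at hrot <;> omega

theorem toChord_rotateChord [NeZero n] (hs : s < n) {p : ℕ × ℕ} (hp : p ∈ diagonals 0 (n - 1)) :
    rotateChord n s p ∈ diagonals 0 (n - 1) ∧
      toChord n (rotateChord n s p) = moveChord (DihedralGroup.r (s : ZMod n)) (toChord n p) := by
  rw [mem_diagonals] at hp
  unfold rotateChord
  rw [mem_diagonals, toChord, toChord, moveChord, Sym2.map_mk]
  simp only [r_smul]
  split_ifs with h1 h2
  · refine ⟨by dsimp only; omega, ?_⟩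
    push_cast
    rfl
  · refine ⟨by dsimp only; omega, ?_⟩
    dsimp only
    rw [Nat.cast_sub (by omega), Sym2.eq_swap]
    push_cast
    simp
  · refine ⟨by dsimp only; omega, ?_⟩
    dsimp only
    rw [Nat.cast_sub (by omega), Nat.cast_sub (by omega)]
    push_cast
    simp

/-- The dissections that are invariant under the rotation by `s` and contain the chord `(0, s)`. -/
theorem card_fixed_sector [NeZero n] (hn : n = m * s) (hm : 2 ≤ m) (hs : 2 ≤ s) (k : ℕ) :
    (Nat.card {Φ : Dissection n // DihedralGroup.r (s : ZMod n) • Φ = Φ ∧ (0, s) ∈ code Φ ∧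
      #Φ.diagonals = #(sectorOrbit n m s (0, s)) + m * k} : ℚ) = (dissectionPoly s).coeff k := by
  classical
  have hsn := offset_le hn (show 1 < m by omega)
  have hμ : ∀ p ∈ diagonals 0 (n - 1), rotateChord n s p ∈ diagonals 0 (n - 1) ∧
      toChord n (rotateChord n s p) = moveChord (DihedralGroup.r (s : ZMod n)) (toChord n p) :=
    fun p hp => toChord_rotateChord (by omega) hp
  have hsc : ∀ t ∈ diagonals 0 s, t ∈ chords 0 s := fun t ht => mem_of_mem_erase ht
  have h0 : (0, s) ∈ chords 0 s := mem_chords.2 (by dsimp only; omega)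
  have h0o : (0, s) ∈ sectorOrbit n m s (0, s) :=
    mem_sectorOrbit.2 ⟨0, by omega, by dsimp only; omega⟩
  have h0t : ∀ t ∈ chords 0 s, ¬ Interlace t (0, s) := by
    intro t ht
    rw [mem_chords] at ht
    unfold Interlace
    dsimp only
    omega
  -- An invariant dissection that contains `(0, s)` contains its whole orbit, which can then serve
  -- as the prescribed part `L`.
  have hL : ∀ Φ : Dissection n, (DihedralGroup.r (s : ZMod n) • Φ = Φ ∧ (0, s) ∈ code Φ ∧
      #Φ.diagonals = #(sectorOrbit n m s (0, s)) + m * k) ↔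
      (DihedralGroup.r (s : ZMod n) • Φ = Φ ∧ sectorOrbit n m s (0, s) ⊆ code Φ ∧
      #Φ.diagonals = #(sectorOrbit n m s (0, s)) + m * k) := by
    intro Φ
    refine and_congr_right fun hΦ => and_congr_left fun _ => ⟨fun h e he => ?_, fun h => h h0o⟩
    have hinv := (smul_eq_self_iff_code hμ).1 hΦ
    obtain ⟨k, rfl⟩ := sectorOrbit_trans hn hm h0 h0o he
    clear he
    induction k with
    | zero => exact h
    | succ k ih =>
      rw [Function.iterate_succ_apply']
      exact hinv _ ih
  rw [Nat.card_congr (Equiv.subtypeEquivRight hL), card_fixed_eq hμ,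
    card_invariant (T := diagonals 0 s) (orb := sectorOrbit n m s) interlace_symm
      (fun t ht => sectorOrbit_subset hn hm hs (hsc t ht))
      (fun t ht => ⟨shiftChord n t (0 * s), mem_image.2 ⟨0, mem_range.2 (by omega), rfl⟩⟩)
      (fun t ht t' ht' e he he' => sectorOrbit_eq hn hm (hsc t ht) (hsc t' ht') he he')
      (fun t ht e he => sectorOrbit_inv hn hm (hsc t ht) he)
      (fun t ht e he f hf => sectorOrbit_trans hn hm (hsc t ht) he hf)
      (fun t ht t' ht' => sectorOrbit_interlace hn hm (hsc t ht) (hsc t' ht'))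
      (sectorOrbit_subset hn hm hs h0) (fun e he => sectorOrbit_inv hn hm h0 he)]
  · have h1 := coeff_indepSum Interlace (diagonals 0 s) (fun _ => 1) k
    simp only [pow_one, sum_const, smul_eq_mul, mul_one] at h1
    rw [dissectionPoly, h1]
    congr 2
    refine filter_congr fun S hS => and_congr_right fun _ => ?_
    rw [sum_congr rfl fun t ht => card_sectorOrbit hn hs (hsc t (mem_powerset.1 hS ht))
      (Or.inl (ne_of_mem_erase (mem_powerset.1 hS ht))), sum_const, smul_eq_mul, mul_comm]
    exact Nat.mul_right_inj (by omega)
  · intro e he f hf h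
    exact h0t _ h0 ((sectorOrbit_interlace hn hm h0 h0).2 ⟨e, he, f, hf, h⟩)
  · intro t ht e he
    refine ⟨fun he' => ne_of_mem_erase ht (sectorOrbit_eq hn hm (hsc t ht) h0 he he'), ?_⟩
    exact fun f hf h => h0t t (hsc t ht)
      ((sectorOrbit_interlace hn hm (hsc t ht) h0).2 ⟨e, he, f, hf, h⟩)
  · intro A hA hAi hAμ hLA e he
    obtain ⟨t, ht, het⟩ := sector_cover hn hm hs hA hAi hAμ hLA he
    by_cases h : t = (0, s)
    · exact Or.inl (h ▸ het)
    · exact Or.inr ⟨t, mem_erase.2 ⟨h, ht⟩, het⟩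

end Sectors

end PolygonDissection

namespace PolygonDissection

/-! ### Which rotations fix an (n - 5)-dissection, and how many they fix -/

section Rotations

open Finset

variable {n : ℕ}

theorem card_smul_diagonals [NeZero n] (g : DihedralGroup n) (Φ : Dissection n) :
    #(g • Φ).diagonals = #Φ.diagonals := by
  rw [smul_diagonals, card_image_of_injective _ (moveChord_injective g)]

theorem moveChord_mem_smul [NeZero n] {g : DihedralGroup n} {Φ : Dissection n}
    {e : Sym2 (ZMod n)} (he : e ∈ Φ.diagonals) : moveChord g e ∈ (g • Φ).diagonals := by
  rw [smul_diagonals]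
  exact mem_image_of_mem _ he

theorem card_diagonals_le [NeZero n] (hn : 3 ≤ n) (Φ : Dissection n) : #Φ.diagonals ≤ n - 3 := by
  have := (isPure_diagonals 0 (n - 1) (by omega) (code Φ) (code_subset Φ) (isIndep_code Φ)).1
  rw [card_code] at this
  omega

theorem r_natCast_mul_smul [NeZero n] {i : ZMod n} {Φ : Dissection n}
    (h : DihedralGroup.r i • Φ = Φ) (k : ℕ) : DihedralGroup.r ((k : ZMod n) * i) • Φ = Φ := by
  have h1 : DihedralGroup.r i ∈ MulAction.stabilizer (DihedralGroup n) Φ := h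
  have h2 := pow_mem h1 k
  rw [DihedralGroup.r_pow, mul_comm] at h2
  exact h2

theorem r_smul_comm [NeZero n] {i j : ZMod n} {Φ : Dissection n}
    (h : DihedralGroup.r i • Φ = Φ) :
    DihedralGroup.r i • (DihedralGroup.r j • Φ) = DihedralGroup.r j • Φ := by
  rw [← mul_smul, DihedralGroup.r_mul_r, add_comm, ← DihedralGroup.r_mul_r, mul_smul, h]

/-- The chord from the vertex `x` to the vertex `x + s`. -/
def side (s : ℕ) (x : ZMod n) : Sym2 (ZMod n) := s(x, x + s)

theorem moveChord_side (s : ℕ) (i x : ZMod n) :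
    moveChord (DihedralGroup.r i) (side s x) = side s (x + i) := by
  rw [side, side, moveChord, Sym2.map_mk, r_smul, r_smul, add_right_comm]

theorem side_natCast (s a : ℕ) : side s (a : ZMod n) = toChord n (a, a + s) := by
  rw [side, toChord]
  push_cast
  rfl

theorem side_add_mem [NeZero n] {s : ℕ} {i : ZMod n} {Φ : Dissection n}
    (h : DihedralGroup.r i • Φ = Φ) {x : ZMod n} (hx : side s x ∈ Φ.diagonals) :
    side s (x + i) ∈ Φ.diagonals := by
  rw [← moveChord_side]
  exact smul_eq_self_iff.1 h _ hx

variable {m s : ℕ}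

theorem mem_code_side (hn : n = m * s) (hm : 2 ≤ m) (hs : 2 ≤ s) {Φ : Dissection n} {a : ℕ}
    (ha : a < s) : (a, a + s) ∈ code Φ ↔ side s (a : ZMod n) ∈ Φ.diagonals := by
  have := offset_le hn (show 1 < m by omega)
  rw [mem_code, side_natCast, and_iff_right]
  rw [mem_diagonals]
  dsimp only
  omega

theorem side_mod_mem [NeZero n] (hn : n = m * s) (hm : 2 ≤ m) {Φ : Dissection n}
    (h : DihedralGroup.r (s : ZMod n) • Φ = Φ) {x : ZMod n} (hx : side s x ∈ Φ.diagonals) :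
    side s ((x.val % s : ℕ) : ZMod n) ∈ Φ.diagonals := by
  -- Since `m * s = 0` modulo `n`, adding `(m - 1) * q` times `s` amounts to subtracting `q * s`.
  have h1 := side_add_mem (r_natCast_mul_smul h ((m - 1) * (x.val / s))) hx
  have key : ∀ r q : ℕ, ((r + s * q : ℕ) : ZMod n) = x →
      (r : ZMod n) = x + (((m - 1) * q : ℕ) : ZMod n) * s := by
    rintro r q rfl
    have h3 : ((m * s : ℕ) : ZMod n) = 0 := by rw [← hn, ZMod.natCast_self]
    obtain ⟨k, rfl⟩ := Nat.exists_eq_add_of_le hm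
    rw [show 2 + k - 1 = 1 + k by omega]
    push_cast at h3 ⊢
    linear_combination (- (q : ZMod n)) * h3
  rwa [key (x.val % s) (x.val / s) (by rw [Nat.mod_add_div, ZMod.natCast_zmod_val])]

/-- Two such chords with `a < a' < s` would cross, because `a < a' < a + s < a' + s`. -/
theorem side_unique (hn : n = m * s) (hm : 2 ≤ m) (hs : 2 ≤ s) {Φ : Dissection n} {a a' : ℕ}
    (ha : a < s) (ha' : a' < s) (h : side s (a : ZMod n) ∈ Φ.diagonals)
    (h' : side s (a' : ZMod n) ∈ Φ.diagonals) : a = a' := by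
  have := isIndep_code Φ _ ((mem_code_side hn hm hs ha).2 h) _ ((mem_code_side hn hm hs ha').2 h')
  unfold Interlace at this
  dsimp only at this
  omega

/-- Rotation by `i` carries the chord at `x` to the chord at `x + i`. By uniqueness modulo `s` the
starting points agree modulo `s`, so `s` divides `i`. -/
theorem mul_eq_zero_of_side [NeZero n] (hn : n = m * s) (hm : 2 ≤ m) (hs : 2 ≤ s)
    {Φ : Dissection n} (h : DihedralGroup.r (s : ZMod n) • Φ = Φ) {x i : ZMod n}
    (hx : side s x ∈ Φ.diagonals) (hi : DihedralGroup.r i • Φ = Φ) : (m : ZMod n) * i = 0 := by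
  have h1 := side_unique hn hm hs (Nat.mod_lt _ (by omega)) (Nat.mod_lt _ (by omega))
    (side_mod_mem hn hm h hx) (side_mod_mem hn hm h (side_add_mem hi hx))
  have h2 := val_add_cases x i _ rfl
  have h3 : i.val ≡ 0 [MOD s] := by
    have h4 : x.val + i.val ≡ (x + i).val [MOD s] := by
      rcases h2 with h2 | h2
      · rw [h2]
      · have h5 : n ≡ 0 [MOD s] := Nat.modEq_zero_iff_dvd.2 ⟨m, by rw [hn, mul_comm]⟩
        rw [h2]
        exact h5.add_left (x + i).val
    exact Nat.ModEq.add_left_cancel' x.val (h4.trans (Eq.symm h1))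
  obtain ⟨q, hq⟩ := (Nat.modEq_zero_iff_dvd.1 h3)
  rw [← ZMod.natCast_zmod_val i, hq, ← Nat.cast_mul, ← mul_assoc, ← hn]
  push_cast
  simp

/-- If every invariant dissection contains a chord `(x, x + s)`, then it contains exactly one with
`0 ≤ x < s`. -/
theorem card_fixed_eq_mul [NeZero n] (hn : n = m * s) (hm : 2 ≤ m) (hs : 2 ≤ s) {k : ℕ}
    (hex : ∀ Φ : Dissection n, DihedralGroup.r (s : ZMod n) • Φ = Φ → #Φ.diagonals = k →
      ∃ x, side s x ∈ Φ.diagonals) :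
    Nat.card {Φ : Dissection n // DihedralGroup.r (s : ZMod n) • Φ = Φ ∧ #Φ.diagonals = k} =
      s * Nat.card {Φ : Dissection n // DihedralGroup.r (s : ZMod n) • Φ = Φ ∧ (0, s) ∈ code Φ ∧
        #Φ.diagonals = k} := by
  have h0 : ∀ Φ : Dissection n, (0, s) ∈ code Φ ↔ side s (0 : ZMod n) ∈ Φ.diagonals := by
    intro Φ
    simpa using mem_code_side hn hm hs (Φ := Φ) (a := 0) (by omega)
  have hmove : ∀ (Φ : Dissection n) (i x : ZMod n), side s x ∈ Φ.diagonals →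
      side s (x + i) ∈ (DihedralGroup.r i • Φ).diagonals := by
    intro Φ i x h
    rw [← moveChord_side]
    exact moveChord_mem_smul h
  -- The inverse rotates the unique chord of length `s` with starting point in `{0, …, s - 1}` back
  -- to `(0, s)`.
  let f : Fin s × {Φ : Dissection n // DihedralGroup.r (s : ZMod n) • Φ = Φ ∧ (0, s) ∈ code Φ ∧
      #Φ.diagonals = k} →
      {Φ : Dissection n // DihedralGroup.r (s : ZMod n) • Φ = Φ ∧ #Φ.diagonals = k} :=
    fun p => ⟨DihedralGroup.r ((p.1 : ℕ) : ZMod n) • p.2.1, r_smul_comm p.2.2.1,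
      (card_smul_diagonals _ _).trans p.2.2.2.2⟩
  have hf : Function.Bijective f := by
    constructor
    · rintro ⟨a, Φ, hΦ⟩ ⟨b, Ψ, hΨ⟩ h
      have h1 : DihedralGroup.r ((a : ℕ) : ZMod n) • Φ = DihedralGroup.r ((b : ℕ) : ZMod n) • Ψ :=
        Subtype.ext_iff.1 h
      have h2 := hmove Φ (a : ℕ) 0 ((h0 Φ).1 hΦ.2.1)
      have h3 := hmove Ψ (b : ℕ) 0 ((h0 Ψ).1 hΨ.2.1)
      rw [← h1] at h3
      rw [zero_add] at h2 h3
      obtain rfl : a = b := Fin.ext (side_unique hn hm hs a.2 b.2 h2 h3)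
      obtain rfl : Φ = Ψ := MulAction.injective _ h1
      rfl
    · rintro ⟨Φ, hΦ, hk⟩
      obtain ⟨x, hx⟩ := hex Φ hΦ hk
      have ha : x.val % s < s := Nat.mod_lt _ (by omega)
      have hx' := side_mod_mem hn hm hΦ hx
      refine ⟨(⟨x.val % s, ha⟩, ⟨DihedralGroup.r (-((x.val % s : ℕ) : ZMod n)) • Φ,
        r_smul_comm hΦ, ?_, (card_smul_diagonals _ _).trans hk⟩), Subtype.ext ?_⟩
      · rw [h0]
        simpa using hmove Φ (-((x.val % s : ℕ) : ZMod n)) _ hx'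
      · change DihedralGroup.r ((x.val % s : ℕ) : ZMod n) •
          (DihedralGroup.r (-((x.val % s : ℕ) : ZMod n)) • Φ) = Φ
        rw [← mul_smul, DihedralGroup.r_mul_r, add_neg_cancel, DihedralGroup.r_zero, one_smul]
  rw [← Nat.card_congr (Equiv.ofBijective f hf), Nat.card_prod, Nat.card_fin]

/-- A rotation of prime order without invariant chords acts freely on the diagonals. -/
theorem dvd_card_or_exists_fixed [NeZero n] {p : ℕ} (hp : p.Prime) {g : DihedralGroup n}
    (hg : g ^ p = 1) {Φ : Dissection n} (h : g • Φ = Φ) :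
    p ∣ #Φ.diagonals ∨ ∃ e ∈ Φ.diagonals, moveChord g e = e := by
  classical
  have := Fact.mk hp
  let f : Function.End Φ.diagonals := fun e => ⟨moveChord g e.1, smul_eq_self_iff.1 h _ e.2⟩
  have hfk : ∀ k : ℕ, ∀ e : Φ.diagonals, ((f ^ k) e).1 = moveChord (g ^ k) e.1 := by
    intro k
    induction k with
    | zero =>
      intro e
      rw [pow_zero, pow_zero, moveChord_one]
      rfl
    | succ k ih =>
      intro e
      rw [pow_succ, pow_succ, moveChord_mul]
      exact ih (f e)
  have hf : f ^ p ^ 1 = 1 := by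
    funext e
    apply Subtype.ext
    rw [hfk, pow_one, hg, moveChord_one]
    rfl
  have hmod := Equiv.Perm.card_fixedPoints_modEq hf
  by_cases hex : ∃ e ∈ Φ.diagonals, moveChord g e = e
  · exact Or.inr hex
  · left
    have : Fintype.card (Function.fixedPoints f) = 0 := by
      rw [Fintype.card_eq_zero_iff]
      exact ⟨fun e => hex ⟨e.1.1, e.1.2, Subtype.ext_iff.1 e.2⟩⟩
    rw [this, Fintype.card_coe] at hmod
    exact (Nat.modEq_zero_iff_dvd.1 hmod)

theorem r_pow_eq_one [NeZero n] (hn : n = m * s) :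
    (DihedralGroup.r (s : ZMod n)) ^ m = 1 := by
  rw [DihedralGroup.r_pow, ← Nat.cast_mul, mul_comm, ← hn, ZMod.natCast_self, DihedralGroup.r_zero]

theorem natCast_ne_zero (hn : n = m * s) (hm : 2 ≤ m) (hs : 1 ≤ s) : (s : ZMod n) ≠ 0 := by
  have := offset_le hn (show 1 < m by omega)
  intro h
  have := Nat.le_of_dvd (by omega) ((ZMod.natCast_eq_zero_iff _ _).1 h)
  omega

/-- A non-trivial rotation fixes no vertex, so it must exchange the two ends of `e`; then `2 * s =
0` modulo `n` and `e` is a diameter. -/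
theorem exists_side_of_fixed [NeZero n] (hn : n = m * s) (hm : 2 ≤ m) (hs : 1 ≤ s)
    {e : Sym2 (ZMod n)} (he : moveChord (DihedralGroup.r (s : ZMod n)) e = e) :
    m = 2 ∧ ∃ x, e = side s x := by
  induction e with
  | _ x y =>
    rw [moveChord, Sym2.map_mk, r_smul, r_smul] at he
    have h0 := natCast_ne_zero hn hm hs
    rcases Sym2.eq_iff.1 he with ⟨h1, _⟩ | ⟨h1, h2⟩
    · exact absurd (add_eq_left.1 h1) h0
    · refine ⟨?_, x, by rw [side, h1]⟩
      have h3 : ((2 * s : ℕ) : ZMod n) = 0 := by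
        push_cast
        linear_combination h1 + h2
      have h4 := Nat.le_of_dvd (by omega) ((ZMod.natCast_eq_zero_iff _ _).1 h3)
      rw [hn] at h4
      exact le_antisymm (Nat.le_of_mul_le_mul_right h4 (by omega)) hm

/-- Here `n - 5` is odd, so the half-turn cannot pair off all the diagonals. -/
theorem exists_side_two [NeZero n] (hn : n = 2 * s) (hs : 3 ≤ s) {Φ : Dissection n}
    (h : DihedralGroup.r (s : ZMod n) • Φ = Φ) (hk : #Φ.diagonals = n - 5) :
    ∃ x, side s x ∈ Φ.diagonals := by
  rcases dvd_card_or_exists_fixed Nat.prime_two (r_pow_eq_one hn) h with h2 | ⟨e, he, hfix⟩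
  · omega
  · obtain ⟨_, x, rfl⟩ := exists_side_of_fixed hn le_rfl (by omega) hfix
    exact ⟨x, he⟩

/-- The chords of a dissection that is invariant under a rotation by `s` are not longer
than `s`. -/
theorem length_le_of_mem_code [NeZero n] (hn : n = m * s) (hm : 2 ≤ m) (hs : 1 ≤ s)
    {Φ : Dissection n} (h : DihedralGroup.r (s : ZMod n) • Φ = Φ) {p : ℕ × ℕ} (hp : p ∈ code Φ) :
    p.2 ≤ p.1 + s ∨ p.1 + n ≤ p.2 + s := by
  have hsn := offset_le hn (show 1 < m by omega)
  have h1 := (smul_eq_self_iff_code fun p hp => toChord_rotateChord (s := s) (by omega) hp).1 h p hp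
  -- A chord with more than `s` steps on both sides would cross its rotation by `s`.
  have h2 := isIndep_code Φ _ hp _ h1
  have h3 := mem_diagonals.1 (code_subset Φ hp)
  unfold Interlace rotateChord at h2
  split_ifs at h2 <;> dsimp only at h2 <;> omega

/-- If no chord had length `s`, chords of length `s` that cut off three consecutive sectors could be
added to a rotated copy of the dissection, giving `n - 2` non-crossing diagonals, one more than a
triangulation has. -/
theorem exists_side_five [NeZero n] (hn : n = 5 * s) (hs : 2 ≤ s) {Φ : Dissection n}
    (h : DihedralGroup.r (s : ZMod n) • Φ = Φ) (hk : #Φ.diagonals = n - 5) :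
    ∃ x, side s x ∈ Φ.diagonals := by
  classical
  by_contra hno
  have hlen : ∃ l, l ≤ s ∧ ∃ x, side l x ∈ Φ.diagonals := by
    obtain ⟨p, hp⟩ : (code Φ).Nonempty := by
      rw [← card_pos, card_code]
      omega
    have h1 := mem_diagonals.1 (code_subset Φ hp)
    have h2 := (mem_code.1 hp).2
    rcases length_le_of_mem_code hn (by omega) (by omega) h hp with h3 | h3
    · refine ⟨p.2 - p.1, by omega, (p.1 : ZMod n), ?_⟩
      rwa [side_natCast, Nat.add_sub_cancel' (by omega)]
    · refine ⟨n + p.1 - p.2, by omega, (p.2 : ZMod n), ?_⟩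
      rw [side_natCast, Nat.add_sub_cancel' (by omega), toChord, Sym2.eq_swap]
      push_cast
      rwa [ZMod.natCast_self, zero_add]
  obtain ⟨l₀, hl₀, hx₀⟩ := hlen
  obtain ⟨l, ⟨hls, x, hx⟩, hmax⟩ : ∃ l, (l ≤ s ∧ ∃ x, side l x ∈ Φ.diagonals) ∧
      ∀ l', (l' ≤ s ∧ ∃ x, side l' x ∈ Φ.diagonals) → l' ≤ l := by
    have hP := Nat.findGreatest_spec (P := fun l => l ≤ s ∧ ∃ x, side l x ∈ Φ.diagonals) hl₀
      ⟨hl₀, hx₀⟩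
    exact ⟨_, hP, fun l' hl' => Nat.le_findGreatest hl'.1 hl'⟩
  have hls' : l < s := lt_of_le_of_ne hls fun he => hno ⟨x, he ▸ hx⟩
  -- The dissection is turned so that a longest chord, of length `l < s`, starts at `0`; by
  -- invariance all the chords `(k * s, k * s + l)` are then present.
  set Ψ := DihedralGroup.r (-x) • Φ with hΨdef
  have hΨ : DihedralGroup.r (s : ZMod n) • Ψ = Ψ := r_smul_comm h
  have hΨΦ : ∀ l y, side l y ∈ Ψ.diagonals → side l (y + x) ∈ Φ.diagonals := by
    intro l y hy
    have := moveChord_mem_smul (g := DihedralGroup.r x) hy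
    rwa [moveChord_side, hΨdef, ← mul_smul, DihedralGroup.r_mul_r, add_neg_cancel,
      DihedralGroup.r_zero, one_smul] at this
  have hlong : ∀ p ∈ code Ψ, p.2 ≤ p.1 + l ∨ p.1 + n ≤ p.2 + l := by
    intro p hp
    have h1 := mem_diagonals.1 (code_subset Ψ hp)
    have h2 := (mem_code.1 hp).2
    rcases length_le_of_mem_code hn (by omega) (by omega) hΨ hp with h3 | h3
    · left
      have h4 : side (p.2 - p.1) (p.1 : ZMod n) ∈ Ψ.diagonals := by
        rwa [side_natCast, Nat.add_sub_cancel' (by omega)]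
      have := hmax (p.2 - p.1) ⟨by omega, _, hΨΦ _ _ h4⟩
      omega
    · right
      have h4 : side (n + p.1 - p.2) (p.2 : ZMod n) ∈ Ψ.diagonals := by
        rw [side_natCast, Nat.add_sub_cancel' (by omega), toChord, Sym2.eq_swap]
        push_cast
        rwa [ZMod.natCast_self, zero_add]
      have := hmax (n + p.1 - p.2) ⟨by omega, _, hΨΦ _ _ h4⟩
      omega
  have hside : ∀ k : ℕ, side l ((k * s : ℕ) : ZMod n) ∈ Ψ.diagonals := by
    intro k
    have h1 : side l (0 : ZMod n) ∈ Ψ.diagonals := by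
      have := moveChord_mem_smul (g := DihedralGroup.r (-x)) hx
      rwa [moveChord_side, add_neg_cancel] at this
    have := side_add_mem (r_natCast_mul_smul hΨ k) h1
    push_cast
    rwa [zero_add] at this
  have hl2 : 2 ≤ l := by
    have h1 := hside 0
    rw [side_natCast] at h1
    obtain ⟨q, hq, hqe⟩ := exists_toChord (Ψ.isDiagonal _ h1)
    have hq' := mem_diagonals.1 hq
    rcases Nat.eq_zero_or_pos l with h0 | h0
    · have h5 := Ψ.isDiagonal _ h1
      obtain ⟨a, b, he, hab, _⟩ := h5
      rw [h0] at he
      rcases Sym2.eq_iff.1 he with ⟨h6, h7⟩ | ⟨h6, h7⟩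
      · exact absurd (h6.symm.trans h7) hab
      · exact absurd (h7.symm.trans h6) hab
    · have := toChord_injOn (n := n) (p := q) (q := (0 * s, 0 * s + l)) (by omega) (by omega)
        (by dsimp only; omega) (by dsimp only; omega) hqe
      rw [this] at hq'
      dsimp only at hq'
      omega
  have hmem : ∀ k < 5, (k * s, k * s + l) ∈ code Ψ := by
    intro k hk
    have := offset_le hn hk
    rw [mem_code, ← side_natCast]
    refine ⟨mem_diagonals.2 ?_, hside k⟩
    dsimp only
    omega
  have hI : ∀ p ∈ code Ψ, ∀ k < 5, ¬ Interlace p (k * s, k * s + l) :=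
    fun p hp k hk => isIndep_code Ψ p hp _ (hmem k hk)
  have hnot : ∀ k < 4, (k * s, k * s + s) ∉ code Ψ := by
    intro k hk hmem
    have := (mem_code.1 hmem).2
    rw [← side_natCast] at this
    exact hno ⟨_, hΨΦ _ _ this⟩
  -- A chord crossing `(k * s, k * s + s)` would have an end between `k * s + l` and `k * s + s`, as
  -- it may not cross `(k * s, k * s + l)`. Having length at most `l`, it would end strictly inside
  -- the next chord `((k + 1) * s, (k + 1) * s + l)` and cross that one.
  have hnew : ∀ p ∈ code Ψ, ∀ k < 3, ¬ Interlace (k * s, k * s + s) p := by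
    intro p hp k hk
    have h1 := hlong p hp
    have h2 := mem_diagonals.1 (code_subset Ψ hp)
    have h3 := hI p hp 0 (by omega)
    have h4 := hI p hp 1 (by omega)
    have h5 := hI p hp 2 (by omega)
    have h6 := hI p hp 3 (by omega)
    unfold Interlace at *
    dsimp only at *
    interval_cases k <;> omega
  have hfin : IsIndep Interlace (insert (0 * s, 0 * s + s) (insert (1 * s, 1 * s + s)
      (insert (2 * s, 2 * s + s) (code Ψ)))) := by
    rw [isIndep_insert_interlace, isIndep_insert_interlace, isIndep_insert_interlace]
    have hk : ∀ i j : ℕ, ¬ Interlace (i * s, i * s + s) (j * s, j * s + s) := by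
      intro i j
      have := offset_cases (s := s) (i := i) (j := j)
      unfold Interlace
      dsimp only
      omega
    refine ⟨⟨⟨isIndep_code Ψ, fun p hp => hnew p hp 2 (by omega)⟩, ?_⟩, ?_⟩
    · intro p hp
      rcases mem_insert.1 hp with rfl | hp
      · exact hk _ _
      · exact hnew p hp 1 (by omega)
    · intro p hp
      rcases mem_insert.1 hp with rfl | hp
      · exact hk _ _
      · rcases mem_insert.1 hp with rfl | hp
        · exact hk _ _
        · exact hnew p hp 0 (by omega)
  have hcard : #(insert (0 * s, 0 * s + s) (insert (1 * s, 1 * s + s)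
      (insert (2 * s, 2 * s + s) (code Ψ)))) = #(code Ψ) + 1 + 1 + 1 := by
    rw [card_insert_of_notMem, card_insert_of_notMem, card_insert_of_notMem]
    · exact hnot 2 (by omega)
    · rw [mem_insert, not_or]
      refine ⟨?_, hnot 1 (by omega)⟩
      rw [Prod.ext_iff]
      dsimp only
      omega
    · rw [mem_insert, mem_insert, not_or, not_or]
      refine ⟨?_, ?_, hnot 0 (by omega)⟩ <;>
      · rw [Prod.ext_iff]
        dsimp only
        omega
  have := (isPure_diagonals 0 (n - 1) (by omega) _ ?_ hfin).1
  · rw [hcard, card_code, card_smul_diagonals, hk] at this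
    omega
  · have hk : ∀ k < 3, (k * s, k * s + s) ∈ diagonals 0 (n - 1) := by
      intro k hk
      rw [mem_diagonals]
      have := offset_le hn (show k + 1 < 5 by omega)
      rw [Nat.succ_mul] at this
      dsimp only
      omega
    exact insert_subset (hk 0 (by omega)) (insert_subset (hk 1 (by omega))
      (insert_subset (hk 2 (by omega)) (code_subset Ψ)))

/-- The rotations of order `p` generate the same subgroup. -/
theorem r_smul_eq_of_order_prime [NeZero n] {p : ℕ} (hp : p.Prime) (hs : n = p * s) {j : ZMod n}
    (hj0 : j ≠ 0) (hpj : (p : ZMod n) * j = 0) {Φ : Dissection n}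
    (hjfix : DihedralGroup.r j • Φ = Φ) : DihedralGroup.r (s : ZMod n) • Φ = Φ := by
  have hdvd : s ∣ j.val := by
    rw [← ZMod.natCast_zmod_val j, ← Nat.cast_mul, ZMod.natCast_eq_zero_iff] at hpj
    exact Nat.dvd_of_mul_dvd_mul_left hp.pos (hs.symm.dvd.trans hpj)
  obtain ⟨t, ht⟩ := hdvd
  have htp : Nat.Coprime t p := by
    rw [Nat.coprime_comm, hp.coprime_iff_not_dvd]
    rintro ⟨u, hu⟩
    apply hj0
    rw [← ZMod.natCast_zmod_val j, ht, hu, ← mul_assoc, mul_comm s p, ← hs, Nat.cast_mul,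
      ZMod.natCast_self, zero_mul]
  -- As `k` inverts `t` modulo `p`, the `k`-th multiple of `j = t * s` is `s` modulo `n = p * s`.
  obtain ⟨k, hkt⟩ := Nat.exists_mul_mod_eq_one_of_coprime htp hp.one_lt
  have := r_natCast_mul_smul hjfix k
  convert this using 3
  rw [← ZMod.natCast_zmod_val j, ht]
  have h5 := Nat.mod_add_div (t * k) p
  rw [hkt.2] at h5
  have h6 : ((p * s : ℕ) : ZMod n) = 0 := by rw [← hs, ZMod.natCast_self]
  have h7 := congrArg (Nat.cast (R := ZMod n)) h5
  push_cast at h6 h7 ⊢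
  linear_combination (s : ZMod n) * h7 - (t * k / p : ℕ) * h6

/-- A suitable power of the rotation has prime order `p`. If it fixes a diagonal then `p = 2`;
otherwise `p` divides `n` and `n - 5`, hence `p = 5`. In either case, apart from `n = 5`, there is a
chord of length `n / p`, and `mul_eq_zero_of_side` bounds the order of the original rotation, not
only of its power. -/
theorem mul_eq_zero_of_fixed [NeZero n] (hn : 5 ≤ n) {i : ZMod n} (hi : i ≠ 0) {Φ : Dissection n}
    (h : DihedralGroup.r i • Φ = Φ) (hk : #Φ.diagonals = n - 5) : 2 * i = 0 ∨ 5 * i = 0 := by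
  obtain ⟨p, hp, hpd⟩ := Nat.exists_prime_and_dvd (n := addOrderOf i)
    (by rwa [ne_eq, AddMonoid.addOrderOf_eq_one_iff])
  obtain ⟨s, hs⟩ : p ∣ n := hpd.trans (by
    rw [addOrderOf_dvd_iff_nsmul_eq_zero, nsmul_eq_mul, ZMod.natCast_self, zero_mul])
  have hs1 : 1 ≤ s := Nat.pos_of_ne_zero fun h0 => by
    rw [h0, mul_zero] at hs
    omega
  have hrot : DihedralGroup.r (s : ZMod n) • Φ = Φ := by
    obtain ⟨q, hq⟩ := hpd
    have hq0 : q ≠ 0 := by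
      rintro rfl
      rw [mul_zero] at hq
      exact (addOrderOf_pos i).ne' hq
    set j : ZMod n := (q : ZMod n) * i with hj
    have hjfix : DihedralGroup.r j • Φ = Φ := r_natCast_mul_smul h q
    have hj0 : j ≠ 0 := by
      intro h0
      have : addOrderOf i ∣ q := by
        rw [addOrderOf_dvd_iff_nsmul_eq_zero, nsmul_eq_mul]
        exact h0
      have := Nat.le_of_dvd (Nat.pos_of_ne_zero hq0) this
      rw [hq] at this
      have h2 := Nat.mul_le_mul_right q hp.two_le
      omega
    have hpj : (p : ZMod n) * j = 0 := by
      rw [hj, ← mul_assoc, ← Nat.cast_mul, ← hq, ← nsmul_eq_mul, addOrderOf_nsmul_eq_zero]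
    exact r_smul_eq_of_order_prime hp hs hj0 hpj hjfix
  rcases dvd_card_or_exists_fixed hp (r_pow_eq_one hs) hrot with h1 | ⟨e, he, hfix⟩
  · have h5 : p ∣ 5 := by
      rw [hk] at h1
      have := (Nat.dvd_sub (Dvd.intro s hs.symm : p ∣ n) h1)
      rwa [Nat.sub_sub_self hn] at this
    obtain rfl : p = 5 := (Nat.prime_dvd_prime_iff_eq hp Nat.prime_five).1 h5
    right
    rcases Nat.lt_or_ge s 2 with h2 | h2
    -- For `n = 5` the dissection is empty and has no chord, but `5` is already zero.
    · obtain rfl : s = 1 := by omega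
      rw [mul_one] at hs
      have h6 : ((5 : ℕ) : ZMod n) = 0 := by rw [← hs, ZMod.natCast_self]
      push_cast at h6
      rw [h6, zero_mul]
    · obtain ⟨x, hx⟩ := exists_side_five hs h2 hrot hk
      exact_mod_cast mul_eq_zero_of_side hs (by omega) h2 hrot hx h
  · obtain ⟨rfl, x, rfl⟩ := exists_side_of_fixed hs hp.two_le hs1 hfix
    left
    exact_mod_cast mul_eq_zero_of_side hs le_rfl (by omega) hrot he h

theorem card_fixed_half_turn [NeZero n] (hn : n = 2 * s) (hs : 3 ≤ s) :
    (Nat.card {Φ : Dissection n // DihedralGroup.r (s : ZMod n) • Φ = Φ ∧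
      #Φ.diagonals = n - 5} : ℚ) = s * (((s : ℚ) - 2) / 2 * catalan (s - 1)) := by
  rw [card_fixed_eq_mul hn le_rfl (by omega) fun Φ h hk => exists_side_two hn hs h hk]
  have h1 : #(sectorOrbit n 2 s (0, s)) = 1 := by
    rw [card_eq_one]
    refine ⟨(0, s), ?_⟩
    ext e
    rw [mem_sectorOrbit, mem_singleton, Prod.ext_iff]
    dsimp only
    constructor
    · rintro ⟨i, hi, h⟩
      interval_cases i <;> omega
    · exact fun h => ⟨0, by omega, by omega⟩
  -- The diameter and `s - 3` diagonals in each half add up to `2 * s - 5 = n - 5`: each half lacks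
  -- one diagonal.
  have h2 := card_fixed_sector hn le_rfl (by omega) (s - 2 - 1)
  rw [h1, show 1 + 2 * (s - 2 - 1) = n - 5 by omega, coeff_dissectionPoly (by omega),
    defectPoly_coeff_one (by omega)] at h2
  rw [Nat.cast_mul, h2, Nat.cast_sub (by omega)]
  push_cast
  ring

theorem card_fixed_fifth_turn [NeZero n] (hn : n = 5 * s) (hs : 1 ≤ s) :
    (Nat.card {Φ : Dissection n // DihedralGroup.r (s : ZMod n) • Φ = Φ ∧
      #Φ.diagonals = n - 5} : ℚ) = s * catalan (s - 1) := by
  rcases Nat.lt_or_ge s 2 with h | h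
  · obtain rfl : s = 1 := by omega
    have hempty : ∀ Φ : Dissection n, #Φ.diagonals = n - 5 ↔ Φ.diagonals = ∅ := by
      intro Φ
      rw [← card_eq_zero, show n - 5 = 0 by omega]
    have : Nat.card {Φ : Dissection n // DihedralGroup.r ((1 : ℕ) : ZMod n) • Φ = Φ ∧
        #Φ.diagonals = n - 5} = 1 := by
      rw [Nat.card_eq_one_iff_unique]
      refine ⟨⟨fun Φ Ψ => Subtype.ext (Dissection.ext ?_)⟩,
        ⟨⟨⟨∅, fun e he => absurd he (notMem_empty e), fun e he => absurd he (notMem_empty e)⟩,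
          ?_, ?_⟩⟩⟩
      · rw [(hempty _).1 Φ.2.2, (hempty _).1 Ψ.2.2]
      · rw [smul_eq_self_iff]
        exact fun e he => absurd he (notMem_empty e)
      · rw [hempty]
    rw [this]
    simp
  · rw [card_fixed_eq_mul hn (by omega) h fun Φ h' hk => exists_side_five hn h h' hk]
    have h1 : #(sectorOrbit n 5 s (0, s)) = 5 :=
      card_sectorOrbit hn h (mem_chords.2 (by dsimp only; omega)) (Or.inr (by omega))
    -- Five sides of the central pentagon and `s - 2` diagonals in each sector add up to `n - 5`:
    -- every sector is triangulated.
    have h2 := card_fixed_sector hn (by omega) h (s - 2 - 0)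
    rw [h1, show 5 + 5 * (s - 2 - 0) = n - 5 by omega, coeff_dissectionPoly (by omega),
      defectPoly_coeff_zero] at h2
    rw [Nat.cast_mul, h2]

end Rotations

end PolygonDissection

namespace PolygonDissection

/-! ### Dimension of the faces of the associahedron -/

section Associahedron

open Finset

variable {n : ℕ}

theorem lt_iff_diagonals {Φ Ψ : Dissection n} : Φ < Ψ ↔ Ψ.diagonals ⊂ Φ.diagonals := Iff.rfl

theorem exists_lt_of_card_lt [NeZero n] (Φ : Dissection n) (h : #Φ.diagonals < n - 3) :
    ∃ Ψ < Φ, #Ψ.diagonals = #Φ.diagonals + 1 := by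
  obtain ⟨e, he, heΦ, hi⟩ := (isPure_diagonals 0 (n - 1) (by omega) (code Φ) (code_subset Φ)
    (isIndep_code Φ)).2 (by rw [card_code]; omega)
  have hc := code_ofCode (n := n) _ (insert_subset he (code_subset Φ)) hi
  have hcard : #(ofCode (n := n) _ (insert_subset he (code_subset Φ)) hi).diagonals =
      #Φ.diagonals + 1 := by
    rw [← card_code, hc, card_insert_of_notMem heΦ, card_code]
  refine ⟨_, lt_iff_diagonals.2 (Finset.ssubset_iff_subset_ne.2 ⟨?_, ?_⟩), hcard⟩
  · rw [← image_code Φ]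
    exact image_subset_image (subset_insert _ _)
  · intro h
    rw [← h] at hcard
    omega

/-- A strictly smaller face has more diagonals and never more than `n - 3`; conversely, by purity, a
face short of a triangulation has a smaller face with exactly one diagonal more. -/
theorem height_eq [NeZero n] (hn : 3 ≤ n) (Φ : Dissection n) :
    Order.height Φ = ((n - 3 - #Φ.diagonals : ℕ) : ℕ∞) := by
  obtain ⟨d, hd⟩ : ∃ d, d = n - 3 - #Φ.diagonals := ⟨_, rfl⟩
  induction d using Nat.strong_induction_on generalizing Φ with
  | _ d ih =>
    have hlt : ∀ Ψ < Φ, n - 3 - #Ψ.diagonals < d := by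
      intro Ψ h
      have h1 := card_lt_card (lt_iff_diagonals.1 h)
      have h2 := card_diagonals_le hn Ψ
      omega
    rw [← hd]
    apply le_antisymm
    · rw [Order.height_le_coe_iff]
      intro Ψ h
      rw [ih _ (hlt Ψ h) Ψ rfl]
      exact_mod_cast hlt Ψ h
    · rcases Nat.eq_zero_or_pos d with h0 | h0
      · rw [h0]
        exact bot_le
      · obtain ⟨Ψ, hΨ, hc⟩ := exists_lt_of_card_lt Φ (by omega)
        refine le_trans ?_ (Order.height_add_one_le hΨ)
        rw [ih _ (hlt Ψ hΨ) Ψ rfl, ← Nat.cast_succ, Nat.cast_le, Nat.succ_eq_add_one]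
        omega

theorem associahedronFaces_two [NeZero n] (hn : 5 ≤ n) :
    associahedronFaces n 2 = kDissections n (n - 5) := by
  apply SetLike.ext
  intro Φ
  change Order.height Φ = ((2 : ℕ) : ℕ∞) ↔ #Φ.diagonals = n - 5
  rw [height_eq (by omega), Nat.cast_inj]
  have := card_diagonals_le (by omega) Φ
  omega

end Associahedron

/-! ### Burnside's lemma and conjugacy of reflections -/

section Burnside

open Finset

variable {n : ℕ}

/-- The number of dissections with `k` diagonals that are fixed by a symmetry. -/
noncomputable def fixedCount [NeZero n] (k : ℕ) (g : DihedralGroup n) : ℕ :=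
  Nat.card {Φ : Dissection n // g • Φ = Φ ∧ #Φ.diagonals = k}

theorem card_fixedBy [NeZero n] (k : ℕ) (g : DihedralGroup n) :
    Nat.card (MulAction.fixedBy (kDissections n k) g) = fixedCount k g :=
  Nat.card_congr
    { toFun := fun Φ => ⟨Φ.1.1, Subtype.ext_iff.1 Φ.2, Φ.1.2⟩
      invFun := fun Φ => ⟨⟨Φ.1, Φ.2.2⟩, Subtype.ext Φ.2.1⟩
      left_inv := fun _ => rfl
      right_inv := fun _ => rfl }

theorem sum_dihedralGroup [NeZero n] {M : Type*} [AddCommMonoid M] (f : DihedralGroup n → M) :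
    ∑ g, f g = ∑ i : ZMod n, f (DihedralGroup.r i) + ∑ i : ZMod n, f (DihedralGroup.sr i) := by
  rw [← Fintype.sum_equiv DihedralGroup.equivSum.symm
    (fun x => f (DihedralGroup.equivSum.symm x)) f fun _ => rfl, Fintype.sum_sum_type]
  rfl

theorem sum_fixedCount [NeZero n] (k : ℕ) :
    ∑ i : ZMod n, fixedCount k (DihedralGroup.r i) +
      ∑ i : ZMod n, fixedCount k (DihedralGroup.sr i) =
      dihedralClasses (kDissections n k) * (2 * n) := by
  classical
  have := Fintype.ofFinite (Dissection n)
  have := Fintype.ofFinite (kDissections n k)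
  have h := MulAction.sum_card_fixedBy_eq_card_orbits_mul_card_group (DihedralGroup n)
    (kDissections n k)
  rw [DihedralGroup.card, ← Nat.card_eq_fintype_card] at h
  simp only [← Nat.card_eq_fintype_card, card_fixedBy] at h
  rw [sum_dihedralGroup] at h
  exact h

theorem r_mem_rotations [NeZero n] (i : ZMod n) : DihedralGroup.r i ∈ rotations n :=
  Subgroup.mem_zpowers_iff.2 ⟨i.val, by simp⟩

theorem exists_r_of_mem_rotations {g : DihedralGroup n} (hg : g ∈ rotations n) :
    ∃ i, g = DihedralGroup.r i := by
  obtain ⟨k, rfl⟩ := Subgroup.mem_zpowers_iff.1 hg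
  exact ⟨_, DihedralGroup.r_one_zpow k⟩

theorem sum_fixedCount_rotations [NeZero n] (k : ℕ) :
    ∑ i : ZMod n, fixedCount k (DihedralGroup.r i) = cyclicClasses (kDissections n k) * n := by
  classical
  have := Fintype.ofFinite (Dissection n)
  have := Fintype.ofFinite (kDissections n k)
  have h := MulAction.sum_card_fixedBy_eq_card_orbits_mul_card_group (rotations n)
    (kDissections n k)
  let f : ZMod n → rotations n := fun i => ⟨DihedralGroup.r i, r_mem_rotations i⟩
  have hf : Function.Bijective f := by
    constructor
    · intro i j hij
      exact DihedralGroup.r.inj (Subtype.ext_iff.1 hij)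
    · rintro ⟨g, hg⟩
      obtain ⟨i, rfl⟩ := exists_r_of_mem_rotations hg
      exact ⟨i, rfl⟩
  have hcard : Fintype.card (rotations n) = n := by
    rw [← Fintype.card_of_bijective hf, ZMod.card]
  rw [hcard] at h
  simp only [← Nat.card_eq_fintype_card] at h
  rw [← hf.sum_comp] at h
  rw [cyclicClasses, ← h]
  exact sum_congr rfl fun i _ => (card_fixedBy k (DihedralGroup.r i)).symm

theorem fixedCount_conj [NeZero n] (k : ℕ) (g h : DihedralGroup n) :
    fixedCount k (h * g * h⁻¹) = fixedCount k g := by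
  refine (Nat.card_congr ((MulAction.toPerm h).subtypeEquiv fun Φ => ?_)).symm
  rw [MulAction.toPerm_apply, card_smul_diagonals, mul_smul, inv_smul_smul, mul_smul,
    smul_left_cancel_iff]

/-- Conjugation by a rotation by `j` shifts the index of a reflection by `2 * j`. -/
theorem fixedCount_sr [NeZero n] (k : ℕ) (i j : ZMod n) :
    fixedCount k (DihedralGroup.sr (i + 2 * j)) = fixedCount k (DihedralGroup.sr i) := by
  rw [← fixedCount_conj k (DihedralGroup.sr i) (DihedralGroup.r (-j)), DihedralGroup.inv_r,
    DihedralGroup.r_mul_sr, DihedralGroup.sr_mul_r]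
  congr 2
  ring

theorem sum_fixedCount_sr_of_odd [NeZero n] (hn : Odd n) (k : ℕ) :
    ∑ i : ZMod n, fixedCount k (DihedralGroup.sr i) =
      n * fixedCount k (DihedralGroup.sr (1 : ZMod n)) := by
  obtain ⟨h, hh⟩ := hn
  have h0 : ((2 * h + 1 : ℕ) : ZMod n) = 0 := by rw [← hh, ZMod.natCast_self]
  have : ∀ i : ZMod n, fixedCount k (DihedralGroup.sr i) =
      fixedCount k (DihedralGroup.sr (1 : ZMod n)) := by
    intro i
    -- `h + 1` is the inverse of `2` modulo `2 * h + 1`.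
    rw [← fixedCount_sr k 1 ((i - 1) * ((h + 1 : ℕ) : ZMod n))]
    congr 2
    push_cast at h0 ⊢
    linear_combination (1 - i) * h0
  rw [sum_congr rfl fun i _ => this i, sum_const, card_univ, ZMod.card, smul_eq_mul]

theorem sum_fixedCount_sr_of_even [NeZero n] (k : ℕ) :
    2 * ∑ i : ZMod n, fixedCount k (DihedralGroup.sr i) =
      n * (fixedCount k (DihedralGroup.sr (0 : ZMod n)) +
        fixedCount k (DihedralGroup.sr (1 : ZMod n))) := by
  have h1 : ∑ i : ZMod n, fixedCount k (DihedralGroup.sr (i + 1)) =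
      ∑ i : ZMod n, fixedCount k (DihedralGroup.sr i) :=
    Equiv.sum_comp (Equiv.addRight (1 : ZMod n)) fun i => fixedCount k (DihedralGroup.sr i)
  -- Of two consecutive indices one has an even and one an odd representative shifted from `0` or
  -- `1` by a multiple of `2`, so the sum over the pair does not depend on `i`.
  have h2 : ∀ i : ZMod n, fixedCount k (DihedralGroup.sr i) +
      fixedCount k (DihedralGroup.sr (i + 1)) = fixedCount k (DihedralGroup.sr (0 : ZMod n)) +
        fixedCount k (DihedralGroup.sr (1 : ZMod n)) := by
    intro i
    rw [← ZMod.natCast_zmod_val i]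
    rcases Nat.even_or_odd' i.val with ⟨q, hq | hq⟩ <;> rw [hq]
    · rw [← fixedCount_sr k 0 (q : ZMod n), ← fixedCount_sr k 1 (q : ZMod n)]
      push_cast
      congr 3 <;> ring
    · rw [← fixedCount_sr k 0 ((q : ZMod n) + 1), ← fixedCount_sr k 1 (q : ZMod n), add_comm]
      push_cast
      congr 3 <;> ring
  rw [two_mul]
  nth_rewrite 2 [← h1]
  rw [← sum_add_distrib, sum_congr rfl fun i _ => h2 i, sum_const, card_univ, ZMod.card,
    smul_eq_mul]

end Burnside

/-! ### Evaluation of the fixed-point counts -/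

section Evaluation

open Finset

variable {n : ℕ}

theorem catalan_succ_mul (k : ℕ) :
    ((k : ℚ) + 2) * catalan (k + 1) = (4 * k + 2) * catalan k := by
  have h1 := succ_mul_catalan_eq_centralBinom (k + 1)
  have h2 := succ_mul_catalan_eq_centralBinom k
  have h3 := Nat.succ_mul_centralBinom_succ k
  have h4 : ((k : ℚ) + 1 + 1) * catalan (k + 1) = (k + 1).centralBinom := by exact_mod_cast h1
  have h5 : ((k : ℚ) + 1) * catalan k = k.centralBinom := by exact_mod_cast h2
  have h6 : ((k : ℚ) + 1) * (k + 1).centralBinom = 2 * (2 * k + 1) * k.centralBinom := by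
    exact_mod_cast h3
  have h7 : (k : ℚ) + 1 ≠ 0 := by positivity
  apply mul_left_cancel₀ h7
  rw [← h4, ← h5] at h6
  linear_combination h6

theorem C_natCast (k : ℕ) : C (k : ℚ) = catalan k := by
  simp [C]

theorem C_eq_zero {q : ℚ} (h : ∀ z : ℤ, q ≠ z) : C q = 0 := by
  rw [C, if_neg]
  rintro ⟨h1, _⟩
  exact h q.num ((Rat.den_eq_one_iff q).1 h1).symm

theorem C_div_sub_one {p s : ℕ} (hp : p ≠ 0) (hs : 1 ≤ s) (hn : n = p * s) :
    C ((n : ℚ) / p - 1) = catalan (s - 1) := by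
  have hp' : (p : ℚ) ≠ 0 := by exact_mod_cast hp
  rw [← C_natCast, Nat.cast_sub hs, hn]
  congr 1
  push_cast
  field_simp

theorem C_div_sub_one_eq_zero {p : ℕ} (hp : p ≠ 0) (hn : ¬ p ∣ n) : C ((n : ℚ) / p - 1) = 0 := by
  have hp' : (p : ℚ) ≠ 0 := by exact_mod_cast hp
  refine C_eq_zero fun z hz => hn ?_
  have h1 : (n : ℚ) = p * (z + 1) := by
    rw [← hz]
    field_simp
    ring
  have h2 : (n : ℤ) = p * (z + 1) := by exact_mod_cast h1
  exact Int.natCast_dvd_natCast.1 ⟨z + 1, h2⟩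

/-- The sum over the rotations of prime order `p`. -/
theorem sum_fixedCount_order_prime [NeZero n] {p s : ℕ} (hp : p.Prime) (hn : n = p * s) (k : ℕ) :
    ∑ i : ZMod n with i ≠ 0 ∧ (p : ZMod n) * i = 0, fixedCount k (DihedralGroup.r i) =
      (p - 1) * fixedCount k (DihedralGroup.r (s : ZMod n)) := by
  have hn0 : n ≠ 0 := NeZero.ne n
  have hs : 0 < s := Nat.pos_of_ne_zero fun h => hn0 (by rw [hn, h, mul_zero])
  have hset : ({i : ZMod n | i ≠ 0 ∧ (p : ZMod n) * i = 0} : Finset (ZMod n)) =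
      (Ioo 0 p).image fun t => ((t * s : ℕ) : ZMod n) := by
    ext i
    rw [mem_filter, mem_image, and_iff_right (mem_univ _)]
    constructor
    · rintro ⟨hi, hpi⟩
      have hdvd : s ∣ i.val := by
        rw [← ZMod.natCast_zmod_val i, ← Nat.cast_mul, ZMod.natCast_eq_zero_iff] at hpi
        exact Nat.dvd_of_mul_dvd_mul_left hp.pos (hn.symm.dvd.trans hpi)
      obtain ⟨t, ht⟩ := hdvd
      refine ⟨t, mem_Ioo.2 ⟨Nat.pos_of_ne_zero fun h => hi ?_, ?_⟩, ?_⟩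
      · rw [h, mul_zero] at ht
        exact (ZMod.val_eq_zero i).1 ht
      · have h1 : s * t < p * s := by
          rw [← ht, ← hn]
          exact ZMod.val_lt i
        rw [mul_comm] at h1
        exact Nat.lt_of_mul_lt_mul_right h1
      · rw [mul_comm, ← ht, ZMod.natCast_zmod_val]
    · rintro ⟨t, ht, rfl⟩
      rw [mem_Ioo] at ht
      constructor
      · rw [ne_eq, ZMod.natCast_eq_zero_iff, hn]
        exact fun h => absurd (Nat.le_of_dvd ht.1 (Nat.dvd_of_mul_dvd_mul_right hs h)) (by omega)
      · rw [← Nat.cast_mul, ZMod.natCast_eq_zero_iff, hn]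
        exact ⟨t, by ring⟩
  have hconst : ∀ i ∈ ({i : ZMod n | i ≠ 0 ∧ (p : ZMod n) * i = 0} : Finset (ZMod n)),
      fixedCount k (DihedralGroup.r i) = fixedCount k (DihedralGroup.r (s : ZMod n)) := by
    intro i hi
    have hi' := (mem_filter.1 hi).2
    rw [hset] at hi
    obtain ⟨t, -, rfl⟩ := mem_image.1 hi
    refine Nat.card_congr (Equiv.subtypeEquivRight fun Φ => and_congr_left fun _ =>
      ⟨fun h => r_smul_eq_of_order_prime hp hn hi'.1 hi'.2 h, fun h => ?_⟩)
    rw [Nat.cast_mul]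
    exact r_natCast_mul_smul h t
  rw [sum_congr rfl hconst, sum_const, smul_eq_mul, hset, card_image_of_injOn, Nat.card_Ioo,
    Nat.sub_zero]
  intro t ht t' ht' h
  rw [coe_Ioo, Set.mem_Ioo] at ht ht'
  have v : ∀ t < p, ((t * s : ℕ) : ZMod n).val = t * s := fun t ht =>
    ZMod.val_natCast_of_lt (lt_of_lt_of_eq (Nat.mul_lt_mul_of_pos_right ht hs) hn.symm)
  have h1 := congrArg ZMod.val h
  dsimp only at h1
  rw [v t ht.2, v t' ht'.2] at h1
  exact Nat.eq_of_mul_eq_mul_right hs h1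

theorem sum_fixedCount_order_prime_of_not_dvd [NeZero n] {p : ℕ} (hp : p.Prime) (hn : ¬ p ∣ n)
    (k : ℕ) :
    ∑ i : ZMod n with i ≠ 0 ∧ (p : ZMod n) * i = 0, fixedCount k (DihedralGroup.r i) = 0 := by
  rw [filter_false_of_mem, sum_empty]
  rintro i - ⟨hi, hpi⟩
  apply hi
  rw [← ZMod.natCast_zmod_val i, ← Nat.cast_mul, ZMod.natCast_eq_zero_iff] at hpi
  rw [← ZMod.natCast_zmod_val i, ZMod.natCast_eq_zero_iff]
  exact ((Nat.Prime.coprime_iff_not_dvd hp).2 hn).symm.dvd_of_dvd_mul_left hpi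

theorem sum_fixedCount_r [NeZero n] (hn : 5 ≤ n) :
    ∑ i : ZMod n, fixedCount (n - 5) (DihedralGroup.r i) =
      fixedCount (n - 5) (1 : DihedralGroup n) +
      ∑ i : ZMod n with i ≠ 0 ∧ ((2 : ℕ) : ZMod n) * i = 0,
        fixedCount (n - 5) (DihedralGroup.r i) +
      ∑ i : ZMod n with i ≠ 0 ∧ ((5 : ℕ) : ZMod n) * i = 0,
        fixedCount (n - 5) (DihedralGroup.r i) := by
  rw [sum_filter, sum_filter, add_assoc, ← sum_add_distrib,
    ← Fintype.sum_ite_eq' (0 : ZMod n) fun _ => fixedCount (n - 5) (1 : DihedralGroup n),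
    ← sum_add_distrib]
  refine sum_congr rfl fun i _ => ?_
  push_cast
  by_cases h0 : i = 0
  · subst h0
    simp
  · have h25 : ¬ (2 * i = 0 ∧ 5 * i = 0) := fun h => h0 (by linear_combination h.2 - 2 * h.1)
    by_cases h2 : 2 * i = 0
    · simp only [h0, h2, ne_eq, not_false_eq_true, true_and, if_true, if_false]
      rw [if_neg fun h => h25 ⟨h2, h⟩, zero_add, add_zero]
    · by_cases h5 : 5 * i = 0
      · simp [h0, h2, h5]
      · have : fixedCount (n - 5) (DihedralGroup.r i) = 0 := by
          rw [fixedCount, Nat.card_eq_zero]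
          left
          refine ⟨fun Φ => ?_⟩
          rcases mul_eq_zero_of_fixed hn h0 Φ.2.1 Φ.2.2 with h | h
          · exact h2 h
          · exact h5 h
        simp [h0, h2, h5, this]

theorem fixedCount_one [NeZero n] (hn : 5 ≤ n) :
    (fixedCount (n - 5) (1 : DihedralGroup n) : ℚ) =
      ((n : ℚ) - 3) ^ 2 * ((n : ℚ) - 4) / (4 * (2 * (n : ℚ) - 5)) * C ((n : ℚ) - 2) := by
  obtain ⟨k, rfl⟩ := Nat.exists_eq_add_of_le hn
  have h1 := card_dissections (n := 5 + k) (5 + k - 5)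
  have h2 := coeff_dissectionPoly (m := 5 + k - 1) (d := 2) (by omega)
  rw [show 5 + k - 1 - 2 - 2 = 5 + k - 5 by omega, show 5 + k - 1 - 1 = k + 2 + 1 by omega] at h2
  have h3 := defectPoly_coeff_two (k + 2)
  -- Here `n = k + 5`; this relation eliminates the Catalan number with index `n - 3`, and its
  -- factor `4 * (k + 2) + 2 = 2 * (2 * n - 5)` is the source of the denominator.
  have h4 := catalan_succ_mul (k + 2)
  rw [fixedCount, h1, h2, show ((5 + k : ℕ) : ℚ) - 2 = ((k + 2 + 1 : ℕ) : ℚ) by push_cast; ring,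
    C_natCast]
  push_cast at h3 h4 ⊢
  have h5 : (2 * (5 + (k : ℚ)) - 5) ≠ 0 := by
    have : (0 : ℚ) ≤ k := Nat.cast_nonneg k
    linarith
  rw [eq_comm, div_mul_eq_mul_div, div_eq_iff (mul_ne_zero four_ne_zero h5)]
  linear_combination -(2 * (k : ℚ) + 5) / 4 * h3 - 1 / 4 * h4

theorem sum_fixedCount_r_eq [NeZero n] (hn : 5 ≤ n) :
    ((∑ i : ZMod n, fixedCount (n - 5) (DihedralGroup.r i) : ℕ) : ℚ) =
      ((n : ℚ) - 3) ^ 2 * ((n : ℚ) - 4) / (4 * (2 * (n : ℚ) - 5)) * C ((n : ℚ) - 2) +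
      n * ((n : ℚ) - 4) / 8 * C ((n : ℚ) / 2 - 1) + 4 * n / 5 * C ((n : ℚ) / 5 - 1) := by
  rw [sum_fixedCount_r hn]
  push_cast [fixedCount_one hn]
  congr 1
  · congr 1
    by_cases h : 2 ∣ n
    · obtain ⟨s, hs⟩ := h
      have h1 := sum_fixedCount_order_prime Nat.prime_two hs (n - 5)
      have h2 := C_div_sub_one (n := n) two_ne_zero (show 1 ≤ s by omega) hs
      have h3 := card_fixed_half_turn hs (by omega)
      push_cast at h1 h2
      rw [← Nat.cast_sum, h1, h2, Nat.cast_mul, fixedCount, h3]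
      have : (n : ℚ) = 2 * s := by exact_mod_cast hs
      rw [this]
      push_cast
      ring
    · have h1 := sum_fixedCount_order_prime_of_not_dvd Nat.prime_two h (n - 5)
      have h2 := C_div_sub_one_eq_zero two_ne_zero h
      push_cast at h1 h2
      rw [← Nat.cast_sum, h1, h2]
      simp
  · by_cases h : 5 ∣ n
    · obtain ⟨s, hs⟩ := h
      have h1 := sum_fixedCount_order_prime Nat.prime_five hs (n - 5)
      have h2 := C_div_sub_one (n := n) (p := 5) (by omega) (show 1 ≤ s by omega) hs
      have h3 := card_fixed_fifth_turn hs (by omega)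
      push_cast at h1 h2
      rw [← Nat.cast_sum, h1, h2, Nat.cast_mul, fixedCount, h3]
      have : (n : ℚ) = 5 * s := by exact_mod_cast hs
      rw [this]
      push_cast
      ring
    · have h1 := sum_fixedCount_order_prime_of_not_dvd Nat.prime_five h (n - 5)
      have h2 := C_div_sub_one_eq_zero (p := 5) (by omega) h
      push_cast at h1 h2
      rw [← Nat.cast_sum, h1, h2]
      simp

theorem sum_fixedCount_sr_even [NeZero n] {s : ℕ} (hn : n = 2 * s) (hs : 3 ≤ s) :
    ((∑ i : ZMod n, fixedCount (n - 5) (DihedralGroup.sr i) : ℕ) : ℚ) =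
      (n : ℚ) ^ 2 * (n - 4) / (4 * (n - 3)) * C ((n : ℚ) / 2 - 1) := by
  have h1 := card_fixed_sr_one (n := n) (h := s - 1) (by omega) (by omega) (n - 5)
  have h2 := card_fixed_sr_zero hn (n - 5)
  have h3 := coeff_foldPoly (m := s - 1 + 1) (d := 1) (by omega) (by omega)
  have h4 := coeff_indepSum_axis hs
  have h5 := C_div_sub_one (n := n) two_ne_zero (show 1 ≤ s by omega) hn
  have h6 := sum_fixedCount_sr_of_even (n := n) (n - 5)
  -- For an axis without vertices the full weight of the folded polygon is `n - 4`, so the defect is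
  -- `1`; an axis through two vertices is covered by `coeff_indepSum_axis`.
  rw [show 2 * (s - 1 + 1 - 2) - 1 = n - 5 by omega, foldDefectPoly_coeff_one (by omega)] at h3
  rw [show 2 * s - 5 = n - 5 by omega] at h4
  obtain ⟨k, rfl⟩ := Nat.exists_eq_add_of_le hs
  rw [show 3 + k - 1 = k + 1 + 1 by omega] at *
  rw [foldDefectPoly_coeff_three (by omega), defectPoly_coeff_one (by omega)] at h4
  rw [show k + 1 + 1 + 1 - 2 = k + 1 by omega] at h3
  rw [h3] at h1
  rw [h4] at h2
  have h7 := catalan_succ_mul (k + 1)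
  have h8 : 2 * ((∑ i : ZMod n, fixedCount (n - 5) (DihedralGroup.sr i) : ℕ) : ℚ) =
      n * (fixedCount (n - 5) (DihedralGroup.sr (0 : ZMod n)) +
        fixedCount (n - 5) (DihedralGroup.sr (1 : ZMod n))) := by exact_mod_cast h6
  rw [fixedCount, fixedCount, h1, h2] at h8
  push_cast at h5 h7 h8 ⊢
  have hk : (n : ℚ) = 2 * (3 + k) := by exact_mod_cast hn
  have h9 : 2 * (k : ℚ) + 3 ≠ 0 := by positivity
  rw [h5]
  rw [hk] at h8 ⊢
  rw [show 2 * (3 + (k : ℚ)) - 3 = 2 * k + 3 by ring, div_mul_eq_mul_div,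
    eq_div_iff (mul_ne_zero four_ne_zero h9)]
  linear_combination 2 * (2 * (k : ℚ) + 3) * h8 + 4 * (3 + (k : ℚ)) * h7

theorem sum_fixedCount_sr_odd [NeZero n] {h : ℕ} (hn : n = 2 * h + 1) (hh : 2 ≤ h) :
    ((∑ i : ZMod n, fixedCount (n - 5) (DihedralGroup.sr i) : ℕ) : ℚ) =
      n * ((n : ℚ) ^ 2 - 2 * n - 11) / (4 * (n - 4)) * C (((n : ℚ) - 3) / 2) := by
  have h1 := card_fixed_sr_one (n := n) (h := h) (by omega) (by omega) (n - 5)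
  have h3 := coeff_foldPoly (m := h + 1) (d := 2) (by omega) (by omega)
  -- For odd `n` the full weight is `n - 3`, so the defect is `2`.
  rw [show 2 * (h + 1 - 2) - 2 = n - 5 by omega] at h3
  obtain ⟨k, rfl⟩ := Nat.exists_eq_add_of_le hh
  rw [show 2 + k + 1 - 2 = k + 1 by omega, foldDefectPoly_coeff_two] at h3
  have hk : (n : ℚ) = 2 * (2 + k) + 1 := by exact_mod_cast hn
  have h4 := catalan_succ_mul k
  rw [sum_fixedCount_sr_of_odd ⟨_, hn⟩, Nat.cast_mul, fixedCount, h1, h3,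
    show ((n : ℚ) - 3) / 2 = ((k + 1 : ℕ) : ℚ) by rw [hk]; push_cast; ring, C_natCast, hk]
  have h5 : 2 * (k : ℚ) + 1 ≠ 0 := by positivity
  rw [show 2 * (2 + (k : ℚ)) + 1 - 4 = 2 * k + 1 by ring, eq_comm, div_mul_eq_mul_div,
    div_eq_iff (mul_ne_zero four_ne_zero h5)]
  linear_combination -2 * (2 * (k : ℚ) + 5) * h4

end Evaluation

end PolygonDissection

theorem theorem3 (n : ℕ) [NeZero n] (hn : 5 ≤ n) :
    -- the `(n - 5)`-dissections modulo the cyclic action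
    (PolygonDissection.cyclicClasses (PolygonDissection.kDissections n (n - 5)) : ℚ) =
        ((n : ℚ) - 3) ^ 2 * ((n : ℚ) - 4) / (4 * (n : ℚ) * (2 * (n : ℚ) - 5)) *
            PolygonDissection.C ((n : ℚ) - 2)
          + ((n : ℚ) - 4) / 8 * PolygonDissection.C ((n : ℚ) / 2 - 1)
          + 4 / 5 * PolygonDissection.C ((n : ℚ) / 5 - 1) ∧
    -- the `(n - 5)`-dissections modulo the dihedral action
    (Even n →
      (PolygonDissection.dihedralClasses (PolygonDissection.kDissections n (n - 5)) : ℚ) =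
        ((n : ℚ) - 3) ^ 2 * ((n : ℚ) - 4) / (8 * (n : ℚ) * (2 * (n : ℚ) - 5)) *
            PolygonDissection.C ((n : ℚ) - 2)
          + 2 / 5 * PolygonDissection.C ((n : ℚ) / 5 - 1)
          + 3 * ((n : ℚ) - 4) * ((n : ℚ) - 1) / (16 * ((n : ℚ) - 3)) *
            PolygonDissection.C ((n : ℚ) / 2 - 1)) ∧
    (Odd n →
      (PolygonDissection.dihedralClasses (PolygonDissection.kDissections n (n - 5)) : ℚ) =
        ((n : ℚ) - 3) ^ 2 * ((n : ℚ) - 4) / (8 * (n : ℚ) * (2 * (n : ℚ) - 5)) *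
            PolygonDissection.C ((n : ℚ) - 2)
          + 2 / 5 * PolygonDissection.C ((n : ℚ) / 5 - 1)
          + ((n : ℚ) ^ 2 - 2 * (n : ℚ) - 11) / (8 * ((n : ℚ) - 4)) *
            PolygonDissection.C (((n : ℚ) - 3) / 2)) ∧
    -- the same numbers count the classes of two-dimensional faces of the associahedron
    PolygonDissection.cyclicClasses (PolygonDissection.associahedronFaces n 2) =
      PolygonDissection.cyclicClasses (PolygonDissection.kDissections n (n - 5)) ∧
    PolygonDissection.dihedralClasses (PolygonDissection.associahedronFaces n 2) =
      PolygonDissection.dihedralClasses (PolygonDissection.kDissections n (n - 5)) := by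
  have hr := PolygonDissection.sum_fixedCount_r_eq hn
  have hc := PolygonDissection.sum_fixedCount_rotations (n := n) (n - 5)
  have hd := PolygonDissection.sum_fixedCount (n := n) (n - 5)
  have h0 : (n : ℚ) ≠ 0 := Nat.cast_ne_zero.2 (NeZero.ne n)
  have h5 : (5 : ℚ) ≤ n := by exact_mod_cast hn
  have h1 : 2 * (n : ℚ) - 5 ≠ 0 := by linarith
  have hd' : ((∑ i : ZMod n, PolygonDissection.fixedCount (n - 5) (DihedralGroup.r i) : ℕ) : ℚ) +
      ((∑ i : ZMod n, PolygonDissection.fixedCount (n - 5) (DihedralGroup.sr i) : ℕ) : ℚ) =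
      PolygonDissection.dihedralClasses (PolygonDissection.kDissections n (n - 5)) * (2 * n) := by
    exact_mod_cast hd
  refine ⟨?_, fun he => ?_, fun ho => ?_, ?_, ?_⟩
  · rw [hc, Nat.cast_mul] at hr
    apply mul_right_cancel₀ h0
    rw [hr]
    field_simp
  · obtain ⟨s, hs⟩ := even_iff_two_dvd.1 he
    have h3 : (n : ℚ) - 3 ≠ 0 := by linarith
    rw [hr, PolygonDissection.sum_fixedCount_sr_even hs (by omega)] at hd'
    apply mul_right_cancel₀ (mul_ne_zero two_ne_zero h0)
    rw [← hd']
    field_simp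
    ring
  · obtain ⟨h, hh⟩ := ho
    have h4 : (n : ℚ) - 4 ≠ 0 := by linarith
    -- For odd `n` there is no half-turn, and the corresponding Catalan term vanishes.
    have h2 := PolygonDissection.C_div_sub_one_eq_zero (n := n) (p := 2) two_ne_zero (by omega)
    rw [Nat.cast_two] at h2
    rw [hr, PolygonDissection.sum_fixedCount_sr_odd hh (by omega), h2] at hd'
    apply mul_right_cancel₀ (mul_ne_zero two_ne_zero h0)
    rw [← hd']
    field_simp
    ring
  · rw [PolygonDissection.associahedronFaces_two hn]
  · rw [PolygonDissection.associahedronFaces_two hn]
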